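/- Let $0<c_1\le c_2\le 1$ and $0<\delta<1$. There is a constant $C>0$, depending only on $c_1,c_2,\delta$, such that the following holds. Let $d\ge 2$, let $A\in\mathbb R^{d\times d}$ be symmetric positive semidefinite with eigenvalues $1\ge\rho_1>\rho_2\ge\dots\ge\rho_d\ge0$ and corresponding orthonormal eigenvectors $p_1,\dots,p_d$, put $\Delta=\rho_1-\rho_2$, let $\tilde\Delta\in[c_1\Delta,c_2\Delta]$ and $\epsilon\in(0,1)$. Algorithm. Start from a uniformly random unit vector $w$ and the shift $\lambda=1+\tilde\Delta$. "Solving the least squares problem for $(\lambda,w)$ with ratio $R$" means: run an iterative solver on $f(x)=\frac12x^\top(\lambda I-A)x-w^\top x$ from $x_0=w/(w^\top(\lambda I-A)w)$ until the first iterate $x$ with $f(x)-\min f\le (f(x_0)-\min f)/R$. A power step with ratio $R$ replaces $w$ by $x/\|x\|$ for this $x$. Phase I: put $m_1=\lceil 8\log(16/(w_0^\top p_1)^2)\rceil$, where $w_0$ is the initial vector, and repeat: make $m_1$ power steps with ratio $32\cdot10^{2m_1+1}/\tilde\Delta^{2m_1}$; solve the least squares problem for $(\lambda,w)$ with ratio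 $1024/\tilde\Delta^2$, obtaining $u$; put $\Delta_s=\frac12\big/\big(w^\top u-\frac18(1+\frac{1-c_2}{c_2}\tilde\Delta)\big)$ and replace $\lambda$ by $\lambda-\Delta_s/2$; until $\Delta_s\le\tilde\Delta$. Phase II: with the final $\lambda$ and $w$ of Phase I, put $G_0=\big(\sum_{i\ge2}(\lambda-\rho_i)(w^\top p_i)^2\big)^{1/2}\big/\big((\lambda-\rho_1)(w^\top p_1)^2\big)^{1/2}$, make $\max\big(0,\lceil\frac12\log_{9/7}(G_0^2/\epsilon)\rceil\big)$ power steps with ratio $100\max(G_0,1)$ (none if $G_0=0$), and output $w$. Solvers (one coordinate update per step, $L_i=\lambda-A_{ii}$). GSL: $x\leftarrow x-\frac1{L_j}\nabla_jf(x)e_j$ with $j\in\arg\max_i|\nabla_if(x)|/\sqrt{L_i}$ (ties broken by any rule). NU-ACDM, with $\mu=\lambda-\rho_1$, $S=\sum_i\sqrt{L_i}$, $\tau=2/(1+\sqrt{4S^2/\mu+1})$, $\eta=1/(\tau S^2)$ and $y=z=x_0$ initially: $x\leftarrow\tau z+(1-\tau)y$; sample $i$ with probability $q_i=\sqrt{L_i}/S$,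 independently of everything before; $y\leftarrow x-\frac1{L_i}\nabla_if(x)e_i$; $z\leftarrow\frac1{1+\eta\mu}\big(z+\eta\mu x-\frac{\eta}{q_i}\nabla_if(x)e_i\big)$; the iterates are the vectors $y$. Cost is the total number of elementary operations (real arithmetic operations, square roots, absolute values, comparisons) in all the coordinate updates and in the vector operations around them; the evaluation of $m_1$, of $G_0$ and the number of power steps in Phase II, of the ratios, and of the quantities in the solvers' exit test (which is charged one comparison) is not charged. Claim. Put $$K_{\mathrm{GSL}}=\frac{\rho_1-\frac1d\sum_{i=1}^d\rho_i}{\rho_1-\rho_2},\qquad K_{\mathrm{ACDM}}=\frac{\frac1d\sum_{i=1}^d\sqrt{\rho_1-A_{ii}}}{\sqrt{\rho_1-\rho_2}},\qquad Q=\big(\log d\cdot(1+\log\tfrac1\Delta)\big)^2 .$$ For each of the two solvers, with the corresponding $K$, with probability at least $1-\delta$ the algorithm terminates and all of the following hold: its output $w$ satisfies $(w^\top p_1)^2\ge1-\epsilon$; Phase II costs at most $C\,K\,d^2\log\frac d\epsilon$; Phase I costs at most $C\,K\,d^2\,Q$, which does not depend on $\epsilon$; and, whenever $\epsilon$ is so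 small that $\log\frac d\epsilon\ge Q$, the whole algorithm costs at most $C\,K\,d^2\log\frac d\epsilon$. That is, the runtime is $O\big(\frac{\rho_1-\frac1d\sum_i\rho_i}{\rho_1-\rho_2}d^2\log\frac d\epsilon\big)$ with GSL and $O\big(\frac{\frac1d\sum_i\sqrt{\rho_1-A_{ii}}}{\sqrt{\rho_1-\rho_2}}d^2\log\frac d\epsilon\big)$ with NU-ACDM. -/

import Mathlib

open MeasureTheory

/-!
Real-number arithmetic with a count of elementary operations.  `ops = ⊤` stands for a computation
that does not terminate.
-/

/-- A result together with the number of elementary operations (real arithmetic operations,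
square roots, absolute values, comparisons) spent on it. -/
structure Counted (α : Type) where
  val : α
  ops : ℕ∞

namespace Counted

instance : Monad Counted where
  pure a := ⟨a, 0⟩
  bind m f := ⟨(f m.val).val, m.ops + (f m.val).ops⟩

/-- A number that is already available costs nothing. -/
def num (a : ℝ) : Counted ℝ := ⟨a, 0⟩

noncomputable instance : Add (Counted ℝ) := ⟨fun a b => ⟨a.val + b.val, a.ops + b.ops + 1⟩⟩
noncomputable instance : Sub (Counted ℝ) := ⟨fun a b => ⟨a.val - b.val, a.ops + b.ops + 1⟩⟩
noncomputable instance : Mul (Counted ℝ) := ⟨fun a b => ⟨a.val * b.val, a.ops + b.ops + 1⟩⟩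
noncomputable instance : Div (Counted ℝ) := ⟨fun a b => ⟨a.val / b.val, a.ops + b.ops + 1⟩⟩

noncomputable def sqrtC (a : Counted ℝ) : Counted ℝ := ⟨Real.sqrt a.val, a.ops + 1⟩

noncomputable def absC (a : Counted ℝ) : Counted ℝ := ⟨|a.val|, a.ops + 1⟩

/-- Compute all entries of a vector, one after the other. -/
noncomputable def vec {d : ℕ} (f : Fin d → Counted ℝ) : Counted (Fin d → ℝ) :=
  ⟨fun i => (f i).val, ∑ i, (f i).ops⟩

/-- Compute `d` numbers and add them up. -/
noncomputable def sum {d : ℕ} (f : Fin d → Counted ℝ) : Counted ℝ :=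
  ⟨∑ i, (f i).val, ∑ i, ((f i).ops + 1)⟩

/-- `for`-loop: run `body` exactly `n` times. -/
noncomputable def repeatN {α : Type} (body : α → Counted α) (s : α) : ℕ → Counted α
  | 0 => pure s
  | n + 1 => repeatN body s n >>= body

open Classical in
/-- Run `body` until `exitTest` holds for the first time (possibly zero times).  Every evaluation of
the test is charged one operation; if the test never succeeds, the cost is infinite. -/
noncomputable def loopUntil {α : Type} (exitTest : α → Prop) (body : α → Counted α) (s : α) :
    Counted α :=
  if h : ∃ n, exitTest (repeatN body s n).val then
    ⟨(repeatN body s (Nat.find h)).val, (repeatN body s (Nat.find h)).ops + (Nat.find h + 1 : ℕ)⟩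
  else ⟨s, ⊤⟩

/-- The computation terminates after at most `B` operations. -/
def CostAtMost {α : Type} (m : Counted α) (B : ℝ) : Prop :=
  ∃ n : ℕ, m.ops = (n : ℕ∞) ∧ (n : ℝ) ≤ B

/-- Inner product `xᵀ y`. -/
noncomputable def dot {d : ℕ} (x y : Fin d → ℝ) : Counted ℝ :=
  sum fun i => num (x i) * num (y i)

/-- `w / ‖w‖` (Euclidean norm). -/
noncomputable def normalize {d : ℕ} (w : Fin d → ℝ) : Counted (Fin d → ℝ) := do
  let r ← sqrtC (dot w w)
  vec fun i => num (w i) / num r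

/-- `(λ I - A) x`. -/
noncomputable def mulShifted {d : ℕ} (A : Matrix (Fin d) (Fin d) ℝ) (lam : ℝ) (x : Fin d → ℝ) :
    Counted (Fin d → ℝ) :=
  vec fun i => num lam * num (x i) - dot (A i) x

end Counted

open Counted

/-! ### The least squares problems and their iterative solvers -/

/-- `f(x) = ½ xᵀ (λ I - A) x - yᵀ x`. -/
noncomputable def lsqObjective {d : ℕ} (A : Matrix (Fin d) (Fin d) ℝ) (lam : ℝ)
    (y x : Fin d → ℝ) : ℝ :=
  1 / 2 * (x ⬝ᵥ ((lam • (1 : Matrix (Fin d) (Fin d) ℝ) - A).mulVec x)) - y ⬝ᵥ x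

/-- Suboptimality `f(x) - min f`. -/
noncomputable def lsqError {d : ℕ} (A : Matrix (Fin d) (Fin d) ℝ) (lam : ℝ)
    (y x : Fin d → ℝ) : ℝ :=
  lsqObjective A lam y x - ⨅ z, lsqObjective A lam y z

/-- An iterative optimizer for the problems `min_x ½ xᵀ (λ I - A) x - yᵀ x`: initialization from
`x₀`, one coordinate update (which may consume one random number from `[0, 1]`), and the current
approximate solution. -/
structure LSO (d : ℕ) where
  State : Type
  start : (lam : ℝ) → (y x₀ : Fin d → ℝ) → Counted State
  step : (lam : ℝ) → (y : Fin d → ℝ) → unitInterval → State → Counted State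
  iterate : State → Fin d → ℝ

/-- Run the optimizer from `x₀` on the random numbers `tape` until the suboptimality has been
reduced by the factor `ratio`, that is, to `ε' = (f(x₀) - min f) / ratio`. -/
noncomputable def LSO.solve {d : ℕ} (opt : LSO d) (A : Matrix (Fin d) (Fin d) ℝ) (lam : ℝ)
    (y x₀ : Fin d → ℝ) (ratio : ℝ) (tape : ℕ → unitInterval) : Counted (Fin d → ℝ) := do
  let s₀ ← opt.start lam y x₀
  let s ← loopUntil
    (fun q : ℕ × opt.State =>
      lsqError A lam y (opt.iterate q.2) ≤ lsqError A lam y x₀ / ratio)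
    (fun q => do
      let s' ← opt.step lam y (tape q.1) q.2
      pure (q.1 + 1, s'))
    (0, s₀)
  pure (opt.iterate s.2)

/-! ### Greedy coordinate descent with the Gauss-Southwell-Lipschitz rule -/

/-- `pick` returns an index of a largest entry (ties are broken arbitrarily). -/
def IsArgmax {d : ℕ} (pick : (Fin d → ℝ) → Fin d) : Prop :=
  ∀ (v : Fin d → ℝ) (i : Fin d), v i ≤ v (pick v)

structure GSLState (d : ℕ) where
  x : Fin d → ℝ
  /-- the gradient at `x` -/
  g : Fin d → ℝ
  /-- `L i = λ - A i i` -/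
  L : Fin d → ℝ
  /-- `√(L i)` -/
  sqrtL : Fin d → ℝ

/-- Coordinate descent, coordinates selected by `argmax_i |g i| / √(λ - A i i)`. -/
noncomputable def gsl {d : ℕ} (A : Matrix (Fin d) (Fin d) ℝ) (pick : (Fin d → ℝ) → Fin d) :
    LSO d where
  State := GSLState d
  start lam y x₀ := do
    let L ← vec fun i => num lam - num (A i i)
    let sqrtL ← vec fun i => sqrtC (num (L i))
    let h ← mulShifted A lam x₀
    let g ← vec fun i => num (h i) - num (y i)
    pure ⟨x₀, g, L, sqrtL⟩
  step lam _ _ s := do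
    let key ← vec fun i => absC (num (s.g i)) / num (s.sqrtL i)
    let j ← (⟨pick key, d⟩ : Counted (Fin d))
    let δ ← num 0 - num (s.g j) / num (s.L j)
    let xj ← num (s.x j) + num δ
    let g ← vec fun i => num (s.g i) - num δ * num (A i j)
    let gj ← num (g j) + num lam * num δ
    pure ⟨Function.update s.x j xj, Function.update g j gj, s.L, s.sqrtL⟩
  iterate s := s.x

/-! ### Accelerated coordinate descent with non-uniform sampling (NU-ACDM) -/

structure ACDMState (d : ℕ) where
  yk : Fin d → ℝ
  zk : Fin d → ℝ
  /-- `L i = λ - A i i` -/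
  L : Fin d → ℝ
  /-- `√(L i)` -/
  sqrtL : Fin d → ℝ
  /-- `∑ i, √(L i)` -/
  S : ℝ
  τ : ℝ
  η : ℝ

open Classical in
/-- Inverse transform sampling by a linear scan: the first index `i` with
`u * S ≤ r 0 + ⋯ + r i`.  For `u` uniform on `[0, 1]` and `S = ∑ i, r i > 0`, index `i` is
returned with probability `r i / S`. -/
noncomputable def sampleIndex {d : ℕ} [NeZero d] (r : Fin d → ℝ) (S : ℝ) (u : unitInterval) :
    Counted (Fin d) :=
  ⟨((List.finRange d).find? fun i => decide ((u : ℝ) * S ≤ ∑ l ∈ Finset.Iic i, r l)).getD 0,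
    (2 * d + 1 : ℕ)⟩

/-- NU-ACDM with sampling probabilities proportional to `√(L i)`, where `L i = λ - A i i`, for
the strong convexity parameter `μ = λ - ρ₁`.  In every step
`x ← τ z + (1 - τ) y`, then, for the sampled coordinate `i` of probability `pᵢ = √(L i) / S`,
`y ← x - (1 / L i) ∇ᵢf(x) eᵢ` and `z ← (z + η μ x - (η / pᵢ) ∇ᵢf(x) eᵢ) / (1 + η μ)`. -/
noncomputable def nuACDM {d : ℕ} [NeZero d] (A : Matrix (Fin d) (Fin d) ℝ) (ρ₁ : ℝ) : LSO d where
  State := ACDMState d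
  start lam _ x₀ := do
    let L ← vec fun i => num lam - num (A i i)
    let sqrtL ← vec fun i => sqrtC (num (L i))
    let S ← sum fun i => num (sqrtL i)
    let μ ← num lam - num ρ₁
    let τ ← num 2 / (num 1 + sqrtC (num 4 * (num S * num S) / num μ + num 1))
    let η ← num 1 / (num τ * (num S * num S))
    pure ⟨x₀, x₀, L, sqrtL, S, τ, η⟩
  step lam b u s := do
    let μ ← num lam - num ρ₁
    let x ← vec fun i => num s.τ * num (s.zk i) + (num 1 - num s.τ) * num (s.yk i)
    let i ← sampleIndex s.sqrtL s.S u
    let gi ← num lam * num (x i) - dot (A i) x - num (b i)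
    let yi ← num (x i) - num gi / num (s.L i)
    let v ← vec fun j => num (s.zk j) + num s.η * num μ * num (x j)
    let vi ← num (v i) - num s.η / (num (s.sqrtL i) / num s.S) * num gi
    let z ← vec fun j => num (Function.update v i vi j) / (num 1 + num s.η * num μ)
    pure ⟨Function.update x i yi, z, s.L, s.sqrtL, s.S, s.τ, s.η⟩
  iterate s := s.yk

/-! ### The shift-and-invert meta-algorithm -/

/-- Variables of the meta-algorithm: the current unit vector, the current shift, the current
`Δ_s`, and the number of least squares problems solved so far (each one reads its own sequence of
random numbers). -/
structure SIState (d : ℕ) where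
  w : Fin d → ℝ
  lam : ℝ
  gap : ℝ
  solved : ℕ

/-- Approximate `(λ I - A)⁻¹ w` with the optimizer, started from `w / (wᵀ (λ I - A) w)`. -/
noncomputable def solveShifted {d : ℕ} (opt : LSO d) (A : Matrix (Fin d) (Fin d) ℝ)
    (tape : ℕ × ℕ → unitInterval) (ratio : ℝ) (st : SIState d) : Counted (Fin d → ℝ) := do
  let h ← mulShifted A st.lam st.w
  let q ← dot st.w h
  let x₀ ← vec fun i => num (st.w i) / num q
  opt.solve A st.lam st.w x₀ ratio fun k => tape (st.solved, k)

/-- One inexact power iteration on `(λ I - A)⁻¹`. -/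
noncomputable def powerStep {d : ℕ} (opt : LSO d) (A : Matrix (Fin d) (Fin d) ℝ)
    (tape : ℕ × ℕ → unitInterval) (ratio : ℝ) (st : SIState d) : Counted (SIState d) := do
  let wt ← solveShifted opt A tape ratio st
  let w ← normalize wt
  pure { st with w := w, solved := st.solved + 1 }

/-- The body of the `repeat`-loop of Phase I: `m₁` power iterations, the estimate `Δ_s`, and the
new shift. -/
noncomputable def shiftStage {d : ℕ} (opt : LSO d) (A : Matrix (Fin d) (Fin d) ℝ)
    (tape : ℕ × ℕ → unitInterval) (c₂ Δt : ℝ) (m₁ : ℕ) (st : SIState d) :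
    Counted (SIState d) := do
  let st ← repeatN (powerStep opt A tape (32 * 10 ^ (2 * m₁ + 1) / Δt ^ (2 * m₁))) st m₁
  let u ← solveShifted opt A tape (1024 / Δt ^ 2) st
  let σ ← num 1 + (num 1 - num c₂) / num c₂ * num Δt
  let gap ← num (1 / 2) * (num 1 / (dot st.w u - num σ / num 8))
  let lam ← num st.lam - num gap / num 2
  pure ⟨st.w, lam, gap, st.solved + 1⟩

/-- Phase I, with `m₁ = ⌈8 log (16 / (w₀ᵀ p₁)²)⌉`: `repeat … until Δ_s ≤ Δt`. -/
noncomputable def phaseOne {d : ℕ} (opt : LSO d) (A : Matrix (Fin d) (Fin d) ℝ)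
    (p₁ : Fin d → ℝ) (tape : ℕ × ℕ → unitInterval) (c₂ Δt : ℝ) (wInit : Fin d → ℝ) :
    Counted (SIState d) := do
  let w₀ ← normalize wInit
  let lam₀ ← num 1 + num Δt
  let m₁ := ⌈8 * Real.log (16 / (w₀ ⬝ᵥ p₁) ^ 2)⌉₊
  let st₁ ← shiftStage opt A tape c₂ Δt m₁ ⟨w₀, lam₀, 0, 0⟩
  loopUntil (fun st => st.gap ≤ Δt) (shiftStage opt A tape c₂ Δt m₁) st₁

/-- `G₀` of a vector `w` for the shift `λ`: the quotient of the `(λ I - A)`-norms of the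
components of `w` orthogonal and parallel to the leading eigenvector `p 0`. -/
noncomputable def initialG {d : ℕ} [NeZero d] (ρ : Fin d → ℝ) (p : Fin d → Fin d → ℝ)
    (lam : ℝ) (w : Fin d → ℝ) : ℝ :=
  Real.sqrt (∑ i ∈ Finset.univ.erase 0, (lam - ρ i) * (w ⬝ᵥ p i) ^ 2) /
    Real.sqrt ((lam - ρ 0) * (w ⬝ᵥ p 0) ^ 2)

/-- Phase II: `m₂ = ⌈½ log_{9/7} (G₀² / ε)⌉` power iterations with the final shift of Phase I. -/
noncomputable def phaseTwo {d : ℕ} [NeZero d] (opt : LSO d) (A : Matrix (Fin d) (Fin d) ℝ)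
    (ρ : Fin d → ℝ) (p : Fin d → Fin d → ℝ) (tape : ℕ × ℕ → unitInterval) (ε : ℝ)
    (st : SIState d) : Counted (Fin d → ℝ) := do
  let G₀ := initialG ρ p st.lam st.w
  let m₂ := ⌈1 / 2 * Real.logb (9 / 7) (G₀ ^ 2 / ε)⌉₊
  let st' ← repeatN (powerStep opt A tape (100 * max G₀ 1)) st m₂
  pure st'.w

/-- The shift-and-invert power method. -/
noncomputable def shiftInvert {d : ℕ} [NeZero d] (opt : LSO d) (A : Matrix (Fin d) (Fin d) ℝ)
    (ρ : Fin d → ℝ) (p : Fin d → Fin d → ℝ) (tape : ℕ × ℕ → unitInterval) (c₂ Δt ε : ℝ)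
    (wInit : Fin d → ℝ) : Counted (Fin d → ℝ) := do
  let st ← phaseOne opt A (p 0) tape c₂ Δt wInit
  phaseTwo opt A ρ p tape ε st

/-- The run finds `w` with `(wᵀ p₁)² ≥ 1 - ε`.  Phase II takes at most
`C K d² log (d/ε)` operations, Phase I at most `C K d² (log d · (1 + log (1/Δ)))²`, which does not
depend on `ε`, and as soon as `ε` is so small that `log (d/ε) ≥ (log d · (1 + log (1/Δ)))²`, the
whole run takes at most `C K d² log (d/ε)` operations. -/
def RunSucceeds {d : ℕ} [NeZero d] (opt : LSO d) (A : Matrix (Fin d) (Fin d) ℝ)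
    (ρ : Fin d → ℝ) (p : Fin d → Fin d → ℝ) (tape : ℕ × ℕ → unitInterval) (c₂ Δt ε : ℝ)
    (wInit : Fin d → ℝ) (C K : ℝ) : Prop :=
  let one := phaseOne opt A (p 0) tape c₂ Δt wInit
  let run := shiftInvert opt A ρ p tape c₂ Δt ε wInit
  let Q := (Real.log d * (1 + Real.log (1 / (ρ 0 - ρ 1)))) ^ 2
  1 - ε ≤ (run.val ⬝ᵥ p 0) ^ 2 ∧
  (phaseTwo opt A ρ p tape ε one.val).CostAtMost (C * (K * d ^ 2 * Real.log (d / ε))) ∧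
  one.CostAtMost (C * (K * d ^ 2 * Q)) ∧
  (Q ≤ Real.log (d / ε) → run.CostAtMost (C * (K * d ^ 2 * Real.log (d / ε))))

/-- Law of a random unit vector of `ℝᵈ`, i.e. the normalized surface measure of the unit sphere,
together with independent random numbers, uniform on `[0, 1]`. -/
noncomputable def initLaw (d : ℕ) :
    Measure (Metric.sphere (0 : EuclideanSpace ℝ (Fin d)) 1 × (ℕ × ℕ → unitInterval)) :=
  (((volume : Measure (EuclideanSpace ℝ (Fin d))).toSphere Set.univ)⁻¹ •
      (volume : Measure (EuclideanSpace ℝ (Fin d))).toSphere).prod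
    (Measure.infinitePi fun _ : ℕ × ℕ => (volume : Measure unitInterval))

/-! ### Spectral coordinates -/

/-! Everything is read off in the eigenbasis. There `λ I - A` is diagonal with entries `λ - ρ i`,
the suboptimality of a least squares problem is the weighted square sum `energy`
(`EigenSystem.lsqError_eq`), and an inexact power step divides the coordinates by `λ - ρ i` up to an
error `ζ` relative to the leading coordinate (`solution_error_le`). Progress is measured by
tangents, that is, the size of the part of `w` off `p 0` divided by its leading coordinate, in the
Euclidean norm (`TanLe`) or in the norm of `λ I - A` (`WTanLe`).

Phase I. Write `x = λ - ρ 0`. During a stage the tangent over the far indices shrinks by `7 / 8` per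
step, while the tangent over all indices stays below its initial bound (`StageInv.step`). After `m₁`
steps almost all of `w` lies where `λ - ρ i` is within `6 / 5` of `x`, so `wᵀ (λ I - A)⁻¹ w` is
close to `1 / x`, and the estimate `Δ_s` lies between `x / 2` and `4 x / 5` (`gapEstimate_bounds`).
The new distance is then between `3 x / 5` and `3 x / 4`. Hence there are `O(log (1 / Δt))` stages,
`x` never falls below `9 / 20 * Δt`, and at the exit `x ≤ 3 / 2 * (ρ 0 - ρ 1)` and `G₀ ≤ 1`
(`shiftStage_spec`, `phaseOne_spec`).

Phase II. With such a shift a step of constant accuracy contracts the weighted tangent by `7 / 9`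
(`weighted_contraction`), so `O(log (1 / ε))` steps suffice (`phaseTwo_spec`).

Solvers. Greedy coordinate descent contracts the energy by `1 - μ / ∑ (λ - ρ i)` per step, where `μ
= λ - ρ 0` (`gsl_contraction`). For NU-ACDM a potential contracts in expectation by `1 - τ`, where
`1 / τ ≤ 1 + S / √μ` (`acdm_contraction`), which bounds the expected number of steps
(`lintegral_acdmCount_le`). Because `μ` is at least a constant times the gap, both step counts are
`O(K d)` times the logarithm of the accuracy ratio (`GapProblem.gsl_work`, `GapProblem.acdm_work`),
and a step costs `O(d)`. That logarithm is a constant in Phase II and `O(log d * (1 + log (1 / Δ)))`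
in Phase I, where the number of problems has the same order; this produces the square in `Q`.

Probability. The run is rewritten as a Markov chain `flatRun` with one state per least squares
problem and one fresh row of random numbers per transition. The expected iteration count of each
admissible state is bounded, and the number of contributing states is bounded on every path, so
Markov's inequality bounds the total work of each phase (`prod_countWhere_le`). The only other
failure is a small initial overlap with `p 0`, which is excluded by packing disjoint translates of a
slab into the unit ball (`volume_ballSlab_le`). `run_spec` is the deterministic link: finite
iteration counts force the algorithm to follow the chain and to obey the cost bounds. -/

/-- `p` is an orthonormal basis of eigenvectors of the symmetric matrix `A` with eigenvalues `ρ`. -/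
structure EigenSystem {d : ℕ} (A : Matrix (Fin d) (Fin d) ℝ) (ρ : Fin d → ℝ)
    (p : Fin d → Fin d → ℝ) : Prop where
  symm : ∀ i j, A i j = A j i
  orth : ∀ i j, p i ⬝ᵥ p j = if i = j then 1 else 0
  eig : ∀ i, A.mulVec (p i) = ρ i • p i

/-- `½ ‖x - (λ I - A)⁻¹ y‖²` in the norm of `λ I - A`, in spectral coordinates. -/
noncomputable def energy {d : ℕ} (ρ : Fin d → ℝ) (p : Fin d → Fin d → ℝ) (lam : ℝ)
    (y x : Fin d → ℝ) : ℝ :=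
  1 / 2 * ∑ i, (lam - ρ i) * (x ⬝ᵥ p i - y ⬝ᵥ p i / (lam - ρ i)) ^ 2

/-- `(λ I - A)⁻¹ y` in spectral form. -/
noncomputable def shiftInv {d : ℕ} (ρ : Fin d → ℝ) (p : Fin d → Fin d → ℝ) (lam : ℝ)
    (y : Fin d → ℝ) : Fin d → ℝ :=
  ∑ i, (y ⬝ᵥ p i / (lam - ρ i)) • p i

namespace EigenSystem

variable {d : ℕ} {A : Matrix (Fin d) (Fin d) ℝ} {ρ : Fin d → ℝ} {p : Fin d → Fin d → ℝ}

/-- A one-sided inverse of a square matrix is two-sided, so orthonormal rows `p i` have orthonormal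
columns. All eigenbasis expansions rest on this. -/
theorem resolution (h : EigenSystem A ρ p) (j k : Fin d) :
    ∑ i, p i j * p i k = if j = k then 1 else 0 := by
  have h1 : (Matrix.of p) * (Matrix.of p).transpose = 1 := by
    ext i j
    simpa [Matrix.mul_apply, Matrix.one_apply, dotProduct] using h.orth i j
  have h2 := mul_eq_one_comm.mp h1
  have h3 := congrFun (congrFun h2 j) k
  simpa [Matrix.mul_apply, Matrix.one_apply] using h3

theorem sum_smul (h : EigenSystem A ρ p) (x : Fin d → ℝ) : ∑ i, (x ⬝ᵥ p i) • p i = x := by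
  ext k
  simp only [Finset.sum_apply, Pi.smul_apply, smul_eq_mul, dotProduct, Finset.sum_mul]
  rw [Finset.sum_comm]
  have : ∀ j, ∑ i, x j * p i j * p i k = x j * (if j = k then 1 else 0) := by
    intro j
    rw [← h.resolution j k, Finset.mul_sum]
    exact Finset.sum_congr rfl fun i _ => by ring
  simp [this]

theorem dot_eq (h : EigenSystem A ρ p) (x y : Fin d → ℝ) :
    x ⬝ᵥ y = ∑ i, (x ⬝ᵥ p i) * (y ⬝ᵥ p i) := by
  conv_lhs => rw [← h.sum_smul y]
  rw [dotProduct_sum]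
  exact Finset.sum_congr rfl fun i _ => by rw [dotProduct_smul, smul_eq_mul, mul_comm]

theorem dot_self (h : EigenSystem A ρ p) (x : Fin d → ℝ) :
    x ⬝ᵥ x = ∑ i, (x ⬝ᵥ p i) ^ 2 := by
  rw [h.dot_eq]; exact Finset.sum_congr rfl fun i _ => by ring

theorem mulVec_dot (h : EigenSystem A ρ p) (x : Fin d → ℝ) (i : Fin d) :
    A.mulVec x ⬝ᵥ p i = ρ i * (x ⬝ᵥ p i) := by
  have hs : A.transpose = A := by ext a b; exact h.symm b a
  rw [dotProduct_comm, Matrix.dotProduct_mulVec, ← Matrix.mulVec_transpose, hs, h.eig,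
    smul_dotProduct, smul_eq_mul, dotProduct_comm]

theorem shift_mulVec (lam : ℝ) (x : Fin d → ℝ) :
    (lam • (1 : Matrix (Fin d) (Fin d) ℝ) - A).mulVec x = lam • x - A.mulVec x := by
  rw [Matrix.sub_mulVec, Matrix.smul_mulVec, Matrix.one_mulVec]

theorem shift_mulVec_dot (h : EigenSystem A ρ p) (lam : ℝ) (x : Fin d → ℝ) (i : Fin d) :
    (lam • x - A.mulVec x) ⬝ᵥ p i = (lam - ρ i) * (x ⬝ᵥ p i) := by
  rw [sub_dotProduct, smul_dotProduct, h.mulVec_dot, smul_eq_mul]; ring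

theorem shift_dot (h : EigenSystem A ρ p) (lam : ℝ) (x y : Fin d → ℝ) :
    x ⬝ᵥ (lam • y - A.mulVec y) = ∑ i, (lam - ρ i) * ((x ⬝ᵥ p i) * (y ⬝ᵥ p i)) := by
  rw [h.dot_eq]
  exact Finset.sum_congr rfl fun i _ => by rw [h.shift_mulVec_dot]; ring

theorem shift_quad (h : EigenSystem A ρ p) (lam : ℝ) (x : Fin d → ℝ) :
    x ⬝ᵥ (lam • x - A.mulVec x) = ∑ i, (lam - ρ i) * (x ⬝ᵥ p i) ^ 2 := by
  rw [h.shift_dot]; exact Finset.sum_congr rfl fun i _ => by ring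

theorem diag_eq (h : EigenSystem A ρ p) (j : Fin d) : A j j = ∑ i, ρ i * (p i j) ^ 2 := by
  have h1 := h.shift_quad 0 (Pi.single j 1)
  simp at h1
  simpa using h1

theorem sum_sq_col (h : EigenSystem A ρ p) (j : Fin d) : ∑ i, (p i j) ^ 2 = 1 := by
  have := h.resolution j j
  simpa [sq] using this

theorem sum_sq_row (h : EigenSystem A ρ p) (i : Fin d) : ∑ j, (p i j) ^ 2 = 1 := by
  have := h.orth i i
  simpa [sq, dotProduct] using this

theorem sum_diag (h : EigenSystem A ρ p) : ∑ j, A j j = ∑ i, ρ i := by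
  simp_rw [h.diag_eq]
  rw [Finset.sum_comm]
  exact Finset.sum_congr rfl fun i _ => by rw [← Finset.mul_sum, h.sum_sq_row, mul_one]

theorem sum_shift_diag (h : EigenSystem A ρ p) (lam : ℝ) :
    ∑ j, (lam - A j j) = ∑ i, (lam - ρ i) := by
  rw [Finset.sum_sub_distrib, Finset.sum_sub_distrib, h.sum_diag]

theorem diag_shift_eq (h : EigenSystem A ρ p) (lam : ℝ) (j : Fin d) :
    lam - A j j = ∑ i, (lam - ρ i) * (p i j) ^ 2 := by
  simp_rw [sub_mul]
  rw [Finset.sum_sub_distrib, ← Finset.mul_sum, h.sum_sq_col, h.diag_eq, mul_one]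

/-- The diagonal of `λ I - A` is bounded below by any lower bound of its spectrum. -/
theorem le_diag_shift (h : EigenSystem A ρ p) {lam μ : ℝ} (hμ : ∀ i, μ ≤ lam - ρ i) (j : Fin d) :
    μ ≤ lam - A j j := by
  rw [h.diag_shift_eq]
  calc μ = ∑ i, μ * (p i j) ^ 2 := by rw [← Finset.mul_sum, h.sum_sq_col, mul_one]
    _ ≤ _ := Finset.sum_le_sum fun i _ => mul_le_mul_of_nonneg_right (hμ i) (sq_nonneg _)

theorem shiftInv_dot (h : EigenSystem A ρ p) (lam : ℝ) (y : Fin d → ℝ) (i : Fin d) :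
    shiftInv ρ p lam y ⬝ᵥ p i = y ⬝ᵥ p i / (lam - ρ i) := by
  unfold shiftInv
  rw [sum_dotProduct]
  simp [smul_dotProduct, h.orth]

theorem ext_dot (h : EigenSystem A ρ p) {x y : Fin d → ℝ} (hxy : ∀ i, x ⬝ᵥ p i = y ⬝ᵥ p i) :
    x = y := by
  rw [← h.sum_smul x, ← h.sum_smul y]; simp_rw [hxy]

theorem shift_mulVec_shiftInv (h : EigenSystem A ρ p) {lam : ℝ} (hlam : ∀ i, 0 < lam - ρ i)
    (y : Fin d → ℝ) :
    lam • shiftInv ρ p lam y - A.mulVec (shiftInv ρ p lam y) = y :=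
  h.ext_dot fun i => by
    rw [h.shift_mulVec_dot, h.shiftInv_dot, mul_div_cancel₀ _ (hlam i).ne']

theorem energy_nonneg {lam : ℝ} (hlam : ∀ i, 0 < lam - ρ i) (y x : Fin d → ℝ) :
    0 ≤ energy ρ p lam y x :=
  mul_nonneg (by norm_num)
    (Finset.sum_nonneg fun i _ => mul_nonneg (hlam i).le (sq_nonneg _))

theorem energy_eq_quad (h : EigenSystem A ρ p) (lam : ℝ) (y x : Fin d → ℝ) :
    energy ρ p lam y x = 1 / 2 * ((x - shiftInv ρ p lam y) ⬝ᵥ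
      (lam • (x - shiftInv ρ p lam y) - A.mulVec (x - shiftInv ρ p lam y))) := by
  rw [h.shift_quad, energy]
  simp_rw [sub_dotProduct, h.shiftInv_dot]

theorem lsqObjective_eq (h : EigenSystem A ρ p) {lam : ℝ} (hlam : ∀ i, 0 < lam - ρ i)
    (y x : Fin d → ℝ) :
    lsqObjective A lam y x =
      energy ρ p lam y x - 1 / 2 * ∑ i, (y ⬝ᵥ p i) ^ 2 / (lam - ρ i) := by
  rw [lsqObjective, shift_mulVec, h.shift_quad, h.dot_eq y x, energy, ← mul_sub,
    ← Finset.sum_sub_distrib]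
  have : ∀ i, (lam - ρ i) * (x ⬝ᵥ p i - y ⬝ᵥ p i / (lam - ρ i)) ^ 2 -
      (y ⬝ᵥ p i) ^ 2 / (lam - ρ i) =
      (lam - ρ i) * (x ⬝ᵥ p i) ^ 2 - 2 * ((y ⬝ᵥ p i) * (x ⬝ᵥ p i)) := by
    intro i
    have := (hlam i).ne'
    field_simp
    ring
  simp_rw [this]
  rw [Finset.sum_sub_distrib, ← Finset.mul_sum]
  ring

/-- After completing the square the infimum is attained at `shiftInv`, where `energy` vanishes. The
solvers' exit test thereby becomes a statement about `energy`. -/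
theorem lsqError_eq (h : EigenSystem A ρ p) {lam : ℝ} (hlam : ∀ i, 0 < lam - ρ i)
    (y x : Fin d → ℝ) : lsqError A lam y x = energy ρ p lam y x := by
  have hinf : ⨅ z, lsqObjective A lam y z = - (1 / 2 * ∑ i, (y ⬝ᵥ p i) ^ 2 / (lam - ρ i)) := by
    apply le_antisymm
    · refine (ciInf_le ⟨- (1 / 2 * ∑ i, (y ⬝ᵥ p i) ^ 2 / (lam - ρ i)), ?_⟩
        (shiftInv ρ p lam y)).trans ?_
      · rintro _ ⟨z, rfl⟩
        simp only [h.lsqObjective_eq hlam]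
        linarith [energy_nonneg (p := p) hlam y z]
      · rw [h.lsqObjective_eq hlam, energy]
        simp [h.shiftInv_dot]
    · refine le_ciInf fun z => ?_
      rw [h.lsqObjective_eq hlam]
      linarith [energy_nonneg (p := p) hlam y z]
  rw [lsqError, hinf, h.lsqObjective_eq hlam]
  ring

/-- The starting point `y / (yᵀ (λ I - A) y)` is the best multiple of `y`. -/
theorem energy_start_le (h : EigenSystem A ρ p) {lam : ℝ} (hlam : ∀ i, 0 < lam - ρ i)
    {y : Fin d → ℝ} (hy : y ⬝ᵥ y = 1) (c : ℝ) :
    energy ρ p lam y ((y ⬝ᵥ (lam • y - A.mulVec y))⁻¹ • y) ≤ energy ρ p lam y (c • y) := by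
  -- Along the line through `y` the energy is a parabola in `c`; since `y` is a unit vector its
  -- linear coefficient is `-1`, which puts the vertex at `q⁻¹`.
  have key : ∀ c : ℝ, energy ρ p lam y (c • y) =
      1 / 2 * (y ⬝ᵥ (lam • y - A.mulVec y)) * c ^ 2 - c +
        1 / 2 * ∑ i, (y ⬝ᵥ p i) ^ 2 / (lam - ρ i) := by
    intro c
    have := h.lsqObjective_eq hlam y (c • y)
    rw [lsqObjective, shift_mulVec] at this
    simp only [Matrix.mulVec_smul, smul_comm lam c, ← smul_sub, smul_dotProduct, dotProduct_smul,
      smul_eq_mul, hy] at this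
    linarith
  have hq : 0 < y ⬝ᵥ (lam • y - A.mulVec y) := by
    rw [h.shift_quad]
    obtain ⟨i, hi⟩ : ∃ i, y ⬝ᵥ p i ≠ 0 := by
      by_contra! hcon
      rw [h.dot_self] at hy
      simp [hcon] at hy
    exact Finset.sum_pos' (fun i _ => mul_nonneg (hlam i).le (sq_nonneg _))
      ⟨i, Finset.mem_univ _, mul_pos (hlam i) (by positivity)⟩
  rw [key, key]
  generalize y ⬝ᵥ (lam • y - A.mulVec y) = q at hq ⊢
  have : 1 / 2 * q * c ^ 2 - c - (1 / 2 * q * q⁻¹ ^ 2 - q⁻¹) = 1 / 2 * q * (c - q⁻¹) ^ 2 := by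
    field_simp; ring
  nlinarith [mul_nonneg hq.le (sq_nonneg (c - q⁻¹))]

end EigenSystem

/-! ### One inexact power iteration in spectral coordinates -/

theorem sqrt_sum_add_sq_le {ι : Type*} (s : Finset ι) (u v : ι → ℝ) :
    Real.sqrt (∑ i ∈ s, (u i + v i) ^ 2) ≤
      Real.sqrt (∑ i ∈ s, u i ^ 2) + Real.sqrt (∑ i ∈ s, v i ^ 2) := by
  have hu : 0 ≤ ∑ i ∈ s, u i ^ 2 := Finset.sum_nonneg fun i _ => sq_nonneg _
  have hv : 0 ≤ ∑ i ∈ s, v i ^ 2 := Finset.sum_nonneg fun i _ => sq_nonneg _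
  rw [Real.sqrt_le_left (by positivity)]
  have hcs : ∑ i ∈ s, u i * v i ≤
      Real.sqrt (∑ i ∈ s, u i ^ 2) * Real.sqrt (∑ i ∈ s, v i ^ 2) := by
    rw [← Real.sqrt_mul hu]
    exact Real.le_sqrt_of_sq_le (Finset.sum_mul_sq_le_sq_mul_sq s u v)
  have : ∑ i ∈ s, (u i + v i) ^ 2 =
      ∑ i ∈ s, u i ^ 2 + 2 * ∑ i ∈ s, u i * v i + ∑ i ∈ s, v i ^ 2 := by
    rw [Finset.mul_sum, ← Finset.sum_add_distrib, ← Finset.sum_add_distrib]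
    exact Finset.sum_congr rfl fun i _ => by ring
  rw [this, add_sq, Real.sq_sqrt hu, Real.sq_sqrt hv]
  linarith

section step

variable {ι : Type*} [Fintype ι] {β a b : ι → ℝ} {o : ι} {ζ : ℝ}

/-- The exact step sends `a o` to `a o / β o`; the single summand at `o` of the error bound perturbs
this by a relative `ζ` at most. This controls the denominator in every tangent estimate below. -/
theorem weighted_head_ge (hβ : ∀ i, 0 < β i) (hζ : 0 ≤ ζ)
    (he : ∑ i, β i * (b i - a i / β i) ^ 2 ≤ ζ ^ 2 * (a o ^ 2 / β o)) :
    (1 - ζ) * (|a o| / Real.sqrt (β o)) ≤ Real.sqrt (β o) * |b o| := by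
  have hs : 0 < Real.sqrt (β o) := Real.sqrt_pos.2 (hβ o)
  have hss : Real.sqrt (β o) * Real.sqrt (β o) = β o := Real.mul_self_sqrt (hβ o).le
  have h1 : β o * (b o - a o / β o) ^ 2 ≤ ζ ^ 2 * (a o ^ 2 / β o) :=
    (Finset.single_le_sum (f := fun i => β i * (b i - a i / β i) ^ 2)
      (fun i _ => mul_nonneg (hβ i).le (sq_nonneg _)) (Finset.mem_univ o)).trans he
  have h2 : (Real.sqrt (β o) * (b o - a o / β o)) ^ 2 ≤ (ζ * (|a o| / Real.sqrt (β o))) ^ 2 := by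
    rw [mul_pow, mul_pow, div_pow, sq_abs, Real.sq_sqrt (hβ o).le]
    exact h1
  have h3 := abs_le_of_sq_le_sq h2 (by positivity)
  have h4 : |a o| / Real.sqrt (β o) = Real.sqrt (β o) * |a o / β o| := by
    rw [abs_div, abs_of_pos (hβ o)]
    field_simp
    rw [Real.sq_sqrt (hβ o).le, mul_div_cancel_right₀ _ (hβ o).ne']
  have h5 : Real.sqrt (β o) * |a o / β o| - Real.sqrt (β o) * |b o| ≤
      ζ * (|a o| / Real.sqrt (β o)) := by
    rw [← mul_sub]
    refine le_trans (mul_le_mul_of_nonneg_left (abs_sub_abs_le_abs_sub _ _) hs.le) ?_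
    rw [abs_sub_comm, ← abs_of_pos hs, ← abs_mul, abs_of_pos hs]
    exact h3
  rw [← h4] at h5
  linarith

theorem sqrt_error_le (hβ : ∀ i, 0 < β i) (hζ : 0 ≤ ζ) (s : Finset ι)
    (he : ∑ i, β i * (b i - a i / β i) ^ 2 ≤ ζ ^ 2 * (a o ^ 2 / β o)) :
    Real.sqrt (∑ i ∈ s, (Real.sqrt (β i) * (b i - a i / β i)) ^ 2) ≤
      ζ * (|a o| / Real.sqrt (β o)) := by
  have h0 : 0 ≤ ζ * (|a o| / Real.sqrt (β o)) := by positivity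
  rw [Real.sqrt_le_left h0, mul_pow, div_pow, sq_abs, Real.sq_sqrt (hβ o).le]
  refine le_trans ?_ he
  calc _ = ∑ i ∈ s, β i * (b i - a i / β i) ^ 2 :=
        Finset.sum_congr rfl fun i _ => by rw [mul_pow, Real.sq_sqrt (hβ i).le]
    _ ≤ _ := Finset.sum_le_sum_of_subset_of_nonneg (Finset.subset_univ _)
      fun i _ _ => mul_nonneg (hβ i).le (sq_nonneg _)

/-- The weighted tangent after an inexact inverse iteration, in terms of the image of the exact
one. -/
theorem weighted_tan_step_aux (hβ : ∀ i, 0 < β i) (hζ : 0 ≤ ζ) (s : Finset ι) {g G' : ℝ}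
    (he : ∑ i, β i * (b i - a i / β i) ^ 2 ≤ ζ ^ 2 * (a o ^ 2 / β o))
    (hg : Real.sqrt (∑ i ∈ s, a i ^ 2 / β i) ≤ g * (|a o| / Real.sqrt (β o)))
    (hG' : 0 ≤ G') (h : g + ζ ≤ G' * (1 - ζ)) :
    Real.sqrt (∑ i ∈ s, β i * b i ^ 2) ≤ G' * (Real.sqrt (β o) * |b o|) := by
  have h1 := weighted_head_ge hβ hζ he
  have h2 := sqrt_error_le hβ hζ s he
  have h3 := sqrt_sum_add_sq_le s (fun i => a i / Real.sqrt (β i))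
    (fun i => Real.sqrt (β i) * (b i - a i / β i))
  have e1 : ∑ i ∈ s, β i * b i ^ 2 =
      ∑ i ∈ s, (a i / Real.sqrt (β i) + Real.sqrt (β i) * (b i - a i / β i)) ^ 2 :=
    Finset.sum_congr rfl fun i _ => by
      have hs : 0 < Real.sqrt (β i) := Real.sqrt_pos.2 (hβ i)
      have hss : Real.sqrt (β i) * Real.sqrt (β i) = β i := Real.mul_self_sqrt (hβ i).le
      have : a i / Real.sqrt (β i) = Real.sqrt (β i) * (a i / β i) := by
        field_simp; rw [Real.sq_sqrt (hβ i).le, mul_div_cancel_right₀ _ (hβ i).ne']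
      rw [this, ← mul_add, mul_pow, Real.sq_sqrt (hβ i).le]
      ring
  have e2 : ∑ i ∈ s, (a i / Real.sqrt (β i)) ^ 2 = ∑ i ∈ s, a i ^ 2 / β i :=
    Finset.sum_congr rfl fun i _ => by rw [div_pow, Real.sq_sqrt (hβ i).le]
  rw [← e1, e2] at h3
  have hq : 0 ≤ |a o| / Real.sqrt (β o) := by positivity
  calc _ ≤ (g + ζ) * (|a o| / Real.sqrt (β o)) := by linarith
    _ ≤ G' * (1 - ζ) * (|a o| / Real.sqrt (β o)) := mul_le_mul_of_nonneg_right h hq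
    _ ≤ _ := by rw [mul_assoc]; exact mul_le_mul_of_nonneg_left h1 hG'

/-- On `s` the exact step multiplies by `1 / β i ≤ γ / β o`, so the weighted tangent contracts by
`γ`. The solver error adds `ζ` to the numerator and costs a factor `1 - ζ` in the denominator. -/
theorem weighted_tan_step (hβ : ∀ i, 0 < β i) (hζ : 0 ≤ ζ) (s : Finset ι) {γ G G' : ℝ}
    (hγ : 0 ≤ γ) (hs : ∀ i ∈ s, β o ≤ γ * β i)
    (he : ∑ i, β i * (b i - a i / β i) ^ 2 ≤ ζ ^ 2 * (a o ^ 2 / β o))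
    (hG : Real.sqrt (∑ i ∈ s, β i * a i ^ 2) ≤ G * (Real.sqrt (β o) * |a o|))
    (hG' : 0 ≤ G') (h : γ * G + ζ ≤ G' * (1 - ζ)) :
    Real.sqrt (∑ i ∈ s, β i * b i ^ 2) ≤ G' * (Real.sqrt (β o) * |b o|) := by
  refine weighted_tan_step_aux hβ hζ s he ?_ hG' h
  have ho := hβ o
  have h1 : ∑ i ∈ s, a i ^ 2 / β i ≤ (γ / β o) ^ 2 * ∑ i ∈ s, β i * a i ^ 2 := by
    rw [Finset.mul_sum]
    refine Finset.sum_le_sum fun i hi => ?_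
    have hi' := hβ i
    have : 1 ≤ γ * β i / β o := by rw [le_div_iff₀ ho]; linarith [hs i hi]
    calc a i ^ 2 / β i = (a i ^ 2 / β i) * 1 := by ring
      _ ≤ (a i ^ 2 / β i) * (γ * β i / β o) ^ 2 :=
        mul_le_mul_of_nonneg_left (one_le_pow₀ this) (by positivity)
      _ = _ := by field_simp
  calc _ ≤ Real.sqrt ((γ / β o) ^ 2 * ∑ i ∈ s, β i * a i ^ 2) := Real.sqrt_le_sqrt h1
    _ = γ / β o * Real.sqrt (∑ i ∈ s, β i * a i ^ 2) := by
      rw [Real.sqrt_mul (sq_nonneg _), Real.sqrt_sq (by positivity)]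
    _ ≤ γ / β o * (G * (Real.sqrt (β o) * |a o|)) :=
      mul_le_mul_of_nonneg_left hG (by positivity)
    _ = _ := by
      have hs : 0 < Real.sqrt (β o) := Real.sqrt_pos.2 ho
      have hss : Real.sqrt (β o) ^ 2 = β o := Real.sq_sqrt ho.le
      field_simp
      rw [hss]
      ring

/-- One step can be spent on passing from the Euclidean to the weighted tangent: it leaves `a i ^ 2
/ β i ≤ a i ^ 2 / β o`, so no condition number is lost in the change of norm. -/
theorem weighted_tan_step_of_tan (hβ : ∀ i, 0 < β i) (hζ : 0 ≤ ζ) (s : Finset ι) {F G' : ℝ}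
    (hs : ∀ i ∈ s, β o ≤ β i)
    (he : ∑ i, β i * (b i - a i / β i) ^ 2 ≤ ζ ^ 2 * (a o ^ 2 / β o))
    (hF : Real.sqrt (∑ i ∈ s, a i ^ 2) ≤ F * |a o|)
    (hG' : 0 ≤ G') (h : F + ζ ≤ G' * (1 - ζ)) :
    Real.sqrt (∑ i ∈ s, β i * b i ^ 2) ≤ G' * (Real.sqrt (β o) * |b o|) := by
  refine weighted_tan_step_aux hβ hζ s he ?_ hG' h
  have ho := hβ o
  have h1 : ∑ i ∈ s, a i ^ 2 / β i ≤ (∑ i ∈ s, a i ^ 2) / β o := by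
    rw [Finset.sum_div]
    exact Finset.sum_le_sum fun i hi =>
      div_le_div_of_nonneg_left (sq_nonneg _) ho (hs i hi)
  calc _ ≤ Real.sqrt ((∑ i ∈ s, a i ^ 2) / β o) := Real.sqrt_le_sqrt h1
    _ = Real.sqrt (∑ i ∈ s, a i ^ 2) / Real.sqrt (β o) := Real.sqrt_div' _ ho.le
    _ ≤ F * |a o| / Real.sqrt (β o) := by gcongr
    _ = _ := by ring

/-- The tangent after an inexact inverse iteration. -/
theorem tan_step (hβ : ∀ i, 0 < β i) (hζ : 0 ≤ ζ) (s : Finset ι) {γ F F' : ℝ}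
    (hγ : 0 ≤ γ) (hs : ∀ i ∈ s, β o ≤ γ * β i) (hs1 : ∀ i ∈ s, β o ≤ β i)
    (he : ∑ i, β i * (b i - a i / β i) ^ 2 ≤ ζ ^ 2 * (a o ^ 2 / β o))
    (hF : Real.sqrt (∑ i ∈ s, a i ^ 2) ≤ F * |a o|)
    (hF' : 0 ≤ F') (h : γ * F + ζ ≤ F' * (1 - ζ)) :
    Real.sqrt (∑ i ∈ s, b i ^ 2) ≤ F' * |b o| := by
  have ho := hβ o
  have hso : 0 < Real.sqrt (β o) := Real.sqrt_pos.2 ho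
  have hss : Real.sqrt (β o) ^ 2 = β o := Real.sq_sqrt ho.le
  have h1 := weighted_head_ge hβ hζ he
  have h2 := sqrt_error_le hβ hζ s he
  have h3 := sqrt_sum_add_sq_le s (fun i => a i / β i) (fun i => b i - a i / β i)
  have e0 : ∑ i ∈ s, b i ^ 2 = ∑ i ∈ s, (a i / β i + (b i - a i / β i)) ^ 2 :=
    Finset.sum_congr rfl fun i _ => by ring
  rw [← e0] at h3
  have h4 : Real.sqrt (∑ i ∈ s, (a i / β i) ^ 2) ≤ γ * F * |a o| / β o := by
    have : ∑ i ∈ s, (a i / β i) ^ 2 ≤ (γ / β o) ^ 2 * ∑ i ∈ s, a i ^ 2 := by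
      rw [Finset.mul_sum]
      refine Finset.sum_le_sum fun i hi => ?_
      have hi' := hβ i
      have : 1 / β i ≤ γ / β o := by
        rw [div_le_div_iff₀ hi' ho]; linarith [hs i hi]
      calc (a i / β i) ^ 2 = (1 / β i) ^ 2 * a i ^ 2 := by ring
        _ ≤ _ := by gcongr
    calc _ ≤ Real.sqrt ((γ / β o) ^ 2 * ∑ i ∈ s, a i ^ 2) := Real.sqrt_le_sqrt this
      _ = γ / β o * Real.sqrt (∑ i ∈ s, a i ^ 2) := by
        rw [Real.sqrt_mul (sq_nonneg _), Real.sqrt_sq (by positivity)]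
      _ ≤ γ / β o * (F * |a o|) := mul_le_mul_of_nonneg_left hF (by positivity)
      _ = _ := by ring
  -- Because `β o ≤ β i` on `s`, the Euclidean error scaled by `√(β o)` is dominated by the
  -- energy-norm error.
  have h5 : Real.sqrt (β o) * Real.sqrt (∑ i ∈ s, (b i - a i / β i) ^ 2) ≤
      ζ * (|a o| / Real.sqrt (β o)) := by
    refine le_trans ?_ h2
    rw [← Real.sqrt_mul ho.le]
    refine Real.sqrt_le_sqrt ?_
    rw [Finset.mul_sum]
    refine Finset.sum_le_sum fun i hi => ?_
    rw [mul_pow, Real.sq_sqrt (hβ i).le]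
    exact mul_le_mul_of_nonneg_right (hs1 i hi) (sq_nonneg _)
  have h6 : Real.sqrt (β o) * Real.sqrt (∑ i ∈ s, b i ^ 2) ≤
      (γ * F + ζ) * (|a o| / Real.sqrt (β o)) := by
    have := mul_le_mul_of_nonneg_left (h3.trans (add_le_add_left h4 _)) hso.le
    rw [mul_add] at this
    have e : Real.sqrt (β o) * (γ * F * |a o| / β o) = γ * F * (|a o| / Real.sqrt (β o)) := by
      nth_rewrite 2 [← hss]
      field_simp
    linarith
  have hq : 0 ≤ |a o| / Real.sqrt (β o) := by positivity
  have h7 : (γ * F + ζ) * (|a o| / Real.sqrt (β o)) ≤ F' * (Real.sqrt (β o) * |b o|) :=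
    (mul_le_mul_of_nonneg_right h hq).trans
      (by rw [mul_assoc]; exact mul_le_mul_of_nonneg_left h1 hF')
  have h8 := h6.trans h7
  have h9 : Real.sqrt (β o) * Real.sqrt (∑ i ∈ s, b i ^ 2) ≤ Real.sqrt (β o) * (F' * |b o|) := by
    linarith
  exact le_of_mul_le_mul_left h9 hso

theorem head_ne_zero (hβ : ∀ i, 0 < β i) (hζ : 0 ≤ ζ) (hζ1 : ζ < 1) (ha : a o ≠ 0)
    (he : ∑ i, β i * (b i - a i / β i) ^ 2 ≤ ζ ^ 2 * (a o ^ 2 / β o)) : b o ≠ 0 := by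
  have h1 := weighted_head_ge hβ hζ he
  have hso : 0 < Real.sqrt (β o) := Real.sqrt_pos.2 (hβ o)
  have : 0 < (1 - ζ) * (|a o| / Real.sqrt (β o)) :=
    mul_pos (by linarith) (div_pos (abs_pos.2 ha) hso)
  intro h0
  rw [h0] at h1
  simp at h1
  linarith

end step

/-- Accuracy of an approximate solution of the least squares problem, relative to the leading
coordinate. -/
theorem solution_error_le {d : ℕ} {A : Matrix (Fin d) (Fin d) ℝ} {ρ : Fin d → ℝ}
    {p : Fin d → Fin d → ℝ} (h : EigenSystem A ρ p) {lam : ℝ} (hlam : ∀ i, 0 < lam - ρ i)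
    {w x : Fin d → ℝ} (hw : w ⬝ᵥ w = 1) {R : ℝ} (hR : 0 < R) (o : Fin d)
    (ho : ∀ i, lam - ρ o ≤ lam - ρ i)
    (hx : energy ρ p lam w x ≤
      energy ρ p lam w ((w ⬝ᵥ (lam • w - A.mulVec w))⁻¹ • w) / R) {G ζ : ℝ}
    (hG : Real.sqrt (∑ i ∈ Finset.univ.erase o, (lam - ρ i) * (w ⬝ᵥ p i) ^ 2) ≤
      G * (Real.sqrt (lam - ρ o) * |w ⬝ᵥ p o|)) (hζ : G ^ 2 ≤ ζ ^ 2 * R) :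
    ∑ i, (lam - ρ i) * (x ⬝ᵥ p i - w ⬝ᵥ p i / (lam - ρ i)) ^ 2 ≤
      ζ ^ 2 * ((w ⬝ᵥ p o) ^ 2 / (lam - ρ o)) := by
  -- The start is the best multiple of `w`, hence no worse than the multiple that is exact in the
  -- leading coordinate; for that one only the weighted tail of `w` contributes.
  have h1 := h.energy_start_le hlam hw (lam - ρ o)⁻¹
  have hop := hlam o
  have h2 : energy ρ p lam w ((lam - ρ o)⁻¹ • w) ≤
      1 / 2 * ((∑ i ∈ Finset.univ.erase o, (lam - ρ i) * (w ⬝ᵥ p i) ^ 2) / (lam - ρ o) ^ 2) := by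
    rw [energy]
    refine mul_le_mul_of_nonneg_left ?_ (by norm_num)
    rw [← Finset.add_sum_erase _ _ (Finset.mem_univ o), Finset.sum_div]
    have : (lam - ρ o) * ((((lam - ρ o)⁻¹ • w) ⬝ᵥ p o) - w ⬝ᵥ p o / (lam - ρ o)) ^ 2 = 0 := by
      rw [smul_dotProduct, smul_eq_mul]; ring
    rw [this, zero_add]
    refine Finset.sum_le_sum fun i _ => ?_
    rw [smul_dotProduct, smul_eq_mul]
    have hi := hlam i
    have e : (lam - ρ i) * ((lam - ρ o)⁻¹ * w ⬝ᵥ p i - w ⬝ᵥ p i / (lam - ρ i)) ^ 2 =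
        (lam - ρ i) * (w ⬝ᵥ p i) ^ 2 / (lam - ρ o) ^ 2 * (1 - (lam - ρ o) / (lam - ρ i)) ^ 2 := by
      field_simp
    rw [e]
    refine mul_le_of_le_one_right (by positivity) ?_
    have q1 : (lam - ρ o) / (lam - ρ i) ≤ 1 := (div_le_one hi).2 (ho i)
    have q2 : 0 ≤ (lam - ρ o) / (lam - ρ i) := by positivity
    nlinarith
  have h3 : ∑ i ∈ Finset.univ.erase o, (lam - ρ i) * (w ⬝ᵥ p i) ^ 2 ≤
      G ^ 2 * ((lam - ρ o) * (w ⬝ᵥ p o) ^ 2) := by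
    have := Real.sqrt_le_iff.1 hG
    rw [mul_pow, mul_pow, Real.sq_sqrt hop.le, sq_abs] at this
    exact this.2
  have h4 : energy ρ p lam w x ≤ 1 / 2 * (ζ ^ 2 * ((w ⬝ᵥ p o) ^ 2 / (lam - ρ o))) := by
    refine hx.trans ?_
    rw [div_le_iff₀ hR]
    refine (h1.trans h2).trans ?_
    have : (∑ i ∈ Finset.univ.erase o, (lam - ρ i) * (w ⬝ᵥ p i) ^ 2) / (lam - ρ o) ^ 2 ≤
        G ^ 2 * ((lam - ρ o) * (w ⬝ᵥ p o) ^ 2) / (lam - ρ o) ^ 2 := by gcongr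
    have e : G ^ 2 * ((lam - ρ o) * (w ⬝ᵥ p o) ^ 2) / (lam - ρ o) ^ 2 =
        G ^ 2 * ((w ⬝ᵥ p o) ^ 2 / (lam - ρ o)) := by field_simp
    rw [e] at this
    have h5 : G ^ 2 * ((w ⬝ᵥ p o) ^ 2 / (lam - ρ o)) ≤
        ζ ^ 2 * R * ((w ⬝ᵥ p o) ^ 2 / (lam - ρ o)) := by gcongr
    linarith
  rw [energy] at h4
  linarith

/-! ### Invariants of the shift-and-invert iteration -/

/-- The hypotheses on the matrix and on the estimate `Δt` of its eigenvalue gap. -/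
structure GapProblem {d : ℕ} [NeZero d] (A : Matrix (Fin d) (Fin d) ℝ) (ρ : Fin d → ℝ)
    (p : Fin d → Fin d → ℝ) (c₂ Δt : ℝ) : Prop extends EigenSystem A ρ p where
  nonneg : ∀ i, 0 ≤ ρ i
  le_one : ρ 0 ≤ 1
  gap_le : ∀ i, i ≠ 0 → ρ i ≤ ρ 0 - (ρ 0 - ρ 1)
  gap_pos : 0 < ρ 0 - ρ 1
  est_pos : 0 < Δt
  est_le : Δt ≤ c₂ * (ρ 0 - ρ 1)
  frac_pos : 0 < c₂
  frac_le : c₂ ≤ 1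

/-- The part of `w` in the span of the `p i`, `i ∈ s`, is at most `F` times its leading part. -/
def TanLe {d : ℕ} [NeZero d] (p : Fin d → Fin d → ℝ) (s : Finset (Fin d)) (w : Fin d → ℝ)
    (F : ℝ) : Prop :=
  Real.sqrt (∑ i ∈ s, (w ⬝ᵥ p i) ^ 2) ≤ F * |w ⬝ᵥ p 0|

/-- As `TanLe`, for the complement of `p 0` and with the norm of `λ I - A`. -/
def WTanLe {d : ℕ} [NeZero d] (ρ : Fin d → ℝ) (p : Fin d → Fin d → ℝ) (lam : ℝ)
    (w : Fin d → ℝ) (G : ℝ) : Prop :=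
  Real.sqrt (∑ i ∈ Finset.univ.erase 0, (lam - ρ i) * (w ⬝ᵥ p i) ^ 2) ≤
    G * (Real.sqrt (lam - ρ 0) * |w ⬝ᵥ p 0|)

/-- The indices of eigenvalues not close to the leading one, seen from the shift `λ`. -/
noncomputable def farIdx {d : ℕ} [NeZero d] (ρ : Fin d → ℝ) (lam : ℝ) : Finset (Fin d) :=
  Finset.univ.filter fun i => 6 / 5 * (lam - ρ 0) ≤ lam - ρ i

theorem TanLe.smul {d : ℕ} [NeZero d] {p : Fin d → Fin d → ℝ} {s : Finset (Fin d)}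
    {w : Fin d → ℝ} {F : ℝ} (h : TanLe p s w F) (c : ℝ) : TanLe p s (c • w) F := by
  unfold TanLe at *
  simp only [smul_dotProduct, smul_eq_mul, mul_pow, ← Finset.mul_sum, abs_mul]
  rw [Real.sqrt_mul (sq_nonneg _), Real.sqrt_sq_eq_abs]
  nlinarith [mul_le_mul_of_nonneg_left h (abs_nonneg c)]

theorem WTanLe.smul {d : ℕ} [NeZero d] {ρ : Fin d → ℝ} {p : Fin d → Fin d → ℝ} {lam : ℝ}
    {w : Fin d → ℝ} {G : ℝ} (h : WTanLe ρ p lam w G) (c : ℝ) : WTanLe ρ p lam (c • w) G := by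
  unfold WTanLe at *
  have : ∀ i, (lam - ρ i) * ((c • w) ⬝ᵥ p i) ^ 2 = c ^ 2 * ((lam - ρ i) * (w ⬝ᵥ p i) ^ 2) := by
    intro i; rw [smul_dotProduct, smul_eq_mul]; ring
  simp only [this, ← Finset.mul_sum]
  rw [Real.sqrt_mul (sq_nonneg _), Real.sqrt_sq_eq_abs, smul_dotProduct, smul_eq_mul, abs_mul]
  nlinarith [mul_le_mul_of_nonneg_left h (abs_nonneg c)]

theorem TanLe.mono {d : ℕ} [NeZero d] {p : Fin d → Fin d → ℝ} {s t : Finset (Fin d)}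
    {w : Fin d → ℝ} {F : ℝ} (h : TanLe p s w F) (hts : t ⊆ s) : TanLe p t w F :=
  (Real.sqrt_le_sqrt (Finset.sum_le_sum_of_subset_of_nonneg hts
    fun _ _ _ => sq_nonneg _)).trans h

namespace GapProblem

variable {d : ℕ} [NeZero d] {A : Matrix (Fin d) (Fin d) ℝ} {ρ : Fin d → ℝ}
  {p : Fin d → Fin d → ℝ} {c₂ Δt : ℝ}

theorem le_zero (h : GapProblem A ρ p c₂ Δt) (i : Fin d) : ρ i ≤ ρ 0 := by
  by_cases hi : i = 0
  · rw [hi]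
  · linarith [h.gap_le i hi, h.gap_pos]

theorem gap_le_one (h : GapProblem A ρ p c₂ Δt) : ρ 0 - ρ 1 ≤ 1 := by
  linarith [h.nonneg 1, h.le_one]

theorem est_le_gap (h : GapProblem A ρ p c₂ Δt) : Δt ≤ ρ 0 - ρ 1 :=
  h.est_le.trans (by nlinarith [h.frac_le, h.gap_pos])

theorem est_le_one (h : GapProblem A ρ p c₂ Δt) : Δt ≤ 1 := h.est_le_gap.trans h.gap_le_one

theorem shift_pos (h : GapProblem A ρ p c₂ Δt) {lam : ℝ} (hl : 0 < lam - ρ 0) (i : Fin d) :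
    0 < lam - ρ i := by linarith [h.le_zero i]

/-- As `Δt / c₂ ≤ ρ 0 - ρ 1 ≤ ρ 0`, the initial distance is at most `1 - t` with `t = (1 - c₂) / c₂
* Δt`, and `(1 - t) * (1 + t) ≤ 1`. It keeps the correction subtracted in `gapEstimate` at most one
eighth of `1 / (λ - ρ 0)`. -/
theorem init_le (h : GapProblem A ρ p c₂ Δt) :
    (1 + Δt - ρ 0) * (1 + (1 - c₂) / c₂ * Δt) ≤ 1 := by
  have hc := h.frac_pos
  set t := (1 - c₂) / c₂ * Δt with ht
  have ht0 : 0 ≤ t :=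
    mul_nonneg (div_nonneg (by linarith [h.frac_le]) hc.le) h.est_pos.le
  have h1 : t = Δt / c₂ - Δt := by rw [ht]; field_simp
  have h2 : Δt / c₂ ≤ ρ 0 - ρ 1 := by rw [div_le_iff₀ hc]; linarith [h.est_le]
  have h3 : 1 + Δt - ρ 0 ≤ 1 - t := by linarith [h.nonneg 1]
  nlinarith

theorem sigma_ge_one (h : GapProblem A ρ p c₂ Δt) : 1 ≤ 1 + (1 - c₂) / c₂ * Δt := by
  have : 0 ≤ (1 - c₂) / c₂ * Δt :=
    mul_nonneg (div_nonneg (by linarith [h.frac_le]) h.frac_pos.le) h.est_pos.le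
  linarith

theorem init_le_one (h : GapProblem A ρ p c₂ Δt) : 1 + Δt - ρ 0 ≤ 1 := by
  have h1 := h.init_le
  have h2 := h.sigma_ge_one
  have h3 : 0 ≤ 1 + Δt - ρ 0 := by linarith [h.le_one, h.est_pos]
  nlinarith

/-- All weights are at most `2`. The factor lost here is paid for by the power of `Δt` in the Phase
I accuracy ratio. -/
theorem wtanLe_of_tanLe (h : GapProblem A ρ p c₂ Δt) {lam : ℝ} {w : Fin d → ℝ} {T : ℝ}
    (hl : 0 < lam - ρ 0) (hl1 : lam ≤ 2) (hT : TanLe p (Finset.univ.erase 0) w T) :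
    WTanLe ρ p lam w (Real.sqrt (2 / (lam - ρ 0)) * T) := by
  unfold WTanLe
  have h1 : ∑ i ∈ Finset.univ.erase 0, (lam - ρ i) * (w ⬝ᵥ p i) ^ 2 ≤
      2 * ∑ i ∈ Finset.univ.erase 0, (w ⬝ᵥ p i) ^ 2 := by
    rw [Finset.mul_sum]
    exact Finset.sum_le_sum fun i _ =>
      mul_le_mul_of_nonneg_right (by linarith [h.nonneg i]) (sq_nonneg _)
  calc _ ≤ Real.sqrt (2 * ∑ i ∈ Finset.univ.erase 0, (w ⬝ᵥ p i) ^ 2) := Real.sqrt_le_sqrt h1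
    _ = Real.sqrt 2 * Real.sqrt (∑ i ∈ Finset.univ.erase 0, (w ⬝ᵥ p i) ^ 2) :=
      Real.sqrt_mul (by norm_num) _
    _ ≤ Real.sqrt 2 * (T * |w ⬝ᵥ p 0|) := mul_le_mul_of_nonneg_left hT (Real.sqrt_nonneg _)
    _ = _ := by
      have : Real.sqrt (2 / (lam - ρ 0)) * Real.sqrt (lam - ρ 0) = Real.sqrt 2 := by
        rw [← Real.sqrt_mul (by positivity), div_mul_cancel₀ _ hl.ne']
      rw [← this]; ring

end GapProblem

/-- The state of a stage of Phase I after `k` of its power iterations, for an initial vector with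
leading coordinate `a`. -/
structure StageInv {d : ℕ} [NeZero d] (ρ : Fin d → ℝ) (p : Fin d → Fin d → ℝ) (a lam : ℝ)
    (k : ℕ) (w : Fin d → ℝ) : Prop where
  unit : w ⬝ᵥ w = 1
  head : w ⬝ᵥ p 0 ≠ 0
  tan : TanLe p (Finset.univ.erase 0) w (1 / a)
  far : TanLe p (farIdx ρ lam) w ((7 / 8) ^ k / a)

/-- What the tests of the solver guarantee about an approximate solution. -/
def SolvesTo {d : ℕ} (A : Matrix (Fin d) (Fin d) ℝ) (ρ : Fin d → ℝ) (p : Fin d → Fin d → ℝ)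
    (lam R : ℝ) (w x : Fin d → ℝ) : Prop :=
  energy ρ p lam w x ≤ energy ρ p lam w ((w ⬝ᵥ (lam • w - A.mulVec w))⁻¹ • w) / R

section

variable {d : ℕ} [NeZero d] {A : Matrix (Fin d) (Fin d) ℝ} {ρ : Fin d → ℝ}
  {p : Fin d → Fin d → ℝ} {c₂ Δt : ℝ}

theorem farIdx_subset {lam : ℝ} (hl : 0 < lam - ρ 0) :
    farIdx ρ lam ⊆ Finset.univ.erase 0 := by
  intro i hi
  simp only [farIdx, Finset.mem_filter, Finset.mem_univ, true_and] at hi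
  simp only [Finset.mem_erase, Finset.mem_univ, and_true]
  rintro rfl
  linarith

/-- Since `1 / 10 ≤ (7 / 8) ^ 2`, one factor `(7 / 8) ^ m ≤ a ^ 2 / 16` can be spent on cancelling
the initial overlap, and another one remains to keep the error below a tangent that shrinks at rate
`7 / 8`. -/
theorem tenth_pow_mul_le {a : ℝ} {m : ℕ} (ha : 0 < a) (ha1 : a ≤ 1)
    (hm : (7 / 8 : ℝ) ^ m ≤ a ^ 2 / 16) :
    (1 / 10 : ℝ) ^ m * (1 + 1 / a) ≤ (7 / 8) ^ m / 8 := by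
  have h1 : (1 / 10 : ℝ) ^ m ≤ (7 / 8) ^ m * (7 / 8) ^ m := by
    rw [← mul_pow]; exact pow_le_pow_left₀ (by norm_num) (by norm_num) m
  have hr : 0 < (7 / 8 : ℝ) ^ m := by positivity
  have h2 : 1 + 1 / a ≤ 2 / a ^ 2 := by
    rw [le_div_iff₀ (by positivity)]
    field_simp
    nlinarith
  calc (1 / 10 : ℝ) ^ m * (1 + 1 / a) ≤ (7 / 8) ^ m * (7 / 8) ^ m * (2 / a ^ 2) := by gcongr
    _ ≤ (7 / 8) ^ m * (a ^ 2 / 16) * (2 / a ^ 2) := by gcongr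
    _ = _ := by field_simp; norm_num

/-- Accuracy of the solutions in the power iterations of Phase I. -/
theorem StageInv.error_le (h : GapProblem A ρ p c₂ Δt) {a lam : ℝ} {m k : ℕ} {w x : Fin d → ℝ}
    (ha : 0 < a) (ha1 : a ≤ 1) (hm : (7 / 8 : ℝ) ^ m ≤ a ^ 2 / 16) (hm2 : 2 ≤ m) 
    (hl : 3 / 4 * Δt ≤ lam - ρ 0) (hl2 : lam ≤ 2)
    (hw : StageInv ρ p a lam k w)
    (hx : SolvesTo A ρ p lam (32 * 10 ^ (2 * m + 1) / Δt ^ (2 * m)) w x) :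
    ∃ ζ : ℝ, 0 < ζ ∧ ζ * (1 + 1 / a) ≤ 1 / a * Δt * ((7 / 8) ^ m / 64) ∧ ζ ≤ (7 / 8) ^ m / 64 ∧
      ∑ i, (lam - ρ i) * (x ⬝ᵥ p i - w ⬝ᵥ p i / (lam - ρ i)) ^ 2 ≤
        ζ ^ 2 * ((w ⬝ᵥ p 0) ^ 2 / (lam - ρ 0)) := by
  have hΔ := h.est_pos
  have hΔ1 := h.est_le_one
  have hx0 : 0 < lam - ρ 0 := by linarith
  have hpos := h.shift_pos hx0
  set q : ℝ := (1 / 10) ^ m with hq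
  have hq0 : 0 < q := by positivity
  have hqr := tenth_pow_mul_le ha ha1 hm
  rw [← hq] at hqr
  set T : ℝ := 1 / a with hT
  have hT0 : 0 < T := by positivity
  -- With this choice `ζ ^ 2` times the accuracy ratio equals `5 * T ^ 2 * Δt ^ 2 / Δt ^ (2 * m)`.
  -- For `m ≥ 2` that is at least `5 * T ^ 2 / Δt`, which covers the squared weighted tangent `2 /
  -- (λ - ρ 0) * T ^ 2`.
  set ζ : ℝ := T * Δt * q / 8 with hζ
  have hζ0 : 0 < ζ := by positivity
  have hζ1 : ζ * (1 + T) ≤ T * Δt * ((7 / 8) ^ m / 64) := by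
    have : ζ * (1 + T) = T * Δt / 8 * (q * (1 + T)) := by rw [hζ]; ring
    rw [this]
    calc T * Δt / 8 * (q * (1 + T)) ≤ T * Δt / 8 * ((7 / 8) ^ m / 8) := by gcongr
      _ = _ := by ring
  have hζ2 : ζ ≤ (7 / 8) ^ m / 64 := by
    have h1 : q * T ≤ q * (1 + T) := by nlinarith
    have h2 : ζ ≤ q * T / 8 := by rw [hζ]; nlinarith [mul_pos hT0 hq0]
    linarith
  have hR : 0 < (32 * 10 ^ (2 * m + 1) / Δt ^ (2 * m) : ℝ) := by positivity
  have hW := h.wtanLe_of_tanLe hx0 hl2 hw.tan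
  refine ⟨ζ, hζ0, hζ1, hζ2, ?_⟩
  exact solution_error_le h.toEigenSystem hpos hw.unit hR 0
    (fun i => by linarith [h.le_zero i]) hx hW (ζ := ζ) (by
      rw [mul_pow, Real.sq_sqrt (by positivity)]
      have e1 : ζ ^ 2 * (32 * 10 ^ (2 * m + 1) / Δt ^ (2 * m)) =
          5 * T ^ 2 * (Δt ^ 2 / Δt ^ (2 * m)) := by
        rw [hζ, hq, one_div, inv_pow, pow_succ (10 : ℝ) (2 * m), pow_mul' (10 : ℝ) 2 m]
        field_simp
        norm_num
      have e2 : 1 / Δt ≤ Δt ^ 2 / Δt ^ (2 * m) := by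
        rw [div_le_div_iff₀ hΔ (by positivity), one_mul, ← pow_succ]
        exact pow_le_pow_of_le_one hΔ.le hΔ1 (by omega)
      rw [e1]
      have e3 : 2 / (lam - ρ 0) ≤ 5 * (1 / Δt) := by
        rw [mul_one_div, div_le_div_iff₀ hx0 hΔ]; linarith
      calc 2 / (lam - ρ 0) * (1 / a) ^ 2 ≤ 5 * (1 / Δt) * T ^ 2 := by gcongr
        _ ≤ 5 * (Δt ^ 2 / Δt ^ (2 * m)) * T ^ 2 := by gcongr
        _ = _ := by ring)

/-- One power iteration of Phase I. -/
theorem StageInv.step (h : GapProblem A ρ p c₂ Δt) {a lam : ℝ} {m k : ℕ} {w x : Fin d → ℝ}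
    (ha : 0 < a) (ha1 : a ≤ 1) (hm : (7 / 8 : ℝ) ^ m ≤ a ^ 2 / 16) (hm2 : 2 ≤ m) (hk : k < m)
    (hl : 3 / 4 * Δt ≤ lam - ρ 0) (hl1 : lam - ρ 0 ≤ 1) (hl2 : lam ≤ 2)
    (hw : StageInv ρ p a lam k w)
    (hx : SolvesTo A ρ p lam (32 * 10 ^ (2 * m + 1) / Δt ^ (2 * m)) w x) :
    x ⬝ᵥ p 0 ≠ 0 ∧ TanLe p (Finset.univ.erase 0) x (1 / a) ∧
      TanLe p (farIdx ρ lam) x ((7 / 8) ^ (k + 1) / a) ∧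
      (k + 1 = m → Finset.univ.erase 0 ⊆ farIdx ρ lam → WTanLe ρ p lam x (1 / 10)) := by
  have hΔ := h.est_pos
  have hΔ1 := h.est_le_one
  have hx0 : 0 < lam - ρ 0 := by linarith
  have hpos := h.shift_pos hx0
  have hr1 : (7 / 8 : ℝ) ^ m ≤ (7 / 8) ^ k := pow_le_pow_of_le_one (by norm_num) (by norm_num) hk.le
  have hr2 : (7 / 8 : ℝ) ^ m ≤ 1 / 16 := hm.trans (by nlinarith)
  have hf1 : (7 / 8 : ℝ) ^ k ≤ 1 := pow_le_one₀ (by norm_num) (by norm_num)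
  have hf0 : 0 < (7 / 8 : ℝ) ^ k := by positivity
  obtain ⟨ζ, hζ0, hζ1, hζ2, herr⟩ := hw.error_le h ha ha1 hm hm2 hl hl2 hx
  set T : ℝ := 1 / a with hT
  have hT0 : 0 < T := by positivity
  have hζlt : ζ < 1 := by linarith
  refine ⟨?_, ?_, ?_, ?_⟩
  · exact head_ne_zero (a := fun i => w ⬝ᵥ p i) (b := fun i => x ⬝ᵥ p i) hpos hζ0.le hζlt
      hw.head herr
  -- Over all indices the contraction may be as weak as `1 - (ρ 0 - ρ 1) / 2`. That is just enough
  -- to swallow the solver error, so the bound `1 / a` is preserved rather than improved.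
  · have hg := h.gap_pos
    have hg1 := h.gap_le_one
    have hxΔ : 0 < lam - ρ 0 + (ρ 0 - ρ 1) := by linarith
    refine tan_step (β := fun i => lam - ρ i) (a := fun i => w ⬝ᵥ p i) (b := fun i => x ⬝ᵥ p i)
      (γ := (lam - ρ 0) / (lam - ρ 0 + (ρ 0 - ρ 1))) hpos hζ0.le _ (by positivity)
      (fun i hi => ?_) (fun i _ => by linarith [h.le_zero i]) herr hw.tan hT0.le ?_
    · rw [div_mul_eq_mul_div, le_div_iff₀ hxΔ]
      exact mul_le_mul_of_nonneg_left (by linarith [h.gap_le i (Finset.ne_of_mem_erase hi)]) hx0.le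
    · have h1 : (lam - ρ 0) / (lam - ρ 0 + (ρ 0 - ρ 1)) ≤ 1 - (ρ 0 - ρ 1) / 2 := by
        rw [div_le_iff₀ hxΔ]; nlinarith
      have h2 : ζ * (1 + T) ≤ T * ((ρ 0 - ρ 1) / 2) := by
        refine hζ1.trans ?_
        rw [mul_assoc]
        refine mul_le_mul_of_nonneg_left ?_ hT0.le
        nlinarith [h.est_le_gap]
      nlinarith [mul_le_mul_of_nonneg_right h1 hT0.le]
  -- The factor `5 / 6` is the threshold in `farIdx`; the slack `1 / 24` up to `7 / 8` absorbs the
  -- error.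
  · refine tan_step (β := fun i => lam - ρ i) (a := fun i => w ⬝ᵥ p i) (b := fun i => x ⬝ᵥ p i)
      (γ := 5 / 6) hpos hζ0.le _ (by norm_num)
      (fun i hi => ?_) (fun i _ => by linarith [h.le_zero i]) herr hw.far (by positivity) ?_
    · simp only [farIdx, Finset.mem_filter, Finset.mem_univ, true_and] at hi
      linarith
    · have e1 : (7 / 8 : ℝ) ^ k / a = (7 / 8) ^ k * T := by rw [hT]; ring
      have e2 : (7 / 8 : ℝ) ^ (k + 1) / a = 7 / 8 * ((7 / 8) ^ k * T) := by rw [hT]; ring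
      rw [e1, e2]
      have h1 : ζ * (1 + T) ≤ (7 / 8) ^ k * T / 24 := by
        refine hζ1.trans ?_
        have : T * Δt * ((7 / 8) ^ m / 64) ≤ T * 1 * ((7 / 8) ^ k / 64) :=
          mul_le_mul (mul_le_mul_of_nonneg_left hΔ1 hT0.le) (by linarith) (by positivity)
            (by linarith)
        nlinarith [mul_pos hf0 hT0]
      have h2 : (7 / 8 : ℝ) ^ k * T ≤ T := by nlinarith
      nlinarith [mul_le_mul_of_nonneg_left h2 hζ0.le]
  -- Before the last step the tangent is at most `1 / 14`; this step also changes the norm, and the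
  -- result stays below `1 / 10`.
  · intro hkm hfar
    have hF := hw.far.mono hfar
    refine weighted_tan_step_of_tan (β := fun i => lam - ρ i) (a := fun i => w ⬝ᵥ p i)
      (b := fun i => x ⬝ᵥ p i) hpos hζ0.le _ (fun i _ => by linarith [h.le_zero i]) herr hF
      (by norm_num) ?_
    have h1 : (7 / 8 : ℝ) ^ k / a ≤ 1 / 14 := by
      have : (7 / 8 : ℝ) ^ m = (7 / 8) ^ k * (7 / 8) := by rw [← hkm, pow_succ]
      rw [this] at hm
      rw [div_le_iff₀ ha]
      nlinarith
    linarith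

/-- Phase II with a well separated shift: the weighted tangent shrinks by `7/9`. -/
theorem weighted_contraction (h : GapProblem A ρ p c₂ Δt) {lam G : ℝ} {w x : Fin d → ℝ}
    (hl : 0 < lam - ρ 0) (hl1 : lam - ρ 0 ≤ 3 / 2 * (ρ 0 - ρ 1)) (hw : w ⬝ᵥ w = 1)
    (hw0 : w ⬝ᵥ p 0 ≠ 0) (hG : WTanLe ρ p lam w G) (hG0 : 0 ≤ G) (hG1 : G ≤ 1)
    (hx : SolvesTo A ρ p lam 100 w x) :
    x ⬝ᵥ p 0 ≠ 0 ∧ WTanLe ρ p lam x (7 / 9 * G) := by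
  have hpos := h.shift_pos hl
  have herr := solution_error_le h.toEigenSystem hpos hw (R := 100) (by norm_num) 0
    (fun i => by linarith [h.le_zero i]) hx hG (ζ := G / 10) (by linarith [div_pow G 10 2])
  refine ⟨head_ne_zero (a := fun i => w ⬝ᵥ p i) (b := fun i => x ⬝ᵥ p i) hpos
    (ζ := G / 10) (by linarith) (by linarith) hw0 herr, ?_⟩
  -- A distance of at most `3 / 2` gaps gives `γ = 3 / 5`, and the ratio `100` gives the error `G /
  -- 10`. The rate `7 / 9` is forced by `3 / 5 + 1 / 10 = 7 / 9 * (9 / 10)`.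
  refine weighted_tan_step (β := fun i => lam - ρ i) (a := fun i => w ⬝ᵥ p i)
    (b := fun i => x ⬝ᵥ p i) (γ := 3 / 5) (ζ := G / 10) hpos (by linarith) _ (by norm_num)
    (fun i hi => ?_) herr hG (by linarith) (by nlinarith)
  linarith [h.gap_le i (Finset.ne_of_mem_erase hi)]

end

/-! ### Accuracy of the gap estimate and the weighted tangent at the start of Phase II. -/

/-- The estimate `Δ_s` of Phase I. -/
noncomputable def gapEstimate {d : ℕ} (c₂ Δt : ℝ) (w u : Fin d → ℝ) : ℝ :=
  1 / 2 * (1 / (w ⬝ᵥ u - (1 + (1 - c₂) / c₂ * Δt) / 8))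

section

variable {d : ℕ} [NeZero d] {A : Matrix (Fin d) (Fin d) ℝ} {ρ : Fin d → ℝ}
  {p : Fin d → Fin d → ℝ} {c₂ Δt : ℝ}

/-- The deviation is the inner product, in the geometry of `λ I - A`, of the exact solution with the
solver error. The exact solution has squared norm `v`, and the start is no worse than the zero
vector, of energy `v / 2`; Cauchy–Schwarz then turns the ratio `1024 / Δt ^ 2` into relative
accuracy `Δt / 32`. -/
theorem solution_dot_error (h : GapProblem A ρ p c₂ Δt) {lam : ℝ} {w u : Fin d → ℝ}
    (hl : 0 < lam - ρ 0) (hw : w ⬝ᵥ w = 1) (hu : SolvesTo A ρ p lam (1024 / Δt ^ 2) w u) :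
    |w ⬝ᵥ u - ∑ i, (w ⬝ᵥ p i) ^ 2 / (lam - ρ i)| ≤
      (∑ i, (w ⬝ᵥ p i) ^ 2 / (lam - ρ i)) * (Δt / 32) := by
  have hpos := h.shift_pos hl
  have hΔ := h.est_pos
  set v := ∑ i, (w ⬝ᵥ p i) ^ 2 / (lam - ρ i) with hv
  have hv0 : 0 ≤ v := Finset.sum_nonneg fun i _ => div_nonneg (sq_nonneg _) (hpos i).le
  have h1 : energy ρ p lam w ((0 : ℝ) • w) = 1 / 2 * v := by
    rw [energy, hv]
    congr 1
    refine Finset.sum_congr rfl fun i _ => ?_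
    have := (hpos i).ne'
    rw [zero_smul, zero_dotProduct]
    field_simp
    ring
  have h2 : ∑ i, (lam - ρ i) * (u ⬝ᵥ p i - w ⬝ᵥ p i / (lam - ρ i)) ^ 2 ≤ v * (Δt / 32) ^ 2 := by
    have h3 := h.energy_start_le hpos hw 0
    rw [h1] at h3
    have h4 := (hu : _ ≤ _).trans (div_le_div_of_nonneg_right h3 (by positivity))
    rw [energy] at h4
    have : 1 / 2 * v / (1024 / Δt ^ 2) = 1 / 2 * (v * (Δt / 32) ^ 2) := by
      field_simp; norm_num
    linarith
  refine abs_le_of_sq_le_sq ?_ (by positivity)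
  have h5 : w ⬝ᵥ u - v = ∑ i, (w ⬝ᵥ p i / Real.sqrt (lam - ρ i)) *
      (Real.sqrt (lam - ρ i) * (u ⬝ᵥ p i - w ⬝ᵥ p i / (lam - ρ i))) := by
    rw [h.dot_eq w u, hv, ← Finset.sum_sub_distrib]
    refine Finset.sum_congr rfl fun i _ => ?_
    have := (Real.sqrt_pos.2 (hpos i)).ne'
    have := (hpos i).ne'
    field_simp
  rw [h5]
  refine (Finset.sum_mul_sq_le_sq_mul_sq _ _ _).trans ?_
  have e1 : ∑ i, (w ⬝ᵥ p i / Real.sqrt (lam - ρ i)) ^ 2 = v :=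
    Finset.sum_congr rfl fun i _ => by rw [div_pow, Real.sq_sqrt (hpos i).le]
  have e2 : ∑ i, (Real.sqrt (lam - ρ i) * (u ⬝ᵥ p i - w ⬝ᵥ p i / (lam - ρ i))) ^ 2 =
      ∑ i, (lam - ρ i) * (u ⬝ᵥ p i - w ⬝ᵥ p i / (lam - ρ i)) ^ 2 :=
    Finset.sum_congr rfl fun i _ => by rw [mul_pow, Real.sq_sqrt (hpos i).le]
  rw [e1, e2]
  calc _ ≤ v * (v * (Δt / 32) ^ 2) := mul_le_mul_of_nonneg_left h2 hv0
    _ = _ := by ring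

/-- All but `1 / 256` of the squared mass lies outside `farIdx`, where `1 / (λ - ρ i)` is at least
`5 / 6` of its largest value, and `5 / 6 * (255 / 256) > 83 / 100`. -/
theorem rayleigh_bounds (h : GapProblem A ρ p c₂ Δt) {a lam : ℝ} {m : ℕ} {w : Fin d → ℝ}
    (ha : 0 < a) (ha1 : a ≤ 1) (hm : (7 / 8 : ℝ) ^ m ≤ a ^ 2 / 16) (hl : 0 < lam - ρ 0)
    (hw : StageInv ρ p a lam m w) :
    83 / 100 / (lam - ρ 0) ≤ ∑ i, (w ⬝ᵥ p i) ^ 2 / (lam - ρ i) ∧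
      ∑ i, (w ⬝ᵥ p i) ^ 2 / (lam - ρ i) ≤ 1 / (lam - ρ 0) := by
  have hpos := h.shift_pos hl
  have hsum : ∑ i, (w ⬝ᵥ p i) ^ 2 = 1 := by rw [← h.dot_self, hw.unit]
  constructor
  · have h0 : (w ⬝ᵥ p 0) ^ 2 ≤ 1 := by
      rw [← hsum]
      exact Finset.single_le_sum (f := fun i => (w ⬝ᵥ p i) ^ 2) (fun i _ => sq_nonneg _)
        (Finset.mem_univ 0)
    have h1 : (7 / 8 : ℝ) ^ m / a ≤ 1 / 16 := by rw [div_le_iff₀ ha]; nlinarith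
    have h2 : ∑ i ∈ farIdx ρ lam, (w ⬝ᵥ p i) ^ 2 ≤ 1 / 256 := by
      have h3 := hw.far
      unfold TanLe at h3
      rw [Real.sqrt_le_left (by positivity)] at h3
      refine h3.trans ?_
      rw [mul_pow, sq_abs]
      have : ((7 / 8 : ℝ) ^ m / a) ^ 2 ≤ (1 / 16) ^ 2 :=
        pow_le_pow_left₀ (by positivity) h1 2
      nlinarith [sq_nonneg (w ⬝ᵥ p 0)]
    have h4 : ∑ i, ((w ⬝ᵥ p i) ^ 2 - if i ∈ farIdx ρ lam then (w ⬝ᵥ p i) ^ 2 else 0) *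
        (5 / 6 / (lam - ρ 0)) ≤ ∑ i, (w ⬝ᵥ p i) ^ 2 / (lam - ρ i) := by
      refine Finset.sum_le_sum fun i _ => ?_
      split_ifs with hi
      · simp only [sub_self, zero_mul]
        exact div_nonneg (sq_nonneg _) (hpos i).le
      · simp only [farIdx, Finset.mem_filter, Finset.mem_univ, true_and, not_le] at hi
        rw [sub_zero, div_eq_mul_inv ((w ⬝ᵥ p i) ^ 2), ← one_div]
        refine mul_le_mul_of_nonneg_left ?_ (sq_nonneg _)
        rw [div_le_div_iff₀ hl (hpos i)]
        linarith
    rw [← Finset.sum_mul, Finset.sum_sub_distrib, hsum, Finset.sum_ite_mem,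
      Finset.univ_inter] at h4
    refine le_trans ?_ h4
    rw [← mul_div_assoc]
    refine div_le_div_of_nonneg_right ?_ hl.le
    linarith
  · rw [← hsum, Finset.sum_div]
    exact Finset.sum_le_sum fun i _ =>
      div_le_div_of_nonneg_left (sq_nonneg _) hl (by linarith [h.le_zero i])

/-- The estimate `Δ_s` of Phase I is correct up to a constant. -/
theorem gapEstimate_bounds (h : GapProblem A ρ p c₂ Δt) {a lam : ℝ} {m : ℕ} {w u : Fin d → ℝ}
    (ha : 0 < a) (ha1 : a ≤ 1) (hm : (7 / 8 : ℝ) ^ m ≤ a ^ 2 / 16)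
    (hl : 3 / 4 * Δt ≤ lam - ρ 0) (hl1 : lam ≤ 1 + Δt) (hw : StageInv ρ p a lam m w)
    (hu : SolvesTo A ρ p lam (1024 / Δt ^ 2) w u) :
    (lam - ρ 0) / 2 ≤ gapEstimate c₂ Δt w u ∧ gapEstimate c₂ Δt w u ≤ 4 / 5 * (lam - ρ 0) := by
  have hΔ := h.est_pos
  have hΔ1 := h.est_le_one
  have hx : 0 < lam - ρ 0 := by linarith
  obtain ⟨hv1, hv2⟩ := rayleigh_bounds h ha ha1 hm hx hw
  have herr := solution_dot_error h hx hw.unit hu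
  set v := ∑ i, (w ⬝ᵥ p i) ^ 2 / (lam - ρ i) with hv
  set x := lam - ρ 0 with hxdef
  set σ := 1 + (1 - c₂) / c₂ * Δt with hσ
  have hσ1 : 1 ≤ σ := h.sigma_ge_one
  have hσx : σ ≤ 1 / x := by
    rw [le_div_iff₀ hx]
    have := h.init_le
    nlinarith
  have he1 : v * (Δt / 32) ≤ (1 / x) * (1 / 32) := by
    apply mul_le_mul hv2 (by linarith) (by positivity) (by positivity)
  have he2 : v * (Δt / 32) ≤ 1 / 24 := by
    calc v * (Δt / 32) ≤ 1 / x * (Δt / 32) := by gcongr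
      _ ≤ 1 / 24 := by
        rw [div_mul_div_comm, div_le_div_iff₀ (by positivity) (by norm_num)]
        linarith
  have hab := abs_le.1 herr
  have e : 83 / 100 / x = 83 / 100 * (1 / x) := by ring
  -- Below, `83 / 100 - 1 / 32 - 1 / 8 > 5 / 8`. Above, the solver error is at most `1 / 24`, which
  -- the subtracted `σ / 8 ≥ 1 / 8` covers.
  have hlow : 5 / 8 * (1 / x) ≤ w ⬝ᵥ u - σ / 8 := by
    have : 0 < 1 / x := by positivity
    linarith
  have hup : w ⬝ᵥ u - σ / 8 ≤ 1 / x := by linarith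
  have hden : 0 < w ⬝ᵥ u - σ / 8 := lt_of_lt_of_le (by positivity) hlow
  unfold gapEstimate
  rw [← hσ]
  constructor
  · have : x ≤ 1 / (w ⬝ᵥ u - σ / 8) := by
      rw [le_div_iff₀ hden]
      calc x * (w ⬝ᵥ u - σ / 8) ≤ x * (1 / x) := by gcongr
        _ = 1 := by field_simp
    linarith
  · have : 1 / (w ⬝ᵥ u - σ / 8) ≤ 8 / 5 * x := by
      rw [div_le_iff₀ hden]
      calc (1 : ℝ) = 8 / 5 * x * (5 / 8 * (1 / x)) := by field_simp
        _ ≤ _ := by gcongr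
    linarith

/-- `G₀` at the beginning of Phase II. -/
theorem initialG_le_one {lam lam' : ℝ} {w : Fin d → ℝ}
    (hl : 0 < lam - ρ 0) (hl1 : 3 / 5 * (lam - ρ 0) ≤ lam' - ρ 0) (hl2 : lam' ≤ lam)
    (hG : WTanLe ρ p lam w (1 / 10)) : WTanLe ρ p lam' w 1 := by
  unfold WTanLe at *
  have h1 : ∑ i ∈ Finset.univ.erase 0, (lam' - ρ i) * (w ⬝ᵥ p i) ^ 2 ≤
      ∑ i ∈ Finset.univ.erase 0, (lam - ρ i) * (w ⬝ᵥ p i) ^ 2 :=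
    Finset.sum_le_sum fun i _ => mul_le_mul_of_nonneg_right (by linarith) (sq_nonneg _)
  refine (Real.sqrt_le_sqrt h1).trans (hG.trans ?_)
  have h2 : Real.sqrt (lam - ρ 0) ≤ 10 * Real.sqrt (lam' - ρ 0) := by
    rw [Real.sqrt_le_left (by positivity), mul_pow, Real.sq_sqrt (by linarith)]
    linarith
  nlinarith [abs_nonneg (w ⬝ᵥ p 0)]

theorem initialG_wtanLe {lam : ℝ} {w : Fin d → ℝ} (hl : 0 < lam - ρ 0) (hw : w ⬝ᵥ p 0 ≠ 0) :
    WTanLe ρ p lam w (initialG ρ p lam w) := by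
  unfold WTanLe initialG
  have h1 : Real.sqrt ((lam - ρ 0) * (w ⬝ᵥ p 0) ^ 2) =
      Real.sqrt (lam - ρ 0) * |w ⬝ᵥ p 0| := by
    rw [Real.sqrt_mul hl.le, Real.sqrt_sq_eq_abs]
  have h2 : 0 < Real.sqrt (lam - ρ 0) * |w ⬝ᵥ p 0| :=
    mul_pos (Real.sqrt_pos.2 hl) (abs_pos.2 hw)
  rw [h1, div_mul_cancel₀ _ h2.ne']

theorem initialG_le {lam : ℝ} {w : Fin d → ℝ} {G : ℝ} (hl : 0 < lam - ρ 0) (hw : w ⬝ᵥ p 0 ≠ 0)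
    (hG : WTanLe ρ p lam w G) : initialG ρ p lam w ≤ G := by
  unfold WTanLe at hG
  unfold initialG
  have h1 : Real.sqrt ((lam - ρ 0) * (w ⬝ᵥ p 0) ^ 2) =
      Real.sqrt (lam - ρ 0) * |w ⬝ᵥ p 0| := by
    rw [Real.sqrt_mul hl.le, Real.sqrt_sq_eq_abs]
  have h2 : 0 < Real.sqrt (lam - ρ 0) * |w ⬝ᵥ p 0| :=
    mul_pos (Real.sqrt_pos.2 hl) (abs_pos.2 hw)
  rwa [h1, div_le_iff₀ h2]

theorem initialG_nonneg {lam : ℝ} {w : Fin d → ℝ} : 0 ≤ initialG ρ p lam w := by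
  unfold initialG; positivity

/-- The weight `λ - ρ i` is smallest at the leading index, so the weighted tangent dominates the
Euclidean one. -/
theorem head_sq_ge (h : GapProblem A ρ p c₂ Δt) {lam : ℝ} {w : Fin d → ℝ} {G : ℝ}
    (hl : 0 < lam - ρ 0) (hw : w ⬝ᵥ w = 1) (hG0 : 0 ≤ G) (hG : WTanLe ρ p lam w G) :
    1 - G ^ 2 ≤ (w ⬝ᵥ p 0) ^ 2 := by
  have hsum : ∑ i, (w ⬝ᵥ p i) ^ 2 = 1 := by rw [← h.dot_self, hw]
  unfold WTanLe at hG
  rw [Real.sqrt_le_left (by positivity), mul_pow, mul_pow, Real.sq_sqrt hl.le, sq_abs] at hG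
  have h1 : (lam - ρ 0) * ∑ i ∈ Finset.univ.erase 0, (w ⬝ᵥ p i) ^ 2 ≤
      ∑ i ∈ Finset.univ.erase 0, (lam - ρ i) * (w ⬝ᵥ p i) ^ 2 := by
    rw [Finset.mul_sum]
    exact Finset.sum_le_sum fun i _ =>
      mul_le_mul_of_nonneg_right (by linarith [h.le_zero i]) (sq_nonneg _)
  have h2 : ∑ i ∈ Finset.univ.erase 0, (w ⬝ᵥ p i) ^ 2 ≤ G ^ 2 * (w ⬝ᵥ p 0) ^ 2 := by
    refine le_of_mul_le_mul_left ?_ hl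
    linarith
  rw [← Finset.add_sum_erase _ _ (Finset.mem_univ 0)] at hsum
  have h3 : (w ⬝ᵥ p 0) ^ 2 ≤ 1 := by
    have : 0 ≤ ∑ i ∈ Finset.univ.erase 0, (w ⬝ᵥ p i) ^ 2 :=
      Finset.sum_nonneg fun i _ => sq_nonneg _
    linarith
  nlinarith [sq_nonneg G]

end

/-! ### Values and costs of the elementary computations -/

namespace Counted

variable {α β : Type}

@[simp] theorem val_bind (m : Counted α) (f : α → Counted β) : (m >>= f).val = (f m.val).val := rfl
@[simp] theorem ops_bind (m : Counted α) (f : α → Counted β) :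
    (m >>= f).ops = m.ops + (f m.val).ops := rfl
@[simp] theorem val_pure (a : α) : (pure a : Counted α).val = a := rfl
@[simp] theorem ops_pure (a : α) : (pure a : Counted α).ops = 0 := rfl
@[simp] theorem val_num (a : ℝ) : (num a).val = a := rfl
@[simp] theorem ops_num (a : ℝ) : (num a).ops = 0 := rfl
@[simp] theorem val_add (a b : Counted ℝ) : (a + b).val = a.val + b.val := rfl
@[simp] theorem ops_add (a b : Counted ℝ) : (a + b).ops = a.ops + b.ops + 1 := rfl
@[simp] theorem val_sub (a b : Counted ℝ) : (a - b).val = a.val - b.val := rfl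
@[simp] theorem ops_sub (a b : Counted ℝ) : (a - b).ops = a.ops + b.ops + 1 := rfl
@[simp] theorem val_mul (a b : Counted ℝ) : (a * b).val = a.val * b.val := rfl
@[simp] theorem ops_mul (a b : Counted ℝ) : (a * b).ops = a.ops + b.ops + 1 := rfl
@[simp] theorem val_div (a b : Counted ℝ) : (a / b).val = a.val / b.val := rfl
@[simp] theorem ops_div (a b : Counted ℝ) : (a / b).ops = a.ops + b.ops + 1 := rfl
@[simp] theorem val_sqrtC (a : Counted ℝ) : (sqrtC a).val = Real.sqrt a.val := rfl
@[simp] theorem ops_sqrtC (a : Counted ℝ) : (sqrtC a).ops = a.ops + 1 := rfl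
@[simp] theorem val_absC (a : Counted ℝ) : (absC a).val = |a.val| := rfl
@[simp] theorem ops_absC (a : Counted ℝ) : (absC a).ops = a.ops + 1 := rfl
@[simp] theorem val_vec {d : ℕ} (f : Fin d → Counted ℝ) : (vec f).val = fun i => (f i).val := rfl
@[simp] theorem ops_vec {d : ℕ} (f : Fin d → Counted ℝ) : (vec f).ops = ∑ i, (f i).ops := rfl
@[simp] theorem val_sum {d : ℕ} (f : Fin d → Counted ℝ) : (sum f).val = ∑ i, (f i).val := rfl
@[simp] theorem ops_sum {d : ℕ} (f : Fin d → Counted ℝ) :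
    (sum f).ops = ∑ i, ((f i).ops + 1) := rfl
@[simp] theorem val_dot {d : ℕ} (x y : Fin d → ℝ) : (dot x y).val = x ⬝ᵥ y := rfl
@[simp] theorem ops_dot {d : ℕ} (x y : Fin d → ℝ) : (dot x y).ops = (2 * d : ℕ) := by
  simp [dot, mul_comm, one_add_one_eq_two]
@[simp] theorem val_mulShifted {d : ℕ} (A : Matrix (Fin d) (Fin d) ℝ) (lam : ℝ) (x : Fin d → ℝ) :
    (mulShifted A lam x).val = lam • x - A.mulVec x := by
  ext i; simp [mulShifted, Matrix.mulVec]
@[simp] theorem ops_mulShifted {d : ℕ} (A : Matrix (Fin d) (Fin d) ℝ) (lam : ℝ) (x : Fin d → ℝ) :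
    (mulShifted A lam x).ops = (d * (2 * d + 2) : ℕ) := by
  simp [mulShifted]; ring
@[simp] theorem val_normalize {d : ℕ} (w : Fin d → ℝ) :
    (normalize w).val = (Real.sqrt (w ⬝ᵥ w))⁻¹ • w := by
  ext i; simp [normalize, div_eq_inv_mul]
@[simp] theorem ops_normalize {d : ℕ} (w : Fin d → ℝ) :
    (normalize w).ops = (3 * d + 1 : ℕ) := by
  simp [normalize]; ring

theorem repeatN_succ (body : α → Counted α) (s : α) (n : ℕ) :
    repeatN body s (n + 1) = repeatN body s n >>= body := rfl

/-- The cost of a computation as an extended nonnegative real. -/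
noncomputable def cost (m : Counted α) : ENNReal := (m.ops : ENNReal)

theorem cost_bind (m : Counted α) (f : α → Counted β) :
    (m >>= f).cost = m.cost + (f m.val).cost := by
  simp [cost]

/-- A finite bound excludes `⊤`, so termination comes for free with the cost estimate. -/
theorem costAtMost_of_cost_le {m : Counted α} {B : ℝ} (hB : 0 ≤ B)
    (h : m.cost ≤ ENNReal.ofReal B) : m.CostAtMost B := by
  unfold cost at h
  have hne : m.ops ≠ ⊤ := by
    intro htop
    rw [htop] at h
    simp at h
  obtain ⟨n, hn⟩ := ENat.ne_top_iff_exists.1 hne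
  refine ⟨n, hn.symm, ?_⟩
  rw [← hn] at h
  have : ((n : ℕ) : ENNReal) ≤ ENNReal.ofReal B := by simpa using h
  rw [← ENNReal.ofReal_natCast] at this
  exact (ENNReal.ofReal_le_ofReal_iff hB).1 this

end Counted

section

variable {d : ℕ} (opt : LSO d) (A : Matrix (Fin d) (Fin d) ℝ) (tape : ℕ × ℕ → unitInterval)

/-- The starting point `w / (wᵀ (λ I - A) w)`. -/
noncomputable def startPoint {d : ℕ} (A : Matrix (Fin d) (Fin d) ℝ) (lam : ℝ) (w : Fin d → ℝ) :
    Fin d → ℝ :=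
  (w ⬝ᵥ (lam • w - A.mulVec w))⁻¹ • w

theorem val_solveShifted (R : ℝ) (st : SIState d) :
    (solveShifted opt A tape R st).val =
      (opt.solve A st.lam st.w (startPoint A st.lam st.w) R fun k => tape (st.solved, k)).val := by
  simp only [solveShifted, val_bind, val_mulShifted, val_dot, val_vec, val_div, val_num]
  congr 2
  ext i
  simp [startPoint, div_eq_inv_mul]

theorem ops_solveShifted (R : ℝ) (st : SIState d) :
    (solveShifted opt A tape R st).ops = (2 * d ^ 2 + 5 * d : ℕ) +
      (opt.solve A st.lam st.w (startPoint A st.lam st.w) R fun k => tape (st.solved, k)).ops := by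
  have e : (fun i => st.w i / (st.w ⬝ᵥ (st.lam • st.w - A.mulVec st.w))) =
      startPoint A st.lam st.w := by
    ext i; simp [startPoint, div_eq_inv_mul]
  simp only [solveShifted, ops_bind, val_mulShifted, val_dot, val_vec, val_div, val_num,
    ops_mulShifted, ops_dot, ops_vec, ops_div, ops_num, e]
  simp
  ring

theorem val_powerStep (R : ℝ) (st : SIState d) :
    (powerStep opt A tape R st).val =
      ⟨(Real.sqrt ((solveShifted opt A tape R st).val ⬝ᵥ (solveShifted opt A tape R st).val))⁻¹ •
        (solveShifted opt A tape R st).val, st.lam, st.gap, st.solved + 1⟩ := by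
  simp [powerStep]

theorem ops_powerStep (R : ℝ) (st : SIState d) :
    (powerStep opt A tape R st).ops = (solveShifted opt A tape R st).ops + (3 * d + 1 : ℕ) := by
  simp [powerStep]

/-- The last part of a stage of Phase I, after its power iterations. -/
noncomputable def shiftUpdate (c₂ Δt : ℝ) (st : SIState d) : Counted (SIState d) := do
  let u ← solveShifted opt A tape (1024 / Δt ^ 2) st
  let σ ← num 1 + (num 1 - num c₂) / num c₂ * num Δt
  let gap ← num (1 / 2) * (num 1 / (dot st.w u - num σ / num 8))
  let lam ← num st.lam - num gap / num 2
  pure ⟨st.w, lam, gap, st.solved + 1⟩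

theorem shiftStage_eq (c₂ Δt : ℝ) (m₁ : ℕ) (st : SIState d) :
    shiftStage opt A tape c₂ Δt m₁ st =
      repeatN (powerStep opt A tape (32 * 10 ^ (2 * m₁ + 1) / Δt ^ (2 * m₁))) st m₁ >>=
        shiftUpdate opt A tape c₂ Δt := rfl

theorem val_shiftUpdate (c₂ Δt : ℝ) (st : SIState d) :
    (shiftUpdate opt A tape c₂ Δt st).val =
      ⟨st.w, st.lam -
        gapEstimate c₂ Δt st.w (solveShifted opt A tape (1024 / Δt ^ 2) st).val / 2,
        gapEstimate c₂ Δt st.w (solveShifted opt A tape (1024 / Δt ^ 2) st).val,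
        st.solved + 1⟩ := by
  simp [shiftUpdate, gapEstimate]

theorem ops_shiftUpdate (c₂ Δt : ℝ) (st : SIState d) :
    (shiftUpdate opt A tape c₂ Δt st).ops =
      (solveShifted opt A tape (1024 / Δt ^ 2) st).ops + (2 * d + 10 : ℕ) := by
  simp [shiftUpdate]; ring

end

/-! ### The sequence of least squares problems -/

/-- Current vector, current shift, and a counter: `c < m` for the power iterations of a stage of
Phase I, `c = m` for its estimation step, and `c > m` for the power iterations of Phase II. -/
abbrev FlatState (d : ℕ) := (Fin d → ℝ) × ℝ × ℕ

/-- The accuracy ratio used in a state with counter `c`. -/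
noncomputable def flatRatio (Δt : ℝ) (m c : ℕ) : ℝ :=
  if c < m then 32 * 10 ^ (2 * m + 1) / Δt ^ (2 * m) else if c = m then 1024 / Δt ^ 2 else 100

/-- The states in which the solvers are analysed. -/
def Admissible {d : ℕ} [NeZero d] (ρ : Fin d → ℝ) (lo lam : ℝ) (w : Fin d → ℝ) : Prop :=
  w ⬝ᵥ w = 1 ∧ lo ≤ lam - ρ 0 ∧ lam ≤ 2

/-- The next state, from the solution `x` of the current least squares problem. -/
noncomputable def flatUpdate {d : ℕ} (c₂ Δt : ℝ) (m : ℕ) (s : FlatState d) (x : Fin d → ℝ) :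
    FlatState d :=
  if s.2.2 = m then
    (s.1, s.2.1 - gapEstimate c₂ Δt s.1 x / 2,
      if gapEstimate c₂ Δt s.1 x ≤ Δt then m + 1 else 0)
  else ((Real.sqrt (x ⬝ᵥ x))⁻¹ • x, s.2.1, s.2.2 + 1)

open Classical in
/-- One least squares problem and the following update; `sol R lam w u` is the solution obtained
with the random numbers `u`. -/
noncomputable def flatStep {d : ℕ} [NeZero d] (ρ : Fin d → ℝ)
    (sol : ℝ → ℝ → (Fin d → ℝ) → (ℕ → unitInterval) → Fin d → ℝ) (c₂ Δt : ℝ) (m : ℕ)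
    (s : FlatState d) (u : ℕ → unitInterval) : FlatState d :=
  -- Elsewhere the chain is frozen. The bounds on solver work hold only in admissible states, and
  -- with this convention they can be summed along every path without first proving that the path is
  -- followed by the algorithm.
  if Admissible ρ (9 / 20 * Δt) s.2.1 s.1 then
    flatUpdate c₂ Δt m s (sol (flatRatio Δt m s.2.2) s.2.1 s.1 u)
  else s

open Classical in
/-- The number of solver iterations spent in a state. -/
noncomputable def flatCount {d : ℕ} [NeZero d] (ρ : Fin d → ℝ)
    (cnt : ℝ → ℝ → (Fin d → ℝ) → (ℕ → unitInterval) → ENNReal) (Δt : ℝ) (m : ℕ)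
    (s : FlatState d) (u : ℕ → unitInterval) : ENNReal :=
  if Admissible ρ (9 / 20 * Δt) s.2.1 s.1 then cnt (flatRatio Δt m s.2.2) s.2.1 s.1 u else 0

/-- The states along the whole run; problem number `k` reads the random numbers `u k`. -/
noncomputable def flatRun {d : ℕ} [NeZero d] (ρ : Fin d → ℝ)
    (sol : ℝ → ℝ → (Fin d → ℝ) → (ℕ → unitInterval) → Fin d → ℝ) (c₂ Δt : ℝ) (m : ℕ)
    (s₀ : FlatState d) (u : ℕ → ℕ → unitInterval) : ℕ → FlatState d
  | 0 => s₀
  | k + 1 => flatStep ρ sol c₂ Δt m (flatRun ρ sol c₂ Δt m s₀ u k) (u k)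

/-- `sol` and `cnt` describe the results and the numbers of iterations of `opt`, where
`cnt = ⊤` stands for a run that does not terminate. -/
def SolverSpec {d : ℕ} [NeZero d] (opt : LSO d) (A : Matrix (Fin d) (Fin d) ℝ) (ρ : Fin d → ℝ)
    (p : Fin d → Fin d → ℝ) (lo : ℝ)
    (sol : ℝ → ℝ → (Fin d → ℝ) → (ℕ → unitInterval) → Fin d → ℝ)
    (cnt : ℝ → ℝ → (Fin d → ℝ) → (ℕ → unitInterval) → ENNReal) (κ : ℕ) : Prop :=
  ∀ (R lam : ℝ) (w : Fin d → ℝ) (u : ℕ → unitInterval), 1 ≤ R → Admissible ρ lo lam w →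
    cnt R lam w u ≠ ⊤ →
    (opt.solve A lam w (startPoint A lam w) R u).val = sol R lam w u ∧
      SolvesTo A ρ p lam R w (sol R lam w u) ∧
      (opt.solve A lam w (startPoint A lam w) R u).cost ≤
        κ * ((d : ENNReal) ^ 2 + d * cnt R lam w u)

section

variable {d : ℕ} [NeZero d] {A : Matrix (Fin d) (Fin d) ℝ} {ρ : Fin d → ℝ}
  {p : Fin d → Fin d → ℝ} {c₂ Δt : ℝ} {opt : LSO d} {κ m : ℕ}
  {sol : ℝ → ℝ → (Fin d → ℝ) → (ℕ → unitInterval) → Fin d → ℝ}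
  {cnt : ℝ → ℝ → (Fin d → ℝ) → (ℕ → unitInterval) → ENNReal}
  {tape : ℕ × ℕ → unitInterval} {s₀ : FlatState d}

theorem natCast_le_sq_mul (a b n : ℕ) (hd : 1 ≤ n) :
    ((a * n + b : ℕ) : ENNReal) ≤ ((a + b : ℕ) : ENNReal) * (n : ENNReal) ^ 2 := by
  exact_mod_cast (by nlinarith [Nat.mul_le_mul_left a (Nat.mul_le_mul_left n hd),
    Nat.mul_le_mul_left b (Nat.mul_le_mul hd hd)] : a * n + b ≤ (a + b) * n ^ 2)

/-- A least squares problem of the algorithm, in an admissible state. -/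
theorem solveShifted_spec (hspec : SolverSpec opt A ρ p (9 / 20 * Δt) sol cnt κ)
    {R : ℝ} (hR : 1 ≤ R) {st : SIState d} (hadm : Admissible ρ (9 / 20 * Δt) st.lam st.w)
    (hfin : cnt R st.lam st.w (fun k => tape (st.solved, k)) ≠ ⊤) :
    (solveShifted opt A tape R st).val = sol R st.lam st.w (fun k => tape (st.solved, k)) ∧
      SolvesTo A ρ p st.lam R st.w (sol R st.lam st.w (fun k => tape (st.solved, k))) ∧
      (solveShifted opt A tape R st).cost ≤ (κ + 7 : ℕ) * ((d : ENNReal) ^ 2 +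
        d * cnt R st.lam st.w (fun k => tape (st.solved, k))) := by
  obtain ⟨h1, h2, h3⟩ := hspec R st.lam st.w _ hR hadm hfin
  refine ⟨by rw [val_solveShifted, h1], h2, ?_⟩
  rw [cost, ops_solveShifted]
  rw [cost] at h3
  have h4 : ((2 * d ^ 2 + 5 * d : ℕ) : ENNReal) ≤ (7 : ℕ) * (d : ENNReal) ^ 2 := by
    exact_mod_cast (by nlinarith [Nat.pos_of_ne_zero (NeZero.ne d)] :
      2 * d ^ 2 + 5 * d ≤ 7 * d ^ 2)
  rw [ENat.toENNReal_add]
  generalize cnt R st.lam st.w (fun k => tape (st.solved, k)) = t at *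
  calc _ ≤ ((7 : ℕ) : ENNReal) * (d : ENNReal) ^ 2 + κ * ((d : ENNReal) ^ 2 + d * t) :=
        add_le_add (by simpa using h4) h3
    _ ≤ ((7 : ℕ) : ENNReal) * ((d : ENNReal) ^ 2 + d * t) + κ * ((d : ENNReal) ^ 2 + d * t) := by
        gcongr; exact le_self_add
    _ = _ := by push_cast; ring

/-- The cost of the least squares problem solved in state `k` of the run, and of the vector
operations around it. -/
noncomputable def flatCost {d : ℕ} [NeZero d] (ρ : Fin d → ℝ)
    (sol : ℝ → ℝ → (Fin d → ℝ) → (ℕ → unitInterval) → Fin d → ℝ)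
    (cnt : ℝ → ℝ → (Fin d → ℝ) → (ℕ → unitInterval) → ENNReal) (κ : ℕ) (c₂ Δt : ℝ) (m : ℕ)
    (s₀ : FlatState d) (u : ℕ → ℕ → unitInterval) (k : ℕ) : ENNReal :=
  (κ + 19 : ℕ) * ((d : ENNReal) ^ 2 +
    d * flatCount ρ cnt Δt m (flatRun ρ sol c₂ Δt m s₀ u k) (u k))

theorem flatStep_of_admissible {s : FlatState d} {u : ℕ → unitInterval}
    (hadm : Admissible ρ (9 / 20 * Δt) s.2.1 s.1) :
    flatStep ρ sol c₂ Δt m s u =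
      flatUpdate c₂ Δt m s (sol (flatRatio Δt m s.2.2) s.2.1 s.1 u) := if_pos hadm

theorem flatCount_of_admissible {s : FlatState d} {u : ℕ → unitInterval}
    (hadm : Admissible ρ (9 / 20 * Δt) s.2.1 s.1) :
    flatCount ρ cnt Δt m s u = cnt (flatRatio Δt m s.2.2) s.2.1 s.1 u := if_pos hadm

theorem unit_normalize {x : Fin d → ℝ} {q : Fin d → ℝ} (hx : x ⬝ᵥ q ≠ 0) :
    0 < Real.sqrt (x ⬝ᵥ x) ∧
      ((Real.sqrt (x ⬝ᵥ x))⁻¹ • x) ⬝ᵥ ((Real.sqrt (x ⬝ᵥ x))⁻¹ • x) = 1 ∧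
      ((Real.sqrt (x ⬝ᵥ x))⁻¹ • x) ⬝ᵥ q ≠ 0 := by
  have h0 : x ≠ 0 := by rintro rfl; simp at hx
  have hnn : 0 ≤ x ⬝ᵥ x := Finset.sum_nonneg fun i _ => mul_self_nonneg (x i)
  have hpos : 0 < x ⬝ᵥ x := lt_of_le_of_ne hnn (fun h => h0 (dotProduct_self_eq_zero.1 h.symm))
  have hs := Real.sqrt_pos.2 hpos
  refine ⟨hs, ?_, ?_⟩
  · rw [smul_dotProduct, dotProduct_smul, smul_eq_mul, smul_eq_mul, ← mul_assoc, ← mul_inv,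
      Real.mul_self_sqrt hnn, inv_mul_cancel₀ hpos.ne']
  · rw [smul_dotProduct, smul_eq_mul]
    exact mul_ne_zero (inv_ne_zero hs.ne') hx

/-- A power iteration of the algorithm follows the run. -/
theorem powerStep_flat (hspec : SolverSpec opt A ρ p (9 / 20 * Δt) sol cnt κ)
    {R : ℝ} (hR : 1 ≤ R) {st : SIState d} {c : ℕ}
    (hrun : flatRun ρ sol c₂ Δt m s₀ (fun k j => tape (k, j)) st.solved = (st.w, st.lam, c))
    (hc : c ≠ m) (hRc : flatRatio Δt m c = R)
    (hadm : Admissible ρ (9 / 20 * Δt) st.lam st.w)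
    (hfin : flatCount ρ cnt Δt m (flatRun ρ sol c₂ Δt m s₀ (fun k j => tape (k, j)) st.solved)
      (fun j => tape (st.solved, j)) ≠ ⊤) :
    ∃ x, SolvesTo A ρ p st.lam R st.w x ∧
      (powerStep opt A tape R st).val =
        ⟨(Real.sqrt (x ⬝ᵥ x))⁻¹ • x, st.lam, st.gap, st.solved + 1⟩ ∧
      flatRun ρ sol c₂ Δt m s₀ (fun k j => tape (k, j)) (st.solved + 1) =
        ((Real.sqrt (x ⬝ᵥ x))⁻¹ • x, st.lam, c + 1) ∧
      (powerStep opt A tape R st).cost ≤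
        flatCost ρ sol cnt κ c₂ Δt m s₀ (fun k j => tape (k, j)) st.solved := by
  have hcount : flatCount ρ cnt Δt m
      (flatRun ρ sol c₂ Δt m s₀ (fun k j => tape (k, j)) st.solved)
      (fun j => tape (st.solved, j)) = cnt R st.lam st.w (fun j => tape (st.solved, j)) := by
    rw [hrun, flatCount_of_admissible hadm, hRc]
  rw [hcount] at hfin
  obtain ⟨h1, h2, h3⟩ := solveShifted_spec (A := A) (p := p) hspec hR hadm hfin
  refine ⟨_, h2, ?_, ?_, ?_⟩
  · rw [val_powerStep, h1]
  · rw [flatRun, hrun, flatStep_of_admissible hadm, flatUpdate, if_neg hc, hRc]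
  · rw [flatCost, hcount]
    rw [cost] at h3 ⊢
    rw [ops_powerStep, ENat.toENNReal_add]
    have h4 := natCast_le_sq_mul 3 1 d (Nat.pos_of_ne_zero (NeZero.ne d))
    generalize cnt R st.lam st.w (fun k => tape (st.solved, k)) = t at *
    calc _ ≤ ((κ + 7 : ℕ) : ENNReal) * ((d : ENNReal) ^ 2 + d * t) +
          ((3 + 1 : ℕ) : ENNReal) * (d : ENNReal) ^ 2 := add_le_add h3 (by simpa using h4)
      _ ≤ ((κ + 7 : ℕ) : ENNReal) * ((d : ENNReal) ^ 2 + d * t) +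
          ((12 : ℕ) : ENNReal) * ((d : ENNReal) ^ 2 + d * t) := by
          gcongr
          · norm_num
          · exact le_self_add
      _ = _ := by push_cast; ring

/-- The estimation step of the algorithm follows the run. -/
theorem shiftUpdate_flat (hspec : SolverSpec opt A ρ p (9 / 20 * Δt) sol cnt κ)
    (hR : 1 ≤ 1024 / Δt ^ 2) {st : SIState d}
    (hrun : flatRun ρ sol c₂ Δt m s₀ (fun k j => tape (k, j)) st.solved = (st.w, st.lam, m))
    (hadm : Admissible ρ (9 / 20 * Δt) st.lam st.w)
    (hfin : flatCount ρ cnt Δt m (flatRun ρ sol c₂ Δt m s₀ (fun k j => tape (k, j)) st.solved)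
      (fun j => tape (st.solved, j)) ≠ ⊤) :
    ∃ u, SolvesTo A ρ p st.lam (1024 / Δt ^ 2) st.w u ∧
      (shiftUpdate opt A tape c₂ Δt st).val =
        ⟨st.w, st.lam - gapEstimate c₂ Δt st.w u / 2, gapEstimate c₂ Δt st.w u,
          st.solved + 1⟩ ∧
      flatRun ρ sol c₂ Δt m s₀ (fun k j => tape (k, j)) (st.solved + 1) =
        (st.w, st.lam - gapEstimate c₂ Δt st.w u / 2,
          if gapEstimate c₂ Δt st.w u ≤ Δt then m + 1 else 0) ∧
      (shiftUpdate opt A tape c₂ Δt st).cost ≤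
        flatCost ρ sol cnt κ c₂ Δt m s₀ (fun k j => tape (k, j)) st.solved := by
  have hRc : flatRatio Δt m m = 1024 / Δt ^ 2 := by simp [flatRatio]
  have hcount : flatCount ρ cnt Δt m
      (flatRun ρ sol c₂ Δt m s₀ (fun k j => tape (k, j)) st.solved)
      (fun j => tape (st.solved, j)) =
        cnt (1024 / Δt ^ 2) st.lam st.w (fun j => tape (st.solved, j)) := by
    rw [hrun, flatCount_of_admissible hadm, hRc]
  rw [hcount] at hfin
  obtain ⟨h1, h2, h3⟩ := solveShifted_spec (A := A) (p := p) hspec hR hadm hfin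
  refine ⟨_, h2, ?_, ?_, ?_⟩
  · rw [val_shiftUpdate, h1]
  · rw [flatRun, hrun, flatStep_of_admissible hadm, flatUpdate, if_pos rfl, hRc]
  · rw [flatCost, hcount]
    rw [cost] at h3 ⊢
    rw [ops_shiftUpdate, ENat.toENNReal_add]
    have h4 := natCast_le_sq_mul 2 10 d (Nat.pos_of_ne_zero (NeZero.ne d))
    generalize cnt (1024 / Δt ^ 2) st.lam st.w (fun k => tape (st.solved, k)) = t at *
    calc _ ≤ ((κ + 7 : ℕ) : ENNReal) * ((d : ENNReal) ^ 2 + d * t) +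
          ((2 + 10 : ℕ) : ENNReal) * (d : ENNReal) ^ 2 := add_le_add h3 (by simpa using h4)
      _ ≤ ((κ + 7 : ℕ) : ENNReal) * ((d : ENNReal) ^ 2 + d * t) +
          ((12 : ℕ) : ENNReal) * ((d : ENNReal) ^ 2 + d * t) := by
          gcongr
          exact le_self_add
      _ = _ := by push_cast; ring

end

/-! ### Phase I: power iterations, stages and the shrinking shift. -/

section

variable {d : ℕ} [NeZero d] {A : Matrix (Fin d) (Fin d) ℝ} {ρ : Fin d → ℝ}
  {p : Fin d → Fin d → ℝ} {c₂ Δt : ℝ} {opt : LSO d} {κ m : ℕ}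
  {sol : ℝ → ℝ → (Fin d → ℝ) → (ℕ → unitInterval) → Fin d → ℝ}
  {cnt : ℝ → ℝ → (Fin d → ℝ) → (ℕ → unitInterval) → ENNReal}
  {tape : ℕ × ℕ → unitInterval} {s₀ : FlatState d} {X : ℕ → FlatState d} {C : ℕ → ENNReal}

theorem one_le_powerRatio (h : GapProblem A ρ p c₂ Δt) (m : ℕ) :
    (1 : ℝ) ≤ 32 * 10 ^ (2 * m + 1) / Δt ^ (2 * m) := by
  rw [le_div_iff₀ (pow_pos h.est_pos _)]
  have h1 : Δt ^ (2 * m) ≤ 1 := pow_le_one₀ h.est_pos.le h.est_le_one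
  have h2 : (1 : ℝ) ≤ 10 ^ (2 * m + 1) := one_le_pow₀ (by norm_num)
  linarith

theorem one_le_estimateRatio (h : GapProblem A ρ p c₂ Δt) : (1 : ℝ) ≤ 1024 / Δt ^ 2 := by
  rw [le_div_iff₀ (pow_pos h.est_pos _)]
  have h1 : Δt ^ 2 ≤ 1 := pow_le_one₀ h.est_pos.le h.est_le_one
  linarith

/-- The power iterations of a stage of Phase I. -/
theorem power_loop (h : GapProblem A ρ p c₂ Δt)
    (hspec : SolverSpec opt A ρ p (9 / 20 * Δt) sol cnt κ) {a : ℝ}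
    (ha : 0 < a) (ha1 : a ≤ 1) (hm : (7 / 8 : ℝ) ^ m ≤ a ^ 2 / 16) (hm2 : 2 ≤ m)
    (hX : X = flatRun ρ sol c₂ Δt m s₀ fun k j => tape (k, j))
    (hC : C = flatCost ρ sol cnt κ c₂ Δt m s₀ fun k j => tape (k, j)) {st : SIState d}
    (hrun : X st.solved = (st.w, st.lam, 0)) (hl : 3 / 4 * Δt ≤ st.lam - ρ 0)
    (hl1 : st.lam ≤ 1 + Δt) (hw : StageInv ρ p a st.lam 0 st.w)
    (hfin : ∀ i ≤ m, (X (st.solved + i)).2.2 ≤ m →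
      flatCount ρ cnt Δt m (X (st.solved + i)) (fun j => tape (st.solved + i, j)) ≠ ⊤)
    {j : ℕ} (hj : j ≤ m) :
    ∃ w gap, (repeatN (powerStep opt A tape (32 * 10 ^ (2 * m + 1) / Δt ^ (2 * m))) st j).val =
        ⟨w, st.lam, gap, st.solved + j⟩ ∧
      X (st.solved + j) = (w, st.lam, j) ∧ StageInv ρ p a st.lam j w ∧
      (repeatN (powerStep opt A tape (32 * 10 ^ (2 * m + 1) / Δt ^ (2 * m))) st j).cost ≤
        ∑ i ∈ Finset.range j, C (st.solved + i) ∧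
      (j = m → Finset.univ.erase 0 ⊆ farIdx ρ st.lam → WTanLe ρ p st.lam w (1 / 10)) := by
  have hΔ := h.est_pos
  have hΔ1 := h.est_le_one
  induction j with
  | zero =>
    refine ⟨st.w, st.gap, rfl, hrun, hw, ?_, fun h0 => by omega⟩
    simp [repeatN, cost]
  | succ j ih =>
    obtain ⟨w, gap, hval, hrun', hinv, hcost, -⟩ := ih (by omega)
    have hadm : Admissible ρ (9 / 20 * Δt) st.lam w := ⟨hinv.unit, by linarith, by linarith⟩
    -- Finiteness is assumed only for states whose counter is at most `m`; the induction hypothesis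
    -- supplies the counter `j`.
    have hf := hfin j (by omega) (by rw [hrun']; exact (Nat.le_of_succ_le hj))
    subst hX hC
    obtain ⟨x, hx, hv, hr, hc⟩ := powerStep_flat (A := A) (ρ := ρ) (p := p) hspec
      (one_le_powerRatio h m) (st := ⟨w, st.lam, gap, st.solved + j⟩) (c := j) hrun' (by omega)
      (by rw [flatRatio, if_pos (by omega)]) hadm hf
    obtain ⟨h0, ht, hfar, hg⟩ := hinv.step h ha ha1 hm hm2 (by omega) hl
      (by linarith [h.init_le_one]) (by linarith) hx
    obtain ⟨hs, hu, hh⟩ := unit_normalize h0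
    refine ⟨_, gap, ?_, hr, ⟨hu, hh, ht.smul _, hfar.smul _⟩, ?_, fun e1 e2 => (hg e1 e2).smul _⟩
    · rw [repeatN_succ, val_bind, hval, hv]; rfl
    · rw [repeatN_succ, cost_bind, hval, Finset.sum_range_succ]
      exact add_le_add hcost hc

/-- What holds at the end of a stage of Phase I that starts with the shift `lam`. -/
structure StageEnd {d : ℕ} [NeZero d] (ρ : Fin d → ℝ) (p : Fin d → Fin d → ℝ) (Δt a : ℝ) (m : ℕ)
    (X : ℕ → FlatState d) (lam : ℝ) (st : SIState d) : Prop where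
  run : X st.solved = (st.w, st.lam, if st.gap ≤ Δt then m + 1 else 0)
  unit : st.w ⬝ᵥ st.w = 1
  head : st.w ⬝ᵥ p 0 ≠ 0
  tan : TanLe p (Finset.univ.erase 0) st.w (1 / a)
  shift_le : st.lam - ρ 0 ≤ 3 / 4 * (lam - ρ 0)
  gap_le : st.gap ≤ 4 / 5 * (lam - ρ 0)
  shift_ge : 9 / 20 * Δt ≤ st.lam - ρ 0
  shift_ge_of_lt : Δt < st.gap → 3 / 4 * Δt ≤ st.lam - ρ 0
  weighted : st.gap ≤ Δt → WTanLe ρ p st.lam st.w 1 ∧ st.lam - ρ 0 ≤ 3 / 2 * (ρ 0 - ρ 1)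

/-- One stage of Phase I. -/
theorem shiftStage_spec (h : GapProblem A ρ p c₂ Δt)
    (hspec : SolverSpec opt A ρ p (9 / 20 * Δt) sol cnt κ) {a : ℝ}
    (ha : 0 < a) (ha1 : a ≤ 1) (hm : (7 / 8 : ℝ) ^ m ≤ a ^ 2 / 16) (hm2 : 2 ≤ m)
    (hX : X = flatRun ρ sol c₂ Δt m s₀ fun k j => tape (k, j))
    (hC : C = flatCost ρ sol cnt κ c₂ Δt m s₀ fun k j => tape (k, j)) {st : SIState d}
    (hrun : X st.solved = (st.w, st.lam, 0)) (hl : 3 / 4 * Δt ≤ st.lam - ρ 0)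
    (hl1 : st.lam ≤ 1 + Δt) (hu : st.w ⬝ᵥ st.w = 1) (hh : st.w ⬝ᵥ p 0 ≠ 0)
    (ht : TanLe p (Finset.univ.erase 0) st.w (1 / a))
    (hfin : ∀ i ≤ m, (X (st.solved + i)).2.2 ≤ m →
      flatCount ρ cnt Δt m (X (st.solved + i)) (fun j => tape (st.solved + i, j)) ≠ ⊤) :
    StageEnd ρ p Δt a m X st.lam (shiftStage opt A tape c₂ Δt m st).val ∧
      (shiftStage opt A tape c₂ Δt m st).val.solved = st.solved + (m + 1) ∧
      (shiftStage opt A tape c₂ Δt m st).cost ≤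
        ∑ i ∈ Finset.range (m + 1), C (st.solved + i) ∧
      ∀ i ≤ m, (X (st.solved + i)).2.2 ≤ m := by
  have hΔ := h.est_pos
  have hΔ1 := h.est_le_one
  have hx0 : 0 < st.lam - ρ 0 := by linarith
  have hw : StageInv ρ p a st.lam 0 st.w :=
    ⟨hu, hh, ht, by simpa using ht.mono (farIdx_subset hx0)⟩
  have hloop := fun {j : ℕ} (hj : j ≤ m) =>
    power_loop h hspec ha ha1 hm hm2 hX hC hrun hl hl1 hw hfin hj
  have hle : ∀ i ≤ m, (X (st.solved + i)).2.2 ≤ m := by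
    intro i hi
    obtain ⟨w, gap, -, hr, -⟩ := hloop hi
    rw [hr]; exact hi
  obtain ⟨w, gap, hval, hr, hinv, hcost, hG⟩ := hloop le_rfl
  have hadm : Admissible ρ (9 / 20 * Δt) st.lam w := ⟨hinv.unit, by linarith, by linarith⟩
  have hf := hfin m le_rfl (hle m le_rfl)
  subst hX hC
  obtain ⟨u, hus, hv, hr', hc⟩ := shiftUpdate_flat (A := A) (ρ := ρ) (p := p) hspec
    (one_le_estimateRatio h) (st := ⟨w, st.lam, gap, st.solved + m⟩) hr hadm hf
  obtain ⟨hg1, hg2⟩ := gapEstimate_bounds h ha ha1 hm hl hl1 hinv hus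
  set g := gapEstimate c₂ Δt w u with hgdef
  have hstage : (shiftStage opt A tape c₂ Δt m st).val =
      ⟨w, st.lam - g / 2, g, st.solved + m + 1⟩ := by
    rw [shiftStage_eq, val_bind, hval, hv]
  refine ⟨?_, ?_, ?_, hle⟩
  · rw [hstage]
    -- With `x / 2 ≤ g ≤ 4 * x / 5` the new distance `x - g / 2` lies between `3 * x / 5` and `3 * x
    -- / 4`. If `g > Δt`, then `x > 5 / 4 * Δt` and at least `3 / 4 * Δt` remains, as the next stage
    -- requires; otherwise `x ≥ 3 / 4 * Δt` leaves `9 / 20 * Δt`.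
    refine ⟨hr', hinv.unit, hinv.head, hinv.tan, ?_, hg2, ?_, ?_, ?_⟩
    · simp only; linarith
    · simp only; linarith
    · intro hlt; simp only at hlt ⊢; linarith
    · intro hle'
      simp only at hle' ⊢
      -- At the exit `x ≤ 2 * g ≤ 2 * (ρ 0 - ρ 1)`, so the other eigenvalues are at distance at
      -- least `3 / 2 * x` from the shift and all count as far.
      have hfar : Finset.univ.erase 0 ⊆ farIdx ρ st.lam := by
        intro i hi
        simp only [farIdx, Finset.mem_filter, Finset.mem_univ, true_and]
        linarith [h.gap_le i (Finset.ne_of_mem_erase hi), h.est_le_gap]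
      exact ⟨initialG_le_one hx0 (by linarith) (by linarith) (hG rfl hfar),
        by linarith [h.est_le_gap]⟩
  · rw [hstage]; ring
  · rw [shiftStage_eq, cost_bind, hval, Finset.sum_range_succ]
    exact add_le_add hcost hc

/-- The stages of Phase I up to its end. -/
theorem stages_spec (h : GapProblem A ρ p c₂ Δt)
    (hspec : SolverSpec opt A ρ p (9 / 20 * Δt) sol cnt κ) {a : ℝ}
    (ha : 0 < a) (ha1 : a ≤ 1) (hm : (7 / 8 : ℝ) ^ m ≤ a ^ 2 / 16) (hm2 : 2 ≤ m) {w₀ : Fin d → ℝ}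
    (hX : X = flatRun ρ sol c₂ Δt m (w₀, 1 + Δt, 0) fun k j => tape (k, j))
    (hC : C = flatCost ρ sol cnt κ c₂ Δt m (w₀, 1 + Δt, 0) fun k j => tape (k, j))
    (hu : w₀ ⬝ᵥ w₀ = 1) (hh : w₀ ⬝ᵥ p 0 ≠ 0)
    (ht : TanLe p (Finset.univ.erase 0) w₀ (1 / a)) {S : ℕ}
    (hfin : ∀ k < (S + 1) * (m + 1), (X k).2.2 ≤ m →
      flatCount ρ cnt Δt m (X k) (fun j => tape (k, j)) ≠ ⊤) {st₁ : Counted (SIState d)}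
    (hst : st₁ = shiftStage opt A tape c₂ Δt m ⟨w₀, 1 + Δt, 0, 0⟩) {s : ℕ} (hs : s ≤ S)
    (hgap : ∀ t < s, Δt < (repeatN (shiftStage opt A tape c₂ Δt m) st₁.val t).val.gap) :
    (∃ lam, lam - ρ 0 ≤ (3 / 4) ^ s ∧ lam ≤ 1 + Δt ∧
      StageEnd ρ p Δt a m X lam (repeatN (shiftStage opt A tape c₂ Δt m) st₁.val s).val) ∧
    (repeatN (shiftStage opt A tape c₂ Δt m) st₁.val s).val.solved = (s + 1) * (m + 1) ∧
    st₁.cost + (repeatN (shiftStage opt A tape c₂ Δt m) st₁.val s).cost ≤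
      ∑ k ∈ Finset.range ((s + 1) * (m + 1)), C k ∧
    ∀ k < (s + 1) * (m + 1), (X k).2.2 ≤ m := by
  have hΔ := h.est_pos
  have hΔ1 := h.est_le_one
  induction s with
  | zero =>
    have h1 := shiftStage_spec (st := ⟨w₀, 1 + Δt, 0, 0⟩) h hspec ha ha1 hm hm2 hX hC
      (by rw [hX]; rfl) (by simp only; linarith [h.le_one]) le_rfl hu hh ht
      (fun i hi => by
        simp only [Nat.zero_add]
        exact hfin i (by nlinarith))
    rw [← hst] at h1
    obtain ⟨he, hsol, hcost, hle⟩ := h1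
    simp only [Nat.zero_add] at hsol hcost hle
    refine ⟨⟨1 + Δt, by simpa using h.init_le_one, le_rfl, he⟩, by rw [Nat.zero_add, one_mul]; exact hsol, ?_, ?_⟩
    · simpa [repeatN, cost] using hcost
    · intro k hk
      exact hle k (by omega)
  | succ s ih =>
    obtain ⟨⟨lam, hlam, hlam1, he⟩, hsol, hcost, hle⟩ := ih (by omega) (fun t ht' => hgap t (by omega))
    have hg := hgap s (by omega)
    rw [repeatN_succ, val_bind, cost_bind]
    set st := (repeatN (shiftStage opt A tape c₂ Δt m) st₁.val s).val with hstdef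
    -- The loop continues only if the estimate exceeds `Δt`, and this is what restores the lower
    -- bound needed on entry to the next stage.
    have hx := he.shift_ge_of_lt hg
    have hll : st.lam ≤ lam := by
      have := he.shift_le
      have := he.shift_ge
      linarith
    have hrun := he.run
    rw [if_neg (not_le.2 hg)] at hrun
    have hmul : (s + 1 + 1) * (m + 1) = (s + 1) * (m + 1) + (m + 1) := by ring
    have hmulle : (s + 1 + 1) * (m + 1) ≤ (S + 1) * (m + 1) :=
      Nat.mul_le_mul_right _ (by omega)
    obtain ⟨he', hsol', hcost', hle'⟩ := shiftStage_spec h hspec ha ha1 hm hm2 hX hC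
      hrun hx (by linarith) he.unit he.head he.tan
      (fun i hi => hfin (st.solved + i) (by rw [hsol]; omega))
    refine ⟨⟨st.lam, ?_, by linarith, he'⟩, ?_, ?_, ?_⟩
    · rw [pow_succ]; linarith [he.shift_le]
    · rw [hsol', hsol, hmul]
    · rw [hmul, Finset.sum_range_add, ← add_assoc]
      rw [hsol] at hcost'
      exact add_le_add hcost hcost'
    · intro k hk
      by_cases hk' : k < (s + 1) * (m + 1)
      · exact hle k hk'
      · obtain ⟨i, rfl⟩ := Nat.exists_eq_add_of_le (not_lt.1 hk')
        rw [← hsol]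
        exact hle' i (by omega)

end

/-- The factor `8` in the definition of `m₁` comes from `log (7 / 8) ≤ -1 / 8`. -/
theorem seven_eighths_pow_le {a : ℝ} {m : ℕ} (ha : 0 < a) (hm : 8 * Real.log (16 / a ^ 2) ≤ m) :
    (7 / 8 : ℝ) ^ m ≤ a ^ 2 / 16 := by
  have h1 : Real.log (7 / 8) ≤ -(1 / 8) := by
    have := Real.log_le_sub_one_of_pos (x := 7 / 8) (by norm_num)
    linarith
  have h2 : 0 < a ^ 2 / 16 := by positivity
  rw [← Real.log_le_log_iff (by positivity) h2, Real.log_pow]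
  have h3 : Real.log (16 / a ^ 2) = - Real.log (a ^ 2 / 16) := by
    rw [← Real.log_inv, inv_div]
  have h4 : (0 : ℝ) ≤ m := Nat.cast_nonneg m
  rw [h3] at hm
  nlinarith

theorem two_le_of_log_le {a : ℝ} {m : ℕ} (ha : 0 < a) (ha1 : a ≤ 1)
    (hm : 8 * Real.log (16 / a ^ 2) ≤ m) : 2 ≤ m := by
  have h1 : (1 : ℝ) / 4 ≤ Real.log (16 / a ^ 2) := by
    rw [Real.le_log_iff_exp_le (by positivity)]
    have h2 : Real.exp (1 / 4) ≤ Real.exp 1 := Real.exp_le_exp.2 (by norm_num)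
    have h3 := Real.exp_one_lt_d9
    have h4 : (16 : ℝ) ≤ 16 / a ^ 2 := by
      rw [le_div_iff₀ (by positivity)]; nlinarith
    linarith
  have : (2 : ℝ) ≤ m := by linarith
  exact_mod_cast this

/-! ### The two phases and the complete run. -/

section

variable {d : ℕ} [NeZero d] {A : Matrix (Fin d) (Fin d) ℝ} {ρ : Fin d → ℝ}
  {p : Fin d → Fin d → ℝ} {c₂ Δt ε : ℝ} {opt : LSO d} {κ m : ℕ}
  {sol : ℝ → ℝ → (Fin d → ℝ) → (ℕ → unitInterval) → Fin d → ℝ}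
  {cnt : ℝ → ℝ → (Fin d → ℝ) → (ℕ → unitInterval) → ENNReal}
  {tape : ℕ × ℕ → unitInterval} {s₀ : FlatState d} {X : ℕ → FlatState d} {C : ℕ → ENNReal}

theorem abs_head_le_one (h : EigenSystem A ρ p) {w : Fin d → ℝ} (hu : w ⬝ᵥ w = 1) :
    |w ⬝ᵥ p 0| ≤ 1 := by
  rw [← sq_le_one_iff_abs_le_one, ← hu, h.dot_self]
  exact Finset.single_le_sum (f := fun i => (w ⬝ᵥ p i) ^ 2) (fun i _ => sq_nonneg _)
    (Finset.mem_univ 0)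

theorem initial_tanLe (h : EigenSystem A ρ p) {w : Fin d → ℝ} (hu : w ⬝ᵥ w = 1)
    (hh : w ⬝ᵥ p 0 ≠ 0) : TanLe p (Finset.univ.erase 0) w (1 / |w ⬝ᵥ p 0|) := by
  unfold TanLe
  rw [one_div, inv_mul_cancel₀ (abs_ne_zero.2 hh), Real.sqrt_le_left zero_le_one, one_pow, ← hu, h.dot_self w]
  exact Finset.sum_le_sum_of_subset_of_nonneg (Finset.erase_subset _ _) fun _ _ _ => sq_nonneg _

/-- Phase I, provided its least squares problems are solved. -/
theorem phaseOne_spec (h : GapProblem A ρ p c₂ Δt)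
    (hspec : SolverSpec opt A ρ p (9 / 20 * Δt) sol cnt κ) {w₀ : Fin d → ℝ}
    (hu : w₀ ⬝ᵥ w₀ = 1) (hh : w₀ ⬝ᵥ p 0 ≠ 0)
    (hm : m = ⌈8 * Real.log (16 / (w₀ ⬝ᵥ p 0) ^ 2)⌉₊)
    (hX : X = flatRun ρ sol c₂ Δt m (w₀, 1 + Δt, 0) fun k j => tape (k, j))
    (hC : C = flatCost ρ sol cnt κ c₂ Δt m (w₀, 1 + Δt, 0) fun k j => tape (k, j))
    {S : ℕ} (hS : (3 / 4 : ℝ) ^ S ≤ Δt)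
    (hfin : ∀ k < (S + 1) * (m + 1), (X k).2.2 ≤ m →
      flatCount ρ cnt Δt m (X k) (fun j => tape (k, j)) ≠ ⊤) :
    ∃ st N, (phaseOne opt A (p 0) tape c₂ Δt w₀).val = st ∧ st.solved = N ∧
      N ≤ (S + 1) * (m + 1) ∧ X N = (st.w, st.lam, m + 1) ∧ st.w ⬝ᵥ st.w = 1 ∧
      st.w ⬝ᵥ p 0 ≠ 0 ∧ 9 / 20 * Δt ≤ st.lam - ρ 0 ∧ st.lam ≤ 2 ∧ WTanLe ρ p st.lam st.w 1 ∧
      st.lam - ρ 0 ≤ 3 / 2 * (ρ 0 - ρ 1) ∧ (∀ k < N, (X k).2.2 ≤ m) ∧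
      (phaseOne opt A (p 0) tape c₂ Δt w₀).cost ≤
        (3 * d + 2 + (S + 1) : ℕ) + ∑ k ∈ Finset.range N, C k := by
  have hΔ := h.est_pos
  have ha : 0 < |w₀ ⬝ᵥ p 0| := abs_pos.2 hh
  have ha1 := abs_head_le_one h.toEigenSystem hu
  have hm' : 8 * Real.log (16 / |w₀ ⬝ᵥ p 0| ^ 2) ≤ m := by
    rw [sq_abs, hm]; exact Nat.le_ceil _
  have key := fun {s : ℕ} => stages_spec h hspec ha ha1 (seven_eighths_pow_le ha hm')
    (two_le_of_log_le ha ha1 hm') hX hC hu hh (initial_tanLe h.toEigenSystem hu hh) hfin rfl (s := s)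
  set st₁ := shiftStage opt A tape c₂ Δt m ⟨w₀, 1 + Δt, 0, 0⟩ with hst₁
  have hnorm : (normalize w₀).val = w₀ := by simp [hu]
  have hone : phaseOne opt A (p 0) tape c₂ Δt w₀ =
      normalize w₀ >>= fun w => (num 1 + num Δt) >>= fun lam₀ =>
        shiftStage opt A tape c₂ Δt ⌈8 * Real.log (16 / (w ⬝ᵥ p 0) ^ 2)⌉₊ ⟨w, lam₀, 0, 0⟩ >>=
          fun st => loopUntil (fun st => st.gap ≤ Δt)
            (shiftStage opt A tape c₂ Δt ⌈8 * Real.log (16 / (w ⬝ᵥ p 0) ^ 2)⌉₊) st := rfl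
  -- If the estimate stayed above `Δt`, the stage with index `S` would start at distance at most `(3
  -- / 4) ^ S ≤ Δt`, while its estimate is at most `4 / 5` of that distance.
  have hex : ∃ n, n ≤ S ∧ (repeatN (shiftStage opt A tape c₂ Δt m) st₁.val n).val.gap ≤ Δt := by
    by_contra! hcon
    obtain ⟨⟨lam, hlam, -, he⟩, -⟩ := key le_rfl (fun t ht => hcon t ht.le)
    have := hcon S le_rfl
    have := he.gap_le
    have : 0 < lam - ρ 0 := by linarith [he.shift_le, he.shift_ge]
    linarith
  obtain ⟨n₀, hn₀, hn₀'⟩ := hex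
  have hex' : ∃ n, (repeatN (shiftStage opt A tape c₂ Δt m) st₁.val n).val.gap ≤ Δt := ⟨n₀, hn₀'⟩
  classical
  have hn : Nat.find hex' ≤ S := (Nat.find_min' hex' hn₀').trans hn₀
  obtain ⟨⟨lam, hlam, hlam1, he⟩, hsol, hcost, hle⟩ :=
    key hn (fun t ht => not_le.1 (Nat.find_min hex' ht))
  have hgap := Nat.find_spec hex'
  have hloop : loopUntil (fun st => st.gap ≤ Δt) (shiftStage opt A tape c₂ Δt m) st₁.val =
      ⟨(repeatN (shiftStage opt A tape c₂ Δt m) st₁.val (Nat.find hex')).val,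
        (repeatN (shiftStage opt A tape c₂ Δt m) st₁.val (Nat.find hex')).ops +
          (Nat.find hex' + 1 : ℕ)⟩ := by
    rw [loopUntil, dif_pos hex']
  have hval : (phaseOne opt A (p 0) tape c₂ Δt w₀).val =
      (repeatN (shiftStage opt A tape c₂ Δt m) st₁.val (Nat.find hex')).val := by
    rw [hone]
    simp only [val_bind, hnorm, val_add, val_num, ← hm, ← hst₁]
    rw [hloop]
  have hcst : (phaseOne opt A (p 0) tape c₂ Δt w₀).cost = (3 * d + 1 : ℕ) + (1 + (st₁.cost +
      ((repeatN (shiftStage opt A tape c₂ Δt m) st₁.val (Nat.find hex')).cost +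
        (Nat.find hex' + 1 : ℕ)))) := by
    rw [hone]
    simp only [cost_bind, hnorm, val_add, val_num, ← hm, ← hst₁]
    rw [hloop]
    simp only [cost, ops_normalize, ops_add, ops_num, ENat.toENNReal_add]
    simp
  obtain ⟨hG, hlam2⟩ := he.weighted hgap
  have hrun := he.run
  rw [if_pos hgap, hsol] at hrun
  have hlast : lam - ρ 0 > 0 := by linarith [he.shift_le, he.shift_ge]
  refine ⟨_, (Nat.find hex' + 1) * (m + 1), hval, hsol, Nat.mul_le_mul_right _ (by omega), hrun,
    he.unit, he.head, he.shift_ge, ?_, hG, hlam2, hle, ?_⟩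
  · linarith [he.shift_le, h.est_le_one]
  · rw [hcst]
    have e : ((3 * d + 1 : ℕ) : ENNReal) + (1 + (st₁.cost +
      ((repeatN (shiftStage opt A tape c₂ Δt m) st₁.val (Nat.find hex')).cost +
        (Nat.find hex' + 1 : ℕ)))) = (3 * d + 2 + (Nat.find hex' + 1) : ℕ) + (st₁.cost +
      (repeatN (shiftStage opt A tape c₂ Δt m) st₁.val (Nat.find hex')).cost) := by
      push_cast; ring
    rw [e]
    refine add_le_add ?_ hcost
    exact_mod_cast (by omega : 3 * d + 2 + (Nat.find hex' + 1) ≤ 3 * d + 2 + (S + 1))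

/-- The power iterations of Phase II. -/
theorem phaseTwo_loop (h : GapProblem A ρ p c₂ Δt)
    (hspec : SolverSpec opt A ρ p (9 / 20 * Δt) sol cnt κ)
    (hX : X = flatRun ρ sol c₂ Δt m s₀ fun k j => tape (k, j))
    (hC : C = flatCost ρ sol cnt κ c₂ Δt m s₀ fun k j => tape (k, j)) {st : SIState d} {G : ℝ}
    {n : ℕ} (hrun : X st.solved = (st.w, st.lam, m + 1)) (hu : st.w ⬝ᵥ st.w = 1)
    (hh : st.w ⬝ᵥ p 0 ≠ 0) (hl : 9 / 20 * Δt ≤ st.lam - ρ 0) (hl2 : st.lam ≤ 2)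
    (hG0 : 0 ≤ G) (hG1 : G ≤ 1) (hG : WTanLe ρ p st.lam st.w G)
    (hl1 : st.lam - ρ 0 ≤ 3 / 2 * (ρ 0 - ρ 1))
    (hfin : ∀ i < n, (X (st.solved + i)).2.2 = m + 1 + i →
      flatCount ρ cnt Δt m (X (st.solved + i)) (fun j => tape (st.solved + i, j)) ≠ ⊤)
    {j : ℕ} (hj : j ≤ n) :
    ∃ w gap, (repeatN (powerStep opt A tape 100) st j).val =
        ⟨w, st.lam, gap, st.solved + j⟩ ∧
      X (st.solved + j) = (w, st.lam, m + 1 + j) ∧ w ⬝ᵥ w = 1 ∧ w ⬝ᵥ p 0 ≠ 0 ∧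
      WTanLe ρ p st.lam w ((7 / 9) ^ j * G) ∧
      (repeatN (powerStep opt A tape 100) st j).cost ≤
        ∑ i ∈ Finset.range j, C (st.solved + i) := by
  have hΔ := h.est_pos
  induction j with
  | zero =>
    refine ⟨st.w, st.gap, rfl, hrun, hu, hh, by simpa using hG, ?_⟩
    simp [repeatN, cost]
  | succ j ih =>
    obtain ⟨w, gap, hval, hrun', hu', hh', hG', hcost⟩ := ih (by omega)
    have hadm : Admissible ρ (9 / 20 * Δt) st.lam w := ⟨hu', hl, hl2⟩
    have hf := hfin j (by omega) (by rw [hrun'])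
    subst hX hC
    obtain ⟨x, hx, hv, hr, hc⟩ := powerStep_flat (A := A) (ρ := ρ) (p := p) hspec (R := 100)
      (by norm_num) (st := ⟨w, st.lam, gap, st.solved + j⟩) (c := m + 1 + j) hrun' (by omega)
      (by rw [flatRatio, if_neg (by omega), if_neg (by omega)]) hadm hf
    have hp1 : (7 / 9 : ℝ) ^ j ≤ 1 := pow_le_one₀ (by norm_num) (by norm_num)
    obtain ⟨h0, hg⟩ := weighted_contraction h (by linarith) hl1 hu' hh' hG' (by positivity)
      (by nlinarith) hx
    obtain ⟨hs, hu2, hh2⟩ := unit_normalize h0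
    refine ⟨_, gap, ?_, hr, hu2, hh2, ?_, ?_⟩
    · rw [repeatN_succ, val_bind, hval, hv]; rfl
    · rw [pow_succ', mul_assoc]; exact hg.smul _
    · rw [repeatN_succ, cost_bind, hval, Finset.sum_range_succ]
      exact add_le_add hcost hc

theorem pow_contraction_le {G : ℝ} (hG0 : 0 ≤ G) (hε : 0 < ε) {n : ℕ}
    (hn : 1 / 2 * Real.logb (9 / 7) (G ^ 2 / ε) ≤ n) : ((7 / 9) ^ n * G) ^ 2 ≤ ε := by
  -- For `G = 0` the logarithm has its default value and `n` carries no information, but nothing has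
  -- to be shown.
  rcases hG0.eq_or_lt with rfl | hG
  · simp [hε.le]
  have h1 : Real.logb (9 / 7) (G ^ 2 / ε) ≤ (2 * n : ℕ) := by push_cast; linarith
  rw [Real.logb_le_iff_le_rpow (by norm_num) (by positivity), Real.rpow_natCast,
    div_le_iff₀ hε] at h1
  have h2 : ((7 / 9 : ℝ) ^ n) ^ 2 * (9 / 7) ^ (2 * n) = 1 := by
    rw [← pow_mul, mul_comm n 2, ← mul_pow]; norm_num
  calc ((7 / 9) ^ n * G) ^ 2 = ((7 / 9 : ℝ) ^ n) ^ 2 * G ^ 2 := by ring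
    _ ≤ ((7 / 9 : ℝ) ^ n) ^ 2 * ((9 / 7) ^ (2 * n) * ε) := by gcongr
    _ = ε := by rw [← mul_assoc, h2, one_mul]

/-- Phase II, provided its least squares problems are solved. -/
theorem phaseTwo_spec (h : GapProblem A ρ p c₂ Δt)
    (hspec : SolverSpec opt A ρ p (9 / 20 * Δt) sol cnt κ)
    (hX : X = flatRun ρ sol c₂ Δt m s₀ fun k j => tape (k, j))
    (hC : C = flatCost ρ sol cnt κ c₂ Δt m s₀ fun k j => tape (k, j)) {st : SIState d}
    (hrun : X st.solved = (st.w, st.lam, m + 1)) (hu : st.w ⬝ᵥ st.w = 1)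
    (hh : st.w ⬝ᵥ p 0 ≠ 0) (hl : 9 / 20 * Δt ≤ st.lam - ρ 0) (hl2 : st.lam ≤ 2)
    (hG : WTanLe ρ p st.lam st.w 1)
    (hl1 : st.lam - ρ 0 ≤ 3 / 2 * (ρ 0 - ρ 1)) (hε : 0 < ε)
    (hfin : ∀ i < ⌈1 / 2 * Real.logb (9 / 7) (1 / ε)⌉₊, (X (st.solved + i)).2.2 = m + 1 + i →
      flatCount ρ cnt Δt m (X (st.solved + i)) (fun j => tape (st.solved + i, j)) ≠ ⊤) :
    1 - ε ≤ ((phaseTwo opt A ρ p tape ε st).val ⬝ᵥ p 0) ^ 2 ∧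
    ∃ n ≤ ⌈1 / 2 * Real.logb (9 / 7) (1 / ε)⌉₊,
      (∀ i < n, (X (st.solved + i)).2.2 = m + 1 + i) ∧
      (phaseTwo opt A ρ p tape ε st).cost ≤ ∑ i ∈ Finset.range n, C (st.solved + i) := by
  have hx : 0 < st.lam - ρ 0 := by linarith [h.est_pos]
  set G := initialG ρ p st.lam st.w with hGdef
  have hG0 : 0 ≤ G := initialG_nonneg
  have hG1 : G ≤ 1 := initialG_le hx hh hG
  have hGw : WTanLe ρ p st.lam st.w G := initialG_wtanLe hx hh
  set n := ⌈1 / 2 * Real.logb (9 / 7) (G ^ 2 / ε)⌉₊ with hn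
  have hnle : n ≤ ⌈1 / 2 * Real.logb (9 / 7) (1 / ε)⌉₊ := by
    rcases hG0.eq_or_lt with h0 | h0
    · rw [hn, ← h0]; simp
    · refine Nat.ceil_le_ceil ?_
      refine mul_le_mul_of_nonneg_left ?_ (by norm_num)
      refine Real.logb_le_logb_of_le (by norm_num) (by positivity) ?_
      gcongr
      exact pow_le_one₀ hG0 hG1
  have htwo : phaseTwo opt A ρ p tape ε st =
      repeatN (powerStep opt A tape (100 * max G 1)) st n >>= fun st' => pure st'.w := rfl
  -- Phase I ends with `G₀ ≤ 1`, so the accuracy ratio is the constant `100`, in agreement with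
  -- `flatRatio`.
  rw [max_eq_right hG1, mul_one] at htwo
  have key := fun {j : ℕ} (hj : j ≤ n) =>
    phaseTwo_loop h hspec hX hC hrun hu hh hl hl2 hG0 hG1 hGw hl1
      (fun i hi => hfin i (by omega)) hj
  obtain ⟨w, gap, hval, -, hu', -, hGn, hcost⟩ := key le_rfl
  refine ⟨?_, n, hnle, ?_, ?_⟩
  · rw [htwo, val_bind, hval, val_pure]
    have h1 := head_sq_ge h hx hu' (by positivity) hGn
    have h2 := pow_contraction_le hG0 hε (n := n) (Nat.le_ceil _)
    linarith
  · intro i hi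
    obtain ⟨w, gap, -, hr, -⟩ := key hi.le
    rw [hr]
  · rw [htwo, cost_bind]
    refine le_trans (le_of_eq ?_) hcost
    simp [cost]

open Classical in
/-- The number of solver iterations in Phase I, summed over the first `N` problems. -/
noncomputable def countOne {d : ℕ} [NeZero d] (ρ : Fin d → ℝ)
    (cnt : ℝ → ℝ → (Fin d → ℝ) → (ℕ → unitInterval) → ENNReal) (Δt : ℝ) (m : ℕ)
    (X : ℕ → FlatState d) (u : ℕ → ℕ → unitInterval) (N : ℕ) : ENNReal :=
  ∑ k ∈ Finset.range N, if (X k).2.2 ≤ m then flatCount ρ cnt Δt m (X k) (u k) else 0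

open Classical in
/-- The number of solver iterations in the first `M` power iterations of Phase II, as far as they
belong to the first `N` problems. -/
noncomputable def countTwo {d : ℕ} [NeZero d] (ρ : Fin d → ℝ)
    (cnt : ℝ → ℝ → (Fin d → ℝ) → (ℕ → unitInterval) → ENNReal) (Δt : ℝ) (m M : ℕ)
    (X : ℕ → FlatState d) (u : ℕ → ℕ → unitInterval) (N : ℕ) : ENNReal :=
  ∑ k ∈ Finset.range N, if m < (X k).2.2 ∧ (X k).2.2 ≤ m + M then
    flatCount ρ cnt Δt m (X k) (u k) else 0

/-- A run with few solver iterations succeeds. -/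
theorem run_spec (h : GapProblem A ρ p c₂ Δt)
    (hspec : SolverSpec opt A ρ p (9 / 20 * Δt) sol cnt κ) {w₀ : Fin d → ℝ}
    (hu : w₀ ⬝ᵥ w₀ = 1) (hh : w₀ ⬝ᵥ p 0 ≠ 0)
    (hm : m = ⌈8 * Real.log (16 / (w₀ ⬝ᵥ p 0) ^ 2)⌉₊)
    (hX : X = flatRun ρ sol c₂ Δt m (w₀, 1 + Δt, 0) fun k j => tape (k, j))
    {S M : ℕ} (hS : (3 / 4 : ℝ) ^ S ≤ Δt) (hε : 0 < ε)
    (hM : M = ⌈1 / 2 * Real.logb (9 / 7) (1 / ε)⌉₊)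
    (h1 : countOne ρ cnt Δt m X (fun k j => tape (k, j)) ((S + 1) * (m + 1)) ≠ ⊤)
    (h2 : countTwo ρ cnt Δt m M X (fun k j => tape (k, j)) ((S + 1) * (m + 1) + M) ≠ ⊤) :
    1 - ε ≤ ((shiftInvert opt A ρ p tape c₂ Δt ε w₀).val ⬝ᵥ p 0) ^ 2 ∧
    (phaseOne opt A (p 0) tape c₂ Δt w₀).cost ≤
      (κ + 25 : ℕ) * (((S + 1) * (m + 1) : ℕ) * (d : ENNReal) ^ 2 +
        d * countOne ρ cnt Δt m X (fun k j => tape (k, j)) ((S + 1) * (m + 1))) ∧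
    (phaseTwo opt A ρ p tape ε (phaseOne opt A (p 0) tape c₂ Δt w₀).val).cost ≤
      (κ + 25 : ℕ) * ((M : ENNReal) * (d : ENNReal) ^ 2 +
        d * countTwo ρ cnt Δt m M X (fun k j => tape (k, j)) ((S + 1) * (m + 1) + M)) := by
  obtain ⟨C, hC⟩ : ∃ C, C = flatCost ρ sol cnt κ c₂ Δt m (w₀, 1 + Δt, 0) fun k j => tape (k, j) :=
    ⟨_, rfl⟩
  have hCk : ∀ k, C k = (κ + 19 : ℕ) * ((d : ENNReal) ^ 2 +
      d * flatCount ρ cnt Δt m (X k) (fun j => tape (k, j))) := by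
    intro k; rw [hC, flatCost, hX]
  unfold countOne at *
  unfold countTwo at *
  have hfin1 : ∀ k < (S + 1) * (m + 1), (X k).2.2 ≤ m →
      flatCount ρ cnt Δt m (X k) (fun j => tape (k, j)) ≠ ⊤ := by
    intro k hk hc
    have := (ENNReal.sum_ne_top.1 h1) k (Finset.mem_range.2 hk)
    rwa [if_pos hc] at this
  obtain ⟨st, N, hone, hsol, hN, hrun, hu', hh', hl, hl2, hG, hl1, hle, hcost⟩ :=
    phaseOne_spec h hspec hu hh hm hX hC hS hfin1
  have hfin2 : ∀ i < M, (X (st.solved + i)).2.2 = m + 1 + i →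
      flatCount ρ cnt Δt m (X (st.solved + i)) (fun j => tape (st.solved + i, j)) ≠ ⊤ := by
    intro i hi hc
    have := (ENNReal.sum_ne_top.1 h2) (st.solved + i) (Finset.mem_range.2 (by omega))
    rwa [if_pos ⟨by omega, by omega⟩] at this
  rw [hM] at hfin2
  obtain ⟨hval, n, hn, hcn, hcost2⟩ := phaseTwo_spec (A := A) (ε := ε) h hspec hX hC
    (by rw [hsol]; exact hrun) hu' hh' hl hl2 hG hl1 hε hfin2
  rw [← hM] at hn
  have hd : 1 ≤ d := Nat.pos_of_ne_zero (NeZero.ne d)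
  refine ⟨?_, ?_, ?_⟩
  · have : (shiftInvert opt A ρ p tape c₂ Δt ε w₀).val =
        (phaseTwo opt A ρ p tape ε (phaseOne opt A (p 0) tape c₂ Δt w₀).val).val := rfl
    rw [this, hone]
    exact hval
  · have e1 : ∑ k ∈ Finset.range N, C k ≤ (κ + 19 : ℕ) * (((S + 1) * (m + 1) : ℕ) *
        (d : ENNReal) ^ 2 + d * ∑ k ∈ Finset.range ((S + 1) * (m + 1)),
          if (X k).2.2 ≤ m then flatCount ρ cnt Δt m (X k) (fun j => tape (k, j)) else 0) := by
      simp_rw [hCk, ← Finset.mul_sum, Finset.sum_add_distrib, ← Finset.mul_sum]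
      gcongr
      · simp only [Finset.sum_const, Finset.card_range, nsmul_eq_mul]
        gcongr
      · calc _ ≤ ∑ k ∈ Finset.range N, if (X k).2.2 ≤ m then
              flatCount ρ cnt Δt m (X k) (fun j => tape (k, j)) else 0 :=
            Finset.sum_le_sum fun k hk => by rw [if_pos (hle k (Finset.mem_range.1 hk))]
          _ ≤ _ := Finset.sum_le_sum_of_subset (Finset.range_mono hN)
    have e2 : ((3 * d + 2 + (S + 1) : ℕ) : ENNReal) ≤
        (6 : ℕ) * (((S + 1) * (m + 1) : ℕ) * (d : ENNReal) ^ 2) := by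
      have hd2 : d ≤ d ^ 2 := by nlinarith
      have hP : S + 1 ≤ (S + 1) * (m + 1) := Nat.le_mul_of_pos_right _ (by omega)
      have hQ : d ^ 2 ≤ (S + 1) * (m + 1) * d ^ 2 := Nat.le_mul_of_pos_left _ (by positivity)
      have hQ2 : (S + 1) * (m + 1) ≤ (S + 1) * (m + 1) * d ^ 2 :=
        Nat.le_mul_of_pos_right _ (by positivity)
      have : 3 * d + 2 + (S + 1) ≤ 6 * ((S + 1) * (m + 1) * d ^ 2) := by omega
      exact_mod_cast this
    generalize (∑ k ∈ Finset.range ((S + 1) * (m + 1)),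
          if (X k).2.2 ≤ m then flatCount ρ cnt Δt m (X k) (fun j => tape (k, j)) else 0) = T at *
    refine hcost.trans ((add_le_add e2 e1).trans ?_)
    generalize (((S + 1) * (m + 1) : ℕ) : ENNReal) * (d : ENNReal) ^ 2 = Y
    calc ((6 : ℕ) : ENNReal) * Y + ((κ + 19 : ℕ) : ENNReal) * (Y + d * T) ≤
          ((6 : ℕ) : ENNReal) * (Y + d * T) + ((κ + 19 : ℕ) : ENNReal) * (Y + d * T) := by
          gcongr; exact le_self_add
      _ = _ := by push_cast; ring
  · rw [hone]
    refine hcost2.trans ?_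
    simp_rw [hCk, ← Finset.mul_sum, Finset.sum_add_distrib, ← Finset.mul_sum]
    gcongr
    · norm_num
    · simp only [Finset.sum_const, Finset.card_range, nsmul_eq_mul]
      gcongr
    -- Phase II begins at a random position, so its states are recognized by their counters inside a
    -- range of fixed length.
    · calc _ ≤ ∑ i ∈ Finset.range n, if m < (X (st.solved + i)).2.2 ∧
              (X (st.solved + i)).2.2 ≤ m + M then flatCount ρ cnt Δt m (X (st.solved + i))
                (fun j => tape (st.solved + i, j)) else 0 :=
            Finset.sum_le_sum fun i hi => by
              have := Finset.mem_range.1 hi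
              have := hcn i this
              rw [if_pos ⟨by omega, by omega⟩]
        _ ≤ ∑ k ∈ Finset.range (st.solved + n), if m < (X k).2.2 ∧ (X k).2.2 ≤ m + M then
              flatCount ρ cnt Δt m (X k) (fun j => tape (k, j)) else 0 := by
          rw [Finset.sum_range_add]; exact le_add_self
        _ ≤ _ := Finset.sum_le_sum_of_subset (Finset.range_mono (by omega))

end

/-! ### Coordinate updates -/

namespace EigenSystem

variable {d : ℕ} {A : Matrix (Fin d) (Fin d) ℝ} {ρ : Fin d → ℝ} {p : Fin d → Fin d → ℝ}

theorem grad_eq (h : EigenSystem A ρ p) {lam : ℝ} (hlam : ∀ i, 0 < lam - ρ i) (y x : Fin d → ℝ) :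
    lam • x - A.mulVec x - y = lam • (x - shiftInv ρ p lam y) - A.mulVec (x - shiftInv ρ p lam y) := by
  rw [smul_sub, Matrix.mulVec_sub]
  nth_rewrite 1 [← h.shift_mulVec_shiftInv hlam y]
  abel

theorem energy_eq_grad (h : EigenSystem A ρ p) {lam : ℝ} (hlam : ∀ i, 0 < lam - ρ i)
    (y x : Fin d → ℝ) :
    (lam • x - A.mulVec x - y) ⬝ᵥ (x - shiftInv ρ p lam y) = 2 * energy ρ p lam y x := by
  rw [h.grad_eq hlam, h.energy_eq_quad, dotProduct_comm]; ring

/-- The objective is quadratic, so its second order Taylor expansion is exact. -/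
theorem energy_sub (h : EigenSystem A ρ p) {lam : ℝ} (hlam : ∀ i, 0 < lam - ρ i)
    (y x v : Fin d → ℝ) :
    energy ρ p lam y (x - v) = energy ρ p lam y x - (lam • x - A.mulVec x - y) ⬝ᵥ v +
      1 / 2 * (v ⬝ᵥ (lam • v - A.mulVec v)) := by
  have e : ∀ i, (lam • x - A.mulVec x - y) ⬝ᵥ p i =
      (lam - ρ i) * (x ⬝ᵥ p i - y ⬝ᵥ p i / (lam - ρ i)) := by
    intro i
    rw [sub_dotProduct, h.shift_mulVec_dot, mul_sub, mul_div_cancel₀ _ (hlam i).ne']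
  rw [h.shift_quad, h.dot_eq (lam • x - A.mulVec x - y) v, energy, energy, Finset.mul_sum,
    Finset.mul_sum, Finset.mul_sum, ← Finset.sum_sub_distrib, ← Finset.sum_add_distrib]
  refine Finset.sum_congr rfl fun i _ => ?_
  rw [e, sub_dotProduct]
  ring

/-- Decrease of the error in an exact coordinate minimization. -/
theorem energy_update (h : EigenSystem A ρ p) {lam : ℝ} (hlam : ∀ i, 0 < lam - ρ i)
    (y x : Fin d → ℝ) (j : Fin d) (hL : 0 < lam - A j j) :
    energy ρ p lam y (Function.update x j (x j - (lam • x - A.mulVec x - y) j / (lam - A j j))) =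
      energy ρ p lam y x - (lam • x - A.mulVec x - y) j ^ 2 / (2 * (lam - A j j)) := by
  set g := lam • x - A.mulVec x - y with hg
  have e : Function.update x j (x j - g j / (lam - A j j)) =
      x - (g j / (lam - A j j)) • Pi.single j 1 := by
    ext i
    by_cases hi : i = j
    · subst hi; simp
    · simp [hi]
  rw [e, h.energy_sub hlam, ← hg]
  have h1 : g ⬝ᵥ ((g j / (lam - A j j)) • Pi.single j 1) = g j / (lam - A j j) * g j := by
    rw [dotProduct_smul, smul_eq_mul, dotProduct_single_one]
  have h2 : ((g j / (lam - A j j)) • Pi.single j (1 : ℝ)) ⬝ᵥ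
      (lam • ((g j / (lam - A j j)) • Pi.single j (1 : ℝ)) -
        A.mulVec ((g j / (lam - A j j)) • Pi.single j (1 : ℝ))) =
      (g j / (lam - A j j)) ^ 2 * (lam - A j j) := by
    rw [Matrix.mulVec_smul, smul_comm lam, ← smul_sub, smul_dotProduct, dotProduct_smul,
      single_one_dotProduct]
    simp
    ring
  rw [h1, h2]
  field_simp
  ring

/-- The Polyak–Łojasiewicz inequality: in eigencoordinates it is `μ * (λ - ρ i) ≤ (λ - ρ i) ^ 2`. -/
theorem energy_le_grad_sq (h : EigenSystem A ρ p) {lam μ : ℝ} (hμ0 : 0 < μ)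
    (hμ : ∀ i, μ ≤ lam - ρ i) (y x : Fin d → ℝ) :
    2 * μ * energy ρ p lam y x ≤
      (lam • x - A.mulVec x - y) ⬝ᵥ (lam • x - A.mulVec x - y) := by
  have hlam : ∀ i, 0 < lam - ρ i := fun i => hμ0.trans_le (hμ i)
  rw [h.grad_eq hlam, h.dot_self, energy]
  simp_rw [h.shift_mulVec_dot, sub_dotProduct, h.shiftInv_dot]
  rw [show ∀ s : ℝ, 2 * μ * (1 / 2 * s) = μ * s from fun s => by ring, Finset.mul_sum]
  refine Finset.sum_le_sum fun i _ => ?_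
  rw [mul_pow, sq (lam - ρ i), mul_assoc]
  exact mul_le_mul_of_nonneg_right (hμ i) (mul_nonneg (hlam i).le (sq_nonneg _))

end EigenSystem

/-! ### Termination of the solvers -/

/-- The states of an optimizer. -/
def LSO.states {d : ℕ} (opt : LSO d) (lam : ℝ) (y x₀ : Fin d → ℝ) (u : ℕ → unitInterval) :
    ℕ → opt.State
  | 0 => (opt.start lam y x₀).val
  | n + 1 => (opt.step lam y (u n) (opt.states lam y x₀ u n)).val

/-- The loop carries only a tape position besides the optimizer's state, and every step costs the
same. Result and cost are therefore determined by the first index that passes the exit test. -/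
theorem LSO.solve_spec {d : ℕ} (opt : LSO d) (A : Matrix (Fin d) (Fin d) ℝ) (lam : ℝ)
    (y x₀ : Fin d → ℝ) (R : ℝ) (u : ℕ → unitInterval) {a b : ℕ}
    (hstart : (opt.start lam y x₀).ops = a) (hstep : ∀ t s, (opt.step lam y t s).ops = b)
    {n : ℕ} (hn : lsqError A lam y (opt.iterate (opt.states lam y x₀ u n)) ≤
      lsqError A lam y x₀ / R)
    (hmin : ∀ k < n, ¬ lsqError A lam y (opt.iterate (opt.states lam y x₀ u k)) ≤
      lsqError A lam y x₀ / R) :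
    (opt.solve A lam y x₀ R u).val = opt.iterate (opt.states lam y x₀ u n) ∧
      (opt.solve A lam y x₀ R u).ops = (a + (n * b + (n + 1)) : ℕ) := by
  set body : ℕ × opt.State → Counted (ℕ × opt.State) := fun q => do
      let s' ← opt.step lam y (u q.1) q.2
      pure (q.1 + 1, s') with hbody
  have hrep : ∀ k, (repeatN body (0, (opt.start lam y x₀).val) k).val =
      (k, opt.states lam y x₀ u k) ∧
      (repeatN body (0, (opt.start lam y x₀).val) k).ops = (k * b : ℕ) := by
    intro k
    induction k with
    | zero => exact ⟨rfl, by simp [repeatN]⟩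
    | succ k ih =>
      rw [repeatN_succ, val_bind, ops_bind, ih.1, ih.2]
      refine ⟨rfl, ?_⟩
      simp only [hbody, ops_bind, ops_pure, hstep, add_zero]
      push_cast; ring
  have hex : ∃ k, (fun q : ℕ × opt.State =>
      lsqError A lam y (opt.iterate q.2) ≤ lsqError A lam y x₀ / R)
        (repeatN body (0, (opt.start lam y x₀).val) k).val := ⟨n, by
    simp only [(hrep n).1]; exact hn⟩
  have hloop : loopUntil (fun q : ℕ × opt.State =>
      lsqError A lam y (opt.iterate q.2) ≤ lsqError A lam y x₀ / R) body
        (0, (opt.start lam y x₀).val) = ⟨(n, opt.states lam y x₀ u n), (n * b : ℕ) + (n + 1 : ℕ)⟩ := by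
    classical
    have hfind : Nat.find hex = n := by
      rw [Nat.find_eq_iff]
      refine ⟨by simp only [(hrep n).1]; exact hn, fun k hk => ?_⟩
      simp only [(hrep k).1]
      exact hmin k hk
    rw [loopUntil, dif_pos hex]
    rw [show Nat.find hex = n from hfind, (hrep n).1, (hrep n).2]
  have hsolve : opt.solve A lam y x₀ R u = opt.start lam y x₀ >>= fun s₀ =>
      loopUntil (fun q : ℕ × opt.State =>
        lsqError A lam y (opt.iterate q.2) ≤ lsqError A lam y x₀ / R) body (0, s₀) >>=
          fun s => pure (opt.iterate s.2) := rfl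
  rw [hsolve]
  simp only [val_bind, ops_bind, hloop, hstart, val_pure, ops_pure]
  refine ⟨trivial, ?_⟩
  push_cast
  ring

/-! ### Greedy coordinate descent -/

section gsl

variable {d : ℕ} {A : Matrix (Fin d) (Fin d) ℝ} {ρ : Fin d → ℝ} {p : Fin d → Fin d → ℝ}
  {pick : (Fin d → ℝ) → Fin d}

theorem ops_gsl_start (lam : ℝ) (y x₀ : Fin d → ℝ) :
    ((gsl A pick).start lam y x₀).ops = (2 * d ^ 2 + 5 * d : ℕ) := by
  simp [gsl]; ring

theorem ops_gsl_step (lam : ℝ) (y : Fin d → ℝ) (t : unitInterval) (s : GSLState d) :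
    ((gsl A pick).step lam y t s).ops = (5 * d + 5 : ℕ) := by
  simp [gsl]; ring

/-- The auxiliary quantities stored by greedy coordinate descent are correct. -/
structure GSLInv (A : Matrix (Fin d) (Fin d) ℝ) (lam : ℝ) (y : Fin d → ℝ) (s : GSLState d) :
    Prop where
  g : s.g = lam • s.x - A.mulVec s.x - y
  L : s.L = fun i => lam - A i i
  sqrtL : s.sqrtL = fun i => Real.sqrt (lam - A i i)

theorem gslInv_start (lam : ℝ) (y x₀ : Fin d → ℝ) :
    GSLInv A lam y ((gsl A pick).start lam y x₀).val ∧
      (gsl A pick).iterate ((gsl A pick).start lam y x₀).val = x₀ := by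
  refine ⟨⟨?_, ?_, ?_⟩, ?_⟩ <;> simp [gsl]
  rfl

/-- Moving `x` by `δ` along one axis changes the gradient by `δ` times a column of `λ I - A`. The
update adds `-δ` times the column of `A` and then `λ δ` in the one entry, which keeps a step at cost
`O(d)`. -/
theorem gslInv_step {lam : ℝ} {y : Fin d → ℝ}
    (t : unitInterval) {s : GSLState d} (hs : GSLInv A lam y s) :
    ∃ j, j = pick (fun i => |s.g i| / Real.sqrt (lam - A i i)) ∧
    GSLInv A lam y ((gsl A pick).step lam y t s).val ∧
      (gsl A pick).iterate ((gsl A pick).step lam y t s).val =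
        Function.update s.x j (s.x j - s.g j / (lam - A j j)) := by
  obtain ⟨hg, hL, hq⟩ := hs
  refine ⟨_, rfl, ⟨?_, ?_, ?_⟩, ?_⟩
  · simp only [gsl, val_bind, val_vec, val_div, val_absC, val_num, val_sub, val_add, val_mul,
      val_pure, hL, hq]
    set j := pick fun i => |s.g i| / Real.sqrt (lam - A i i)
    set δ := 0 - s.g j / (lam - A j j)
    have e : Function.update s.x j (s.x j + δ) = s.x + δ • Pi.single j 1 := by
      ext i
      by_cases hi : i = j
      · subst hi; simp
      · simp [hi]
    rw [e, Matrix.mulVec_add, Matrix.mulVec_smul, Matrix.mulVec_single_one]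
    have hg' : ∀ i, s.g i = lam * s.x i - A.mulVec s.x i - y i := fun i => by rw [hg]; rfl
    ext i
    by_cases hi : i = j
    · rw [hi]
      simp [hg']
      ring
    · simp [hi, hg']
      ring
  · simpa [gsl] using hL
  · simpa [gsl] using hq
  · simp [gsl, hL, hq, sub_eq_add_neg]

/-- One step of greedy coordinate descent contracts the error. -/
theorem gsl_contraction (h : EigenSystem A ρ p) (hpick : IsArgmax pick) {lam μ : ℝ} (hμ0 : 0 < μ)
    (hμ : ∀ i, μ ≤ lam - ρ i) {y : Fin d → ℝ} (t : unitInterval) {s : GSLState d}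
    (hs : GSLInv A lam y s) :
    energy ρ p lam y ((gsl A pick).iterate ((gsl A pick).step lam y t s).val) ≤
      (1 - μ / ∑ i, (lam - ρ i)) * energy ρ p lam y s.x := by
  have hlam : ∀ i, 0 < lam - ρ i := fun i => hμ0.trans_le (hμ i)
  have hL : ∀ i, 0 < lam - A i i := fun i => hμ0.trans_le (h.le_diag_shift hμ i)
  obtain ⟨j, hj, -, hit⟩ := gslInv_step (pick := pick) t hs
  have hg := hs.g
  have hS : 0 < ∑ i, (lam - ρ i) := Finset.sum_pos (fun i _ => hlam i) ⟨j, Finset.mem_univ j⟩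
  rw [hit, hg, h.energy_update hlam y s.x j (hL j), ← hg]
  -- Squaring the greedy rule. Summed over `i` it bounds the squared gradient norm by the trace `∑
  -- (λ - ρ i)` times twice the decrease of the energy.
  have h1 : ∀ i, s.g i ^ 2 ≤ (lam - A i i) * (s.g j ^ 2 / (lam - A j j)) := by
    intro i
    have h2 := hpick (fun i => |s.g i| / Real.sqrt (lam - A i i)) i
    rw [← hj] at h2
    have h3 := pow_le_pow_left₀ (by positivity) h2 2
    rw [div_pow, div_pow, sq_abs, sq_abs, Real.sq_sqrt (hL i).le, Real.sq_sqrt (hL j).le,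
      div_le_iff₀ (hL i)] at h3
    linarith
  have h4 := h.energy_le_grad_sq hμ0 hμ y s.x
  rw [← hg] at h4
  have h5 : s.g ⬝ᵥ s.g ≤ (∑ i, (lam - ρ i)) * (s.g j ^ 2 / (lam - A j j)) := by
    rw [← h.sum_shift_diag, Finset.sum_mul, dotProduct]
    exact Finset.sum_le_sum fun i _ => by rw [← sq]; exact h1 i
  have h6 : μ / (∑ i, (lam - ρ i)) * energy ρ p lam y s.x ≤ s.g j ^ 2 / (2 * (lam - A j j)) := by
    rw [div_mul_eq_mul_div, div_le_iff₀ hS]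
    have : s.g j ^ 2 / (2 * (lam - A j j)) * ∑ i, (lam - ρ i) =
        1 / 2 * ((∑ i, (lam - ρ i)) * (s.g j ^ 2 / (lam - A j j))) := by
      have := (hL j).ne'
      field_simp
    linarith
  linarith

theorem gsl_states (h : EigenSystem A ρ p) (hpick : IsArgmax pick) {lam μ : ℝ} (hμ0 : 0 < μ)
    (hμ : ∀ i, μ ≤ lam - ρ i) (hμS : μ ≤ ∑ i, (lam - ρ i)) (y x₀ : Fin d → ℝ)
    (u : ℕ → unitInterval) (n : ℕ) :
    GSLInv A lam y ((gsl A pick).states lam y x₀ u n) ∧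
    energy ρ p lam y ((gsl A pick).iterate ((gsl A pick).states lam y x₀ u n)) ≤
      (1 - μ / ∑ i, (lam - ρ i)) ^ n * energy ρ p lam y x₀ := by
  have hlam : ∀ i, 0 < lam - ρ i := fun i => hμ0.trans_le (hμ i)
  induction n with
  | zero =>
    have := gslInv_start (A := A) (pick := pick) lam y x₀
    exact ⟨this.1, by rw [LSO.states, this.2, pow_zero, one_mul]⟩
  | succ n ih =>
    obtain ⟨j, -, h1, -⟩ := gslInv_step (pick := pick) (u n) ih.1
    refine ⟨h1, (gsl_contraction h hpick hμ0 hμ (u n) ih.1).trans ?_⟩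
    rw [pow_succ', mul_assoc]
    refine mul_le_mul_of_nonneg_left ih.2 ?_
    rw [sub_nonneg]
    exact div_le_one_of_le₀ hμS (hμ0.le.trans hμS)

theorem one_sub_pow_le_inv {θ R : ℝ} (hθ : 0 < θ) (hθ1 : θ ≤ 1) (hR : 0 < R) {n : ℕ}
    (hn : Real.log R / θ ≤ n) : (1 - θ) ^ n ≤ 1 / R := by
  have h1 : (1 - θ) ^ n ≤ Real.exp (-θ) ^ n :=
    pow_le_pow_left₀ (by linarith) (Real.one_sub_le_exp_neg θ) n
  rw [← Real.exp_nat_mul] at h1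
  refine h1.trans ?_
  rw [one_div, ← Real.exp_log (inv_pos.2 hR), Real.exp_le_exp, Real.log_inv]
  rw [div_le_iff₀ hθ] at hn
  linarith

open Classical in
/-- Greedy coordinate descent solves the least squares problems within
`⌈∑ i, (λ - ρ i) / (λ - ρ 0) * log R⌉` steps. -/
theorem gsl_spec [NeZero d] {c₂ Δt lo : ℝ} (h : GapProblem A ρ p c₂ Δt) (hpick : IsArgmax pick)
    (hlo : 0 < lo) :
    SolverSpec (gsl A pick) A ρ p lo
      (fun R lam w u => ((gsl A pick).solve A lam w (startPoint A lam w) R u).val)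
      (fun R lam _ _ => (⌈Real.log R / ((lam - ρ 0) / ∑ i, (lam - ρ i))⌉₊ : ENNReal)) 11 := by
  rintro R lam w u hR ⟨hw, hl, hl2⟩ -
  have hx : 0 < lam - ρ 0 := hlo.trans_le hl
  have hlam := h.shift_pos hx
  have hμ : ∀ i, lam - ρ 0 ≤ lam - ρ i := fun i => by linarith [h.le_zero i]
  have hμS : lam - ρ 0 ≤ ∑ i, (lam - ρ i) :=
    Finset.single_le_sum (f := fun i => lam - ρ i) (fun i _ => (hlam i).le) (Finset.mem_univ 0)
  have hS : 0 < ∑ i, (lam - ρ i) := hx.trans_le hμS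
  set n₀ := ⌈Real.log R / ((lam - ρ 0) / ∑ i, (lam - ρ i))⌉₊ with hn₀
  have hreach : lsqError A lam w ((gsl A pick).iterate
      ((gsl A pick).states lam w (startPoint A lam w) u n₀)) ≤
        lsqError A lam w (startPoint A lam w) / R := by
    rw [h.lsqError_eq hlam, h.lsqError_eq hlam]
    refine (gsl_states h.toEigenSystem hpick hx hμ hμS w _ u n₀).2.trans ?_
    have h1 : (1 - (lam - ρ 0) / ∑ i, (lam - ρ i)) ^ n₀ ≤ 1 / R :=
      one_sub_pow_le_inv (div_pos hx hS) (div_le_one_of_le₀ hμS hS.le) (by linarith)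
        (Nat.le_ceil _)
    calc _ ≤ 1 / R * energy ρ p lam w (startPoint A lam w) :=
          mul_le_mul_of_nonneg_right h1 (EigenSystem.energy_nonneg hlam _ _)
      _ = _ := by ring
  have hex : ∃ n, lsqError A lam w ((gsl A pick).iterate
      ((gsl A pick).states lam w (startPoint A lam w) u n)) ≤
        lsqError A lam w (startPoint A lam w) / R := ⟨n₀, hreach⟩
  obtain ⟨N, hN, hmin, hle⟩ : ∃ N, lsqError A lam w ((gsl A pick).iterate
      ((gsl A pick).states lam w (startPoint A lam w) u N)) ≤
        lsqError A lam w (startPoint A lam w) / R ∧ (∀ k < N, ¬ lsqError A lam w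
      ((gsl A pick).iterate ((gsl A pick).states lam w (startPoint A lam w) u k)) ≤
        lsqError A lam w (startPoint A lam w) / R) ∧ N ≤ n₀ :=
    ⟨Nat.find hex, Nat.find_spec hex, fun k hk => Nat.find_min hex hk, Nat.find_min' hex hreach⟩
  obtain ⟨hv, ho⟩ := (gsl A pick).solve_spec A lam w (startPoint A lam w) R u
    (ops_gsl_start lam w _) (fun t s => ops_gsl_step lam w t s) hN hmin
  refine ⟨rfl, ?_, ?_⟩
  · rw [h.lsqError_eq hlam, h.lsqError_eq hlam] at hN
    simp only [SolvesTo, hv]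
    exact hN
  · rw [cost, ho]
    have hd : 1 ≤ d := Nat.pos_of_ne_zero (NeZero.ne d)
    have : 2 * d ^ 2 + 5 * d + (N * (5 * d + 5) + (N + 1)) ≤ 11 * (d ^ 2 + d * n₀) := by nlinarith
    change _ ≤ ((11 : ℕ) : ENNReal) * ((d : ENNReal) ^ 2 + d * (n₀ : ENNReal))
    exact_mod_cast this

end gsl

/-! ### Accelerated coordinate descent: one step -/

section acdm

variable {d : ℕ} {A : Matrix (Fin d) (Fin d) ℝ} {ρ : Fin d → ℝ} {p : Fin d → Fin d → ℝ}

/-- `∑ i, √(λ - A i i)`. -/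
noncomputable def sqrtSum (A : Matrix (Fin d) (Fin d) ℝ) (lam : ℝ) : ℝ :=
  ∑ i, Real.sqrt (lam - A i i)

/-- The momentum parameter `τ`. -/
noncomputable def acdmTau (A : Matrix (Fin d) (Fin d) ℝ) (ρ₁ lam : ℝ) : ℝ :=
  2 / (1 + Real.sqrt (4 * (sqrtSum A lam * sqrtSum A lam) / (lam - ρ₁) + 1))

/-- The step size `η`. -/
noncomputable def acdmEta (A : Matrix (Fin d) (Fin d) ℝ) (ρ₁ lam : ℝ) : ℝ :=
  1 / (acdmTau A ρ₁ lam * (sqrtSum A lam * sqrtSum A lam))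

/-- The point at which the gradient is evaluated. -/
noncomputable def acdmMid (A : Matrix (Fin d) (Fin d) ℝ) (ρ₁ lam : ℝ)
    (s : (Fin d → ℝ) × (Fin d → ℝ)) : Fin d → ℝ :=
  acdmTau A ρ₁ lam • s.2 + (1 - acdmTau A ρ₁ lam) • s.1

/-- The new `(y, z)` if coordinate `i` is sampled. -/
noncomputable def acdmNext (A : Matrix (Fin d) (Fin d) ℝ) (ρ₁ lam : ℝ) (b : Fin d → ℝ)
    (s : (Fin d → ℝ) × (Fin d → ℝ)) (i : Fin d) : (Fin d → ℝ) × (Fin d → ℝ) :=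
  let x := acdmMid A ρ₁ lam s
  let g := lam • x - A.mulVec x - b
  let v := s.2 + (acdmEta A ρ₁ lam * (lam - ρ₁)) • x
  (Function.update x i (x i - g i / (lam - A i i)),
    (1 + acdmEta A ρ₁ lam * (lam - ρ₁))⁻¹ • Function.update v i
      (v i - acdmEta A ρ₁ lam / (Real.sqrt (lam - A i i) / sqrtSum A lam) * g i))

/-- The potential function of the analysis. -/
noncomputable def acdmPotential (A : Matrix (Fin d) (Fin d) ℝ) (ρ : Fin d → ℝ)
    (p : Fin d → Fin d → ℝ) (ρ₁ lam : ℝ) (b : Fin d → ℝ) (s : (Fin d → ℝ) × (Fin d → ℝ)) : ℝ :=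
  energy ρ p lam b s.1 + (lam - ρ₁) / (2 * (1 - acdmTau A ρ₁ lam)) *
    ((s.2 - shiftInv ρ p lam b) ⬝ᵥ (s.2 - shiftInv ρ p lam b))

theorem dotProduct_self_nonneg' (v : Fin d → ℝ) : 0 ≤ v ⬝ᵥ v :=
  Finset.sum_nonneg fun i _ => mul_self_nonneg (v i)

/-- What is needed of the parameters. -/
theorem acdm_parameters {lam ρ₁ : ℝ} (hμ : 0 < lam - ρ₁)
    (hS : 2 * (lam - ρ₁) ≤ sqrtSum A lam ^ 2) (hS0 : 0 < sqrtSum A lam) :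
    0 < acdmTau A ρ₁ lam ∧ acdmTau A ρ₁ lam ≤ 1 / 2 ∧
      acdmTau A ρ₁ lam ^ 2 * sqrtSum A lam ^ 2 = (lam - ρ₁) * (1 - acdmTau A ρ₁ lam) ∧
      acdmEta A ρ₁ lam * (lam - ρ₁) = acdmTau A ρ₁ lam / (1 - acdmTau A ρ₁ lam) ∧
      1 / acdmTau A ρ₁ lam ≤ 1 + sqrtSum A lam / Real.sqrt (lam - ρ₁) := by
  set S := sqrtSum A lam with hSdef
  set μ := lam - ρ₁ with hμdef
  set r := Real.sqrt (4 * (S * S) / μ + 1) with hr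
  have hτ : acdmTau A ρ₁ lam = 2 / (1 + r) := by rw [acdmTau]
  -- The assumption `2 μ ≤ S ^ 2` makes the radicand at least `9`; hence `τ ≤ 1 / 2`.
  have hr3 : 3 ≤ r := by
    refine Real.le_sqrt_of_sq_le ?_
    have : 8 ≤ 4 * (S * S) / μ := by rw [le_div_iff₀ hμ]; nlinarith
    linarith
  have hr2 : r ^ 2 = 4 * S ^ 2 / μ + 1 := by rw [hr, Real.sq_sqrt (by positivity)]; ring
  have hr2' : μ * (r ^ 2 - 1) = 4 * S ^ 2 := by rw [hr2]; field_simp; ring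
  have h1 : 0 < 1 + r := by linarith
  -- So `τ` is the positive root of `τ ^ 2 * S ^ 2 = μ * (1 - τ)`, the relation behind the
  -- cancellation of gradient terms in `acdm_contraction`.
  have e1 : (2 / (1 + r)) ^ 2 * S ^ 2 = μ * (1 - 2 / (1 + r)) := by
    field_simp
    linarith
  have hk : 0 < 1 - 2 / (1 + r) := by
    rw [sub_pos, div_lt_one h1]; linarith
  refine ⟨by rw [hτ]; positivity, ?_, ?_, ?_, ?_⟩
  · rw [hτ, div_le_div_iff₀ h1 (by norm_num)]; linarith
  · rw [hτ]; exact e1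
  · rw [acdmEta, ← hSdef, hτ]
    rw [eq_div_iff hk.ne', mul_assoc, ← e1]
    field_simp
  · rw [hτ, one_div_div]
    have h2 : r ≤ 2 * (S / Real.sqrt μ) + 1 := by
      rw [hr, Real.sqrt_le_left (by positivity)]
      have : (2 * (S / Real.sqrt μ) + 1) ^ 2 =
          4 * (S * S) / μ + 1 + 4 * (S / Real.sqrt μ) := by
        rw [add_sq, mul_pow, div_pow, Real.sq_sqrt hμ.le]; ring
      rw [this]
      have : 0 ≤ S / Real.sqrt μ := by positivity
      linarith
    linarith

/-- Expanding the square, each `i` contributes one cross term and one variance term. In the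
application `c i` is proportional to `1 / q i`, which turns the averaged cross terms into an inner
product with the full gradient. -/
theorem sum_sub_single_dot (V q c : Fin d → ℝ) (hq : ∑ i, q i = 1) :
    ∑ i, q i * ((V - c i • Pi.single i (1 : ℝ)) ⬝ᵥ (V - c i • Pi.single i (1 : ℝ))) =
      V ⬝ᵥ V - 2 * ∑ i, q i * (c i * V i) + ∑ i, q i * c i ^ 2 := by
  have h1 : ∀ i, (V - c i • Pi.single i (1 : ℝ)) ⬝ᵥ (V - c i • Pi.single i (1 : ℝ)) =
      V ⬝ᵥ V - 2 * (c i * V i) + c i ^ 2 := by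
    intro i
    rw [sub_dotProduct, dotProduct_sub, dotProduct_sub, smul_dotProduct, dotProduct_smul,
      dotProduct_smul, smul_dotProduct, dotProduct_single_one, single_one_dotProduct,
      single_one_dotProduct]
    simp
    ring
  simp_rw [h1, mul_add, mul_sub]
  rw [Finset.sum_add_distrib, Finset.sum_sub_distrib, ← Finset.sum_mul, hq, one_mul,
    Finset.mul_sum]
  congr 2
  exact Finset.sum_congr rfl fun i _ => by ring

theorem dot_convex (u v : Fin d → ℝ) {τ : ℝ} (h0 : 0 ≤ τ) (h1 : τ ≤ 1) :
    ((1 - τ) • u + τ • v) ⬝ᵥ ((1 - τ) • u + τ • v) ≤ (1 - τ) * (u ⬝ᵥ u) + τ * (v ⬝ᵥ v) := by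
  have : (1 - τ) * (u ⬝ᵥ u) + τ * (v ⬝ᵥ v) -
      ((1 - τ) • u + τ • v) ⬝ᵥ ((1 - τ) • u + τ • v) = (1 - τ) * τ * ((u - v) ⬝ᵥ (u - v)) := by
    simp only [add_dotProduct, dotProduct_add, smul_dotProduct, dotProduct_smul, smul_eq_mul,
      sub_dotProduct, dotProduct_sub, dotProduct_comm v u]
    ring
  have h2 := dotProduct_self_nonneg' (u - v)
  have : 0 ≤ (1 - τ) * τ * ((u - v) ⬝ᵥ (u - v)) :=
    mul_nonneg (mul_nonneg (by linarith) h0) h2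
  linarith

/-- The potential contracts in expectation. -/
theorem acdm_contraction (h : EigenSystem A ρ p) {lam ρ₁ : ℝ} (hμ : 0 < lam - ρ₁)
    (hle : ∀ i, lam - ρ₁ ≤ lam - ρ i) (hS : 2 * (lam - ρ₁) ≤ sqrtSum A lam ^ 2)
    (hS0 : 0 < sqrtSum A lam) (b : Fin d → ℝ) (s : (Fin d → ℝ) × (Fin d → ℝ)) :
    ∑ i, Real.sqrt (lam - A i i) / sqrtSum A lam *
      acdmPotential A ρ p ρ₁ lam b (acdmNext A ρ₁ lam b s i) ≤
        (1 - acdmTau A ρ₁ lam) * acdmPotential A ρ p ρ₁ lam b s := by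
  obtain ⟨hτ0, hτ1, hτS, hημ, -⟩ := acdm_parameters hμ hS hS0
  have hlam : ∀ i, 0 < lam - ρ i := fun i => hμ.trans_le (hle i)
  have hL : ∀ i, 0 < lam - A i i := fun i => hμ.trans_le (h.le_diag_shift hle i)
  have hsq : ∀ i, 0 < Real.sqrt (lam - A i i) := fun i => Real.sqrt_pos.2 (hL i)
  have hηdef : acdmEta A ρ₁ lam = 1 / (acdmTau A ρ₁ lam * (sqrtSum A lam * sqrtSum A lam)) := rfl
  have hxdef : acdmMid A ρ₁ lam s =
    acdmTau A ρ₁ lam • s.2 + (1 - acdmTau A ρ₁ lam) • s.1 := rfl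
  have hSsum : ∑ i, Real.sqrt (lam - A i i) = sqrtSum A lam := rfl
  obtain ⟨y, z⟩ := s
  simp only [acdmPotential, acdmNext]
  set S := sqrtSum A lam
  set τ := acdmTau A ρ₁ lam
  set η := acdmEta A ρ₁ lam
  set μ := lam - ρ₁
  set x := acdmMid A ρ₁ lam (y, z)
  set xs := shiftInv ρ p lam b with hxs
  set g := lam • x - A.mulVec x - b with hg
  set w := z + (η * μ) • x with hw
  have hk : 0 < 1 - τ := by linarith
  have hkinv : (1 + η * μ)⁻¹ = 1 - τ := by
    rw [hημ]; field_simp; ring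
  rw [hkinv]
  set q : Fin d → ℝ := fun i => Real.sqrt (lam - A i i) / S with hq
  have hqsum : ∑ i, q i = 1 := by
    rw [hq, ← Finset.sum_div, hSsum, div_self hS0.ne']
  -- `V` is the new `z - x*` without its gradient correction; it is a convex combination of `z - x*`
  -- and `x - x*`.
  set V := (1 - τ) • w - xs with hV
  have hz : ∀ i, (1 - τ) • Function.update w i
      (w i - η / (Real.sqrt (lam - A i i) / S) * g i) - xs =
        V - ((1 - τ) * (η / q i * g i)) • Pi.single i (1 : ℝ) := by
    intro i
    ext j
    by_cases hj : j = i
    · subst hj; simp [hV, hq]; ring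
    · simp [hV, hj]
  have hupd : ∀ i, energy ρ p lam b (Function.update x i (x i - g i / (lam - A i i))) =
      energy ρ p lam b x - g i ^ 2 / (2 * (lam - A i i)) := fun i =>
    h.energy_update hlam b x i (hL i)
  simp_rw [hz, hupd, mul_add]
  rw [Finset.sum_add_distrib]
  have e1 : ∑ i, Real.sqrt (lam - A i i) / S *
      (energy ρ p lam b x - g i ^ 2 / (2 * (lam - A i i))) = energy ρ p lam b x -
        1 / (2 * S) * ∑ i, g i ^ 2 / Real.sqrt (lam - A i i) := by
    have h3 : ∀ i, Real.sqrt (lam - A i i) / S *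
        (energy ρ p lam b x - g i ^ 2 / (2 * (lam - A i i))) =
        q i * energy ρ p lam b x - 1 / (2 * S) * (g i ^ 2 / Real.sqrt (lam - A i i)) := by
      intro i
      have h1 : q i = Real.sqrt (lam - A i i) / S := rfl
      have := (hsq i).ne'
      have h2 : g i ^ 2 / (2 * (lam - A i i)) = g i ^ 2 / (2 * Real.sqrt (lam - A i i) ^ 2) := by
        rw [Real.sq_sqrt (hL i).le]
      rw [h1, h2]
      generalize Real.sqrt (lam - A i i) = t at this
      field_simp
    simp_rw [h3]
    rw [Finset.sum_sub_distrib, ← Finset.sum_mul, hqsum, one_mul, Finset.mul_sum]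
  have e2 : ∑ i, Real.sqrt (lam - A i i) / S * (μ / (2 * (1 - τ)) *
      ((V - ((1 - τ) * (η / q i * g i)) • Pi.single i (1 : ℝ)) ⬝ᵥ
        (V - ((1 - τ) * (η / q i * g i)) • Pi.single i (1 : ℝ)))) =
      μ / (2 * (1 - τ)) * (V ⬝ᵥ V - 2 * ((1 - τ) * η) * (g ⬝ᵥ V)) +
        1 / (2 * S) * ∑ i, g i ^ 2 / Real.sqrt (lam - A i i) := by
    have h3 := sum_sub_single_dot V q (fun i => (1 - τ) * (η / q i * g i)) hqsum
    have h4 : ∀ i, Real.sqrt (lam - A i i) / S * (μ / (2 * (1 - τ)) *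
      ((V - ((1 - τ) * (η / q i * g i)) • Pi.single i (1 : ℝ)) ⬝ᵥ
        (V - ((1 - τ) * (η / q i * g i)) • Pi.single i (1 : ℝ)))) = μ / (2 * (1 - τ)) *
      (q i * ((V - ((1 - τ) * (η / q i * g i)) • Pi.single i (1 : ℝ)) ⬝ᵥ
        (V - ((1 - τ) * (η / q i * g i)) • Pi.single i (1 : ℝ)))) := fun i => by
      rw [hq]; ring
    simp_rw [h4]
    rw [← Finset.mul_sum, h3]
    have hq0 : ∀ i, q i ≠ 0 := fun i => (div_pos (hsq i) hS0).ne'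
    have h5 : ∑ i, q i * ((1 - τ) * (η / q i * g i) * V i) = ((1 - τ) * η) * (g ⬝ᵥ V) := by
      rw [dotProduct, Finset.mul_sum]
      refine Finset.sum_congr rfl fun i _ => ?_
      have := hq0 i
      field_simp
    have h6 : ∑ i, q i * ((1 - τ) * (η / q i * g i)) ^ 2 =
        (1 - τ) ^ 2 * η ^ 2 * S * ∑ i, g i ^ 2 / Real.sqrt (lam - A i i) := by
      rw [Finset.mul_sum]
      refine Finset.sum_congr rfl fun i _ => ?_
      have := hq0 i
      have h7 : q i = Real.sqrt (lam - A i i) / S := rfl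
      have := (hsq i).ne'
      have e : q i * ((1 - τ) * (η / q i * g i)) ^ 2 = (1 - τ) ^ 2 * η ^ 2 * (g i ^ 2 / q i) := by
        field_simp
      rw [e, h7]
      field_simp
    rw [h5, h6]
    -- The variance of the `z`-update is exactly the expected energy decrease of the `y`-update, so
    -- both terms in `g i ^ 2` disappear from the sum.
    have h8 : μ / (2 * (1 - τ)) * ((1 - τ) ^ 2 * η ^ 2 * S) = 1 / (2 * S) := by
      have : η * η * (τ ^ 2 * S ^ 2) * S ^ 2 = 1 := by
        rw [hηdef]; field_simp
      rw [hτS] at this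
      field_simp
      linarith
    rw [mul_add, ← mul_assoc (μ / (2 * (1 - τ))) ((1 - τ) ^ 2 * η ^ 2 * S), h8]
    ring
  rw [e1, e2]
  have hVeq : V = (1 - τ) • (z - xs) + τ • (x - xs) := by
    have : (1 - τ) * (η * μ) = τ := by rw [hημ]; field_simp
    rw [hV, hw, smul_add, smul_smul, this]
    ext i; simp; ring
  have hconv : V ⬝ᵥ V ≤ (1 - τ) * ((z - xs) ⬝ᵥ (z - xs)) + τ * ((x - xs) ⬝ᵥ (x - xs)) := by
    rw [hVeq]; exact dot_convex _ _ hτ0.le (by linarith)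
  have hgx : g ⬝ᵥ (x - xs) = 2 * energy ρ p lam b x := h.energy_eq_grad hlam b x
  -- By the definition of the midpoint, `τ * (z - x) = (1 - τ) * (x - y)`; this trades `z` for `y`
  -- in the linear term.
  have hVg : τ * (g ⬝ᵥ V) = τ * (g ⬝ᵥ (x - xs)) + (1 - τ) ^ 2 * (g ⬝ᵥ (x - y)) := by
    have : τ • V = τ • (x - xs) + (1 - τ) ^ 2 • (x - y) := by
      rw [hVeq, hxdef]; ext i; simp; ring
    rw [← smul_eq_mul, ← smul_eq_mul, ← smul_eq_mul, ← dotProduct_smul, this, dotProduct_add,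
      dotProduct_smul, dotProduct_smul]
  have hgy : energy ρ p lam b x - energy ρ p lam b y ≤ g ⬝ᵥ (x - y) := by
    have := h.energy_sub hlam b x (x - y)
    rw [sub_sub_cancel, ← hg] at this
    have h9 : 0 ≤ (x - y) ⬝ᵥ (lam • (x - y) - A.mulVec (x - y)) := by
      rw [h.shift_quad]
      exact Finset.sum_nonneg fun i _ => mul_nonneg (hlam i).le (sq_nonneg _)
    linarith
  have hstrong : μ / 2 * ((x - xs) ⬝ᵥ (x - xs)) ≤ energy ρ p lam b x := by
    rw [h.energy_eq_quad, h.shift_quad, h.dot_self, hxs]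
    have : μ * ∑ i, ((x - shiftInv ρ p lam b) ⬝ᵥ p i) ^ 2 ≤
        ∑ i, (lam - ρ i) * ((x - shiftInv ρ p lam b) ⬝ᵥ p i) ^ 2 := by
      rw [Finset.mul_sum]
      exact Finset.sum_le_sum fun i _ => mul_le_mul_of_nonneg_right (hle i) (sq_nonneg _)
    linarith
  have hE : 0 ≤ energy ρ p lam b x := EigenSystem.energy_nonneg hlam b x
  generalize energy ρ p lam b x = Ex at *
  generalize energy ρ p lam b y = Ey at *
  generalize (z - xs) ⬝ᵥ (z - xs) = Z at *
  generalize (x - xs) ⬝ᵥ (x - xs) = Xn at *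
  generalize V ⬝ᵥ V = VV at *
  generalize g ⬝ᵥ V = gV at *
  generalize g ⬝ᵥ (x - y) = gxy at *
  rw [hgx] at hVg
  have hη1 : μ * η = τ / (1 - τ) := by rw [mul_comm]; exact hημ
  have f1 : μ / (2 * (1 - τ)) * (VV - 2 * ((1 - τ) * η) * gV) =
      μ / (2 * (1 - τ)) * VV - (2 * τ / (1 - τ) * Ex + (1 - τ) * gxy) := by
    have : μ / (2 * (1 - τ)) * (2 * ((1 - τ) * η) * gV) = (μ * η) * gV := by field_simp
    have h2 : τ / (1 - τ) * gV = τ * gV / (1 - τ) := by ring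
    rw [mul_sub, this, hη1, h2, hVg]
    field_simp
  rw [f1]
  have f2 : μ / (2 * (1 - τ)) * VV ≤ μ / (2 * (1 - τ)) * ((1 - τ) * Z) + τ / (1 - τ) * Ex := by
    have : μ / (2 * (1 - τ)) * VV ≤ μ / (2 * (1 - τ)) * ((1 - τ) * Z + τ * Xn) :=
      mul_le_mul_of_nonneg_left hconv (by positivity)
    have f3 : μ / (2 * (1 - τ)) * (τ * Xn) = τ / (1 - τ) * (μ / 2 * Xn) := by field_simp
    have f4 : τ / (1 - τ) * (μ / 2 * Xn) ≤ τ / (1 - τ) * Ex :=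
      mul_le_mul_of_nonneg_left hstrong (by positivity)
    linarith
  have f5 : (1 - τ) * (Ex - Ey) ≤ (1 - τ) * gxy := mul_le_mul_of_nonneg_left hgy hk.le
  have f6 : τ * Ex ≤ τ / (1 - τ) * Ex := by
    refine mul_le_mul_of_nonneg_right ?_ hE
    rw [le_div_iff₀ hk]
    nlinarith
  -- One half pays for the term `x - x*` of the convex combination through strong convexity; the
  -- other half and `f5` replace the energy at `x` by `(1 - τ)` times that at `y`.
  have f7 : 2 * τ / (1 - τ) * Ex = τ / (1 - τ) * Ex + τ / (1 - τ) * Ex := by ring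
  have f8 : (1 - τ) * (μ / (2 * (1 - τ)) * Z) = μ / (2 * (1 - τ)) * ((1 - τ) * Z) := by ring
  rw [f7, f8]
  linarith

/-- Since `τ ≤ 1 / 2`, the distance enters with a coefficient at most `μ`, and strong convexity
bounds that part by twice the energy. -/
theorem acdmPotential_start (h : EigenSystem A ρ p) {lam ρ₁ : ℝ} (hμ : 0 < lam - ρ₁)
    (hle : ∀ i, lam - ρ₁ ≤ lam - ρ i) (hS : 2 * (lam - ρ₁) ≤ sqrtSum A lam ^ 2)
    (hS0 : 0 < sqrtSum A lam) (b x₀ : Fin d → ℝ) :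
    acdmPotential A ρ p ρ₁ lam b (x₀, x₀) ≤ 3 * energy ρ p lam b x₀ := by
  obtain ⟨hτ0, hτ1, -, -, -⟩ := acdm_parameters hμ hS hS0
  unfold acdmPotential
  have hstrong : (lam - ρ₁) / 2 *
      ((x₀ - shiftInv ρ p lam b) ⬝ᵥ (x₀ - shiftInv ρ p lam b)) ≤ energy ρ p lam b x₀ := by
    rw [h.energy_eq_quad, h.shift_quad, h.dot_self]
    have : (lam - ρ₁) * ∑ i, ((x₀ - shiftInv ρ p lam b) ⬝ᵥ p i) ^ 2 ≤
        ∑ i, (lam - ρ i) * ((x₀ - shiftInv ρ p lam b) ⬝ᵥ p i) ^ 2 := by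
      rw [Finset.mul_sum]
      exact Finset.sum_le_sum fun i _ => mul_le_mul_of_nonneg_right (hle i) (sq_nonneg _)
    linarith
  have hN := dotProduct_self_nonneg' (x₀ - shiftInv ρ p lam b)
  have h1 : (lam - ρ₁) / (2 * (1 - acdmTau A ρ₁ lam)) ≤ lam - ρ₁ := by
    rw [div_le_iff₀ (by linarith)]; nlinarith
  have := mul_le_mul_of_nonneg_right h1 hN
  simp only
  linarith

end acdm

/-! ### Independent steps -/

section process

variable {α S : Type*} [MeasurableSpace α] [MeasurableSpace S] (μ : Measure α)
  [IsProbabilityMeasure μ]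

/-- Resampling one coordinate preserves a product measure. -/
theorem measurePreserving_update (n : ℕ) :
    MeasurePreserving (fun q : (ℕ → α) × α => Function.update q.1 n q.2)
      ((Measure.infinitePi fun _ : ℕ => μ).prod μ) (Measure.infinitePi fun _ : ℕ => μ) := by
  have hmeas : Measurable (fun q : (ℕ → α) × α => Function.update q.1 n q.2) := by
    refine measurable_pi_iff.2 fun k => ?_
    by_cases hk : k = n
    · subst hk; simpa using measurable_snd
    · simp only [Function.update_of_ne hk]
      exact (measurable_pi_apply k).comp measurable_fst
  refine ⟨hmeas, ?_⟩
  refine Measure.eq_infinitePi _ fun s t ht => ?_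
  rw [Measure.map_apply hmeas (MeasurableSet.pi s.countable_toSet fun i _ => ht i)]
  have e : (fun q : (ℕ → α) × α => Function.update q.1 n q.2) ⁻¹' (s : Set ℕ).pi t =
      ((s.erase n : Finset ℕ) : Set ℕ).pi t ×ˢ (if n ∈ s then t n else Set.univ) := by
    ext ⟨ω, a⟩
    simp only [Set.mem_preimage, Set.mem_pi, Finset.mem_coe, Set.mem_prod, Finset.mem_erase]
    constructor
    · intro h
      refine ⟨fun i hi => by simpa [hi.1] using h i hi.2, ?_⟩
      split_ifs with hn
      · simpa using h n hn
      · trivial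
    · rintro ⟨h1, h2⟩ i hi
      by_cases hin : i = n
      · subst hin; simpa [hi] using h2
      · simpa [hin] using h1 i ⟨hin, hi⟩
  rw [e, Measure.prod_prod, Measure.infinitePi_pi _ (fun i _ => ht i)]
  split_ifs with hn
  · rw [mul_comm, Finset.mul_prod_erase s (fun i => μ (t i)) hn]
  · rw [measure_univ, mul_one, Finset.erase_eq_of_notMem hn]

/-- Expectation over the next step of a process that depends only on earlier coordinates. -/
theorem lintegral_next (n : ℕ) {X : (ℕ → α) → S} (hX : Measurable X)
    (hXn : ∀ ω a, X (Function.update ω n a) = X ω) {F : S → α → ENNReal}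
    (hF : Measurable (Function.uncurry F)) :
    ∫⁻ ω, F (X ω) (ω n) ∂(Measure.infinitePi fun _ : ℕ => μ) =
      ∫⁻ ω, ∫⁻ a, F (X ω) a ∂μ ∂(Measure.infinitePi fun _ : ℕ => μ) := by
  have h1 : Measurable fun ω : ℕ → α => F (X ω) (ω n) :=
    hF.comp (hX.prodMk (measurable_pi_apply n))
  -- After resampling coordinate `n` the state `X` no longer sees the new value, so Fubini separates
  -- the two.
  rw [← (measurePreserving_update μ n).lintegral_comp h1, lintegral_prod]
  · simp only [hXn, Function.update_self]
  · exact (h1.comp (measurePreserving_update μ n).measurable).aemeasurable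

end process

/-! ### Accelerated coordinate descent: sampling and the run -/

section acdm

variable {d : ℕ} [NeZero d]

-- The last index passes the test because `u ≤ 1`, so the default index `0` is never used; the lower
-- bound is the failed test at the preceding index.
open Classical in
theorem sampleIndex_bounds (r : Fin d → ℝ) (u : unitInterval) (hS : 0 ≤ ∑ i, r i) {i : Fin d}
    (hi : (sampleIndex r (∑ i, r i) u).val = i) :
    ∑ l ∈ Finset.Iio i, r l ≤ u * ∑ i, r i ∧ u * ∑ i, r i ≤ ∑ l ∈ Finset.Iic i, r l := by
  have hu0 : 0 ≤ (u : ℝ) * ∑ i, r i := mul_nonneg u.2.1 hS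
  have hu1 : (u : ℝ) * ∑ i, r i ≤ ∑ i, r i := mul_le_of_le_one_left hS u.2.2
  set S := ∑ i, r i with hSdef
  have hd : 0 < d := Nat.pos_of_ne_zero (NeZero.ne d)
  unfold sampleIndex at hi
  simp only at hi
  cases hf : (List.finRange d).find? fun i => decide ((u : ℝ) * S ≤ ∑ l ∈ Finset.Iic i, r l) with
  | none =>
    exfalso
    rw [List.find?_eq_none] at hf
    have h1 := hf ⟨d - 1, by omega⟩ (List.mem_finRange _)
    have h2 : Finset.Iic (⟨d - 1, by omega⟩ : Fin d) = Finset.univ := by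
      ext j
      simp only [Finset.mem_Iic, Finset.mem_univ, iff_true, Fin.le_def]
      omega
    rw [h2] at h1
    exact h1 (by simpa [hSdef] using hu1)
  | some j =>
    rw [hf, Option.getD_some] at hi
    subst hi
    rw [List.find?_eq_some_iff_getElem] at hf
    obtain ⟨h1, n, hn, hnj, hlt⟩ := hf
    refine ⟨?_, by simpa using h1⟩
    rw [List.getElem_finRange] at hnj
    have hnj' : n = j.val := by rw [← hnj]; rfl
    by_cases hn0 : n = 0
    · have : Finset.Iio j = ∅ := by
        ext k
        simp only [Finset.mem_Iio, Finset.notMem_empty, iff_false, Fin.lt_def]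
        omega
      rw [this, Finset.sum_empty]; exact hu0
    · have h3 := hlt (n - 1) (by omega)
      rw [List.getElem_finRange] at h3
      simp only [Bool.not_eq_eq_eq_not, Bool.not_true, decide_eq_false_iff_not, not_le] at h3
      have : Finset.Iio j = Finset.Iic (Fin.cast (by simp) (⟨n - 1, by simp at hn ⊢; omega⟩ :
          Fin (List.finRange d).length)) := by
        ext k
        simp only [Finset.mem_Iio, Finset.mem_Iic, Fin.lt_def, Fin.le_def, Fin.val_cast]
        omega
      rw [this]
      exact h3.le

/-- The numbers selecting `i` lie in an interval of length `r i / S`. An upper bound suffices,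
because only nonnegative potentials are integrated against this law. -/
theorem volume_sampleIndex_le (r : Fin d → ℝ) (hS : 0 < ∑ i, r i) (i : Fin d) :
    (volume : Measure unitInterval) {u | (sampleIndex r (∑ i, r i) u).val = i} ≤
      ENNReal.ofReal (r i / ∑ i, r i) := by
  set S := ∑ i, r i with hSdef
  have hsub : (Subtype.val '' {u : unitInterval | (sampleIndex r S u).val = i}) ⊆
      Set.Icc ((∑ l ∈ Finset.Iio i, r l) / S) ((∑ l ∈ Finset.Iic i, r l) / S) := by
    rintro _ ⟨u, hu, rfl⟩
    obtain ⟨h1, h2⟩ := sampleIndex_bounds r u hS.le hu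
    exact ⟨by rwa [div_le_iff₀ hS], by rwa [le_div_iff₀ hS]⟩
  rw [unitInterval.volume_apply]
  refine (measure_mono hsub).trans ?_
  rw [Real.volume_Icc, ← sub_div]
  refine ENNReal.ofReal_le_ofReal (le_of_eq ?_)
  congr 1
  rw [← Finset.Iio_insert, Finset.sum_insert (by simp)]
  ring

-- The scan sees its input only through `d` Boolean outcomes, and any function on the finite set of
-- outcomes is measurable.
open Classical in
theorem measurable_sampleIndex {β : Type*} [MeasurableSpace β] {r : β → Fin d → ℝ} {S : β → ℝ}
    {u : β → unitInterval} (hr : Measurable r) (hS : Measurable S) (hu : Measurable u) :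
    Measurable fun b => (sampleIndex (r b) (S b) (u b)).val := by
  have h1 : Measurable fun b => fun i : Fin d =>
      decide ((u b : ℝ) * S b ≤ ∑ l ∈ Finset.Iic i, r b l) := by
    refine measurable_pi_iff.2 fun i => ?_
    refine measurable_to_bool ?_
    have : (fun b => decide ((u b : ℝ) * S b ≤ ∑ l ∈ Finset.Iic i, r b l)) ⁻¹' {true} =
        {b | (u b : ℝ) * S b ≤ ∑ l ∈ Finset.Iic i, r b l} := by
      ext b; simp
    rw [this]
    exact measurableSet_le ((measurable_subtype_coe.comp hu).mul hS)
      (Finset.measurable_sum _ fun l _ => (measurable_pi_apply l).comp hr)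
  have h2 : Measurable fun f : Fin d → Bool => ((List.finRange d).find? f).getD 0 :=
    measurable_of_countable _
  exact h2.comp h1

variable (A : Matrix (Fin d) (Fin d) ℝ) (ρ₁ : ℝ)

/-- The sampled coordinate. -/
noncomputable def acdmIdx (lam : ℝ) (u : unitInterval) : Fin d :=
  (sampleIndex (fun i => Real.sqrt (lam - A i i)) (sqrtSum A lam) u).val

/-- The vectors `(y, z)` in the course of NU-ACDM. -/
noncomputable def acdmPair (lam : ℝ) (b x₀ : Fin d → ℝ) (u : ℕ → unitInterval) :
    ℕ → (Fin d → ℝ) × (Fin d → ℝ)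
  | 0 => (x₀, x₀)
  | n + 1 => acdmNext A ρ₁ lam b (acdmPair lam b x₀ u n) (acdmIdx A lam (u n))

theorem nuACDM_states (lam : ℝ) (b x₀ : Fin d → ℝ) (u : ℕ → unitInterval) (n : ℕ) :
    (nuACDM A ρ₁).states lam b x₀ u n =
      (⟨(acdmPair A ρ₁ lam b x₀ u n).1, (acdmPair A ρ₁ lam b x₀ u n).2, fun i => lam - A i i,
        fun i => Real.sqrt (lam - A i i), sqrtSum A lam, acdmTau A ρ₁ lam,
        acdmEta A ρ₁ lam⟩ : ACDMState d) := by
  induction n with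
  | zero =>
    simp [LSO.states, nuACDM, acdmPair, acdmTau, acdmEta, sqrtSum]
  | succ n ih =>
    rw [LSO.states, ih, acdmPair]
    generalize acdmPair A ρ₁ lam b x₀ u n = s
    have hx : (fun i => acdmTau A ρ₁ lam * s.2 i + (1 - acdmTau A ρ₁ lam) * s.1 i) =
        acdmMid A ρ₁ lam s := by ext i; simp [acdmMid]
    simp only [nuACDM, val_bind, val_vec, val_div, val_num, val_sub, val_add, val_mul,
      val_pure, val_dot, hx]
    have hi : (sampleIndex (fun i => Real.sqrt (lam - A i i)) (sqrtSum A lam) (u n)).val =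
        acdmIdx A lam (u n) := rfl
    rw [hi]
    generalize acdmIdx A lam (u n) = i
    simp only [acdmNext]
    congr 1
    ext j
    rw [Pi.smul_apply, smul_eq_mul, div_eq_inv_mul]
    rfl

theorem ops_nuACDM_start (lam : ℝ) (b x₀ : Fin d → ℝ) :
    ((nuACDM A ρ₁).start lam b x₀).ops = (3 * d + 11 : ℕ) := by
  simp [nuACDM]; ring

theorem ops_nuACDM_step (lam : ℝ) (b : Fin d → ℝ) (t : unitInterval) (s : ACDMState d) :
    ((nuACDM A ρ₁).step lam b t s).ops = (14 * d + 11 : ℕ) := by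
  simp [nuACDM, sampleIndex]; ring

/-- The exit test of the solver after `n` steps. -/
def AcdmExit (ρ : Fin d → ℝ) (p : Fin d → Fin d → ℝ) (R lam : ℝ) (w : Fin d → ℝ)
    (u : ℕ → unitInterval) (n : ℕ) : Prop :=
  energy ρ p lam w (acdmPair A ρ₁ lam w (startPoint A lam w) u n).1 ≤
    energy ρ p lam w (startPoint A lam w) / R

open Classical in
/-- The number of steps before the exit test holds for the first time. -/
noncomputable def acdmCount (ρ : Fin d → ℝ) (p : Fin d → Fin d → ℝ) (R lam : ℝ) (w : Fin d → ℝ)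
    (u : ℕ → unitInterval) : ENNReal :=
  ∑' n : ℕ, if ∀ k ≤ n, ¬ AcdmExit A ρ₁ ρ p R lam w u k then 1 else 0

/-- The first iterate that passes the exit test. -/
noncomputable def acdmSol (ρ : Fin d → ℝ) (p : Fin d → Fin d → ℝ) (R lam : ℝ) (w : Fin d → ℝ)
    (u : ℕ → unitInterval) : Fin d → ℝ :=
  (acdmPair A ρ₁ lam w (startPoint A lam w) u (sInf {n | AcdmExit A ρ₁ ρ p R lam w u n})).1

variable {A} {ρ : Fin d → ℝ} {p : Fin d → Fin d → ℝ}

open Classical in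
theorem nuACDM_spec {c₂ Δt lo : ℝ} (h : GapProblem A ρ p c₂ Δt) (hlo : 0 < lo) :
    SolverSpec (nuACDM A (ρ 0)) A ρ p lo (acdmSol A (ρ 0) ρ p) (acdmCount A (ρ 0) ρ p) 29 := by
  rintro R lam w u hR ⟨hw, hl, hl2⟩ hfin
  have hlam := h.shift_pos (hlo.trans_le hl)
  have hex : ∃ n, AcdmExit A (ρ 0) ρ p R lam w u n := by
    -- If no iterate passes the test, every summand of the count is `1` and the count is infinite.
    by_contra! hcon
    apply hfin
    unfold acdmCount
    simp only [hcon, not_false_eq_true, implies_true, if_true]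
    exact ENNReal.tsum_const_eq_top_of_ne_zero one_ne_zero
  have hsInf : sInf {n | AcdmExit A (ρ 0) ρ p R lam w u n} = Nat.find hex := Nat.sInf_def hex
  have hsol : acdmSol A (ρ 0) ρ p R lam w u =
      (acdmPair A (ρ 0) lam w (startPoint A lam w) u (Nat.find hex)).1 := by
    rw [acdmSol, hsInf]
  have hit : ∀ n, (nuACDM A (ρ 0)).iterate
      ((nuACDM A (ρ 0)).states lam w (startPoint A lam w) u n) =
        (acdmPair A (ρ 0) lam w (startPoint A lam w) u n).1 := fun n => by
    rw [nuACDM_states]; rfl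
  have htest : ∀ n, lsqError A lam w ((nuACDM A (ρ 0)).iterate
      ((nuACDM A (ρ 0)).states lam w (startPoint A lam w) u n)) ≤
        lsqError A lam w (startPoint A lam w) / R ↔ AcdmExit A (ρ 0) ρ p R lam w u n := fun n => by
    rw [h.lsqError_eq hlam, h.lsqError_eq hlam, hit, AcdmExit]
  obtain ⟨hv, ho⟩ := (nuACDM A (ρ 0)).solve_spec A lam w (startPoint A lam w) R u
    (ops_nuACDM_start A (ρ 0) lam w _) (fun t s => ops_nuACDM_step A (ρ 0) lam w t s)
    ((htest _).2 (Nat.find_spec hex)) (fun k hk hc => Nat.find_min hex hk ((htest k).1 hc))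
  refine ⟨by rw [hv, hit, hsol], ?_, ?_⟩
  · rw [hsol]; exact Nat.find_spec hex
  · have hN : ((Nat.find hex : ℕ) : ENNReal) ≤ acdmCount A (ρ 0) ρ p R lam w u := by
      unfold acdmCount
      refine le_trans (le_of_eq ?_) (ENNReal.sum_le_tsum (Finset.range (Nat.find hex)))
      rw [Finset.sum_congr rfl (g := fun _ => (1 : ENNReal))]
      · simp
      · intro n hn
        rw [if_pos]
        intro k hk
        exact Nat.find_min hex (by have := Finset.mem_range.1 hn; omega)
    rw [cost, ho]
    have hd : 1 ≤ d := Nat.pos_of_ne_zero (NeZero.ne d)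
    generalize Nat.find hex = N at hN
    have h1 : 3 * d + 11 + (N * (14 * d + 11) + (N + 1)) ≤ 29 * (d ^ 2 + d * N) := by nlinarith
    calc _ ≤ ((29 : ℕ) : ENNReal) * ((d : ENNReal) ^ 2 + d * (N : ENNReal)) := by exact_mod_cast h1
      _ ≤ _ := by gcongr

end acdm

/-! ### Measurability -/

section measurability

variable {d : ℕ} {β : Type*} [MeasurableSpace β]

theorem Measurable.dotProduct' {f g : β → Fin d → ℝ} (hf : Measurable f) (hg : Measurable g) :
    Measurable fun b => f b ⬝ᵥ g b :=
  Finset.measurable_sum _ fun i _ =>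
    ((measurable_pi_apply i).comp hf).mul ((measurable_pi_apply i).comp hg)

theorem Measurable.mulVec' (A : Matrix (Fin d) (Fin d) ℝ) {f : β → Fin d → ℝ}
    (hf : Measurable f) : Measurable fun b => A.mulVec (f b) :=
  measurable_pi_iff.2 fun i => (measurable_const (a := A i)).dotProduct' hf

theorem Measurable.smul_vec {l : β → ℝ} {f : β → Fin d → ℝ}
    (hl : Measurable l) (hf : Measurable f) : Measurable fun b => l b • f b :=
  measurable_pi_iff.2 fun i => hl.mul ((measurable_pi_apply i).comp hf)

theorem Measurable.shift_mulVec (A : Matrix (Fin d) (Fin d) ℝ) {l : β → ℝ} {f : β → Fin d → ℝ}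
    (hl : Measurable l) (hf : Measurable f) : Measurable fun b => l b • f b - A.mulVec (f b) :=
  (hl.smul_vec hf).sub (hf.mulVec' A)

theorem Measurable.update_const {f : β → Fin d → ℝ} {g : β → ℝ} (i : Fin d)
    (hf : Measurable f) (hg : Measurable g) : Measurable fun b => Function.update (f b) i (g b) := by
  refine measurable_pi_iff.2 fun j => ?_
  by_cases hj : j = i
  · subst hj; simpa using hg
  · simp only [Function.update_of_ne hj]
    exact (measurable_pi_apply j).comp hf

theorem Measurable.energy' (ρ : Fin d → ℝ) (p : Fin d → Fin d → ℝ) {l : β → ℝ}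
    {y x : β → Fin d → ℝ} (hl : Measurable l) (hy : Measurable y) (hx : Measurable x) :
    Measurable fun b => energy ρ p (l b) (y b) (x b) := by
  unfold energy
  refine (Finset.measurable_sum _ fun i _ => ?_).const_mul _
  have h1 := hl.sub_const (ρ i)
  exact h1.mul (((hx.dotProduct' measurable_const).sub
    ((hy.dotProduct' measurable_const).div h1)).pow_const 2)

theorem Measurable.startPoint' (A : Matrix (Fin d) (Fin d) ℝ) {l : β → ℝ} {w : β → Fin d → ℝ}
    (hl : Measurable l) (hw : Measurable w) : Measurable fun b => startPoint A (l b) (w b) :=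
  ((hw.dotProduct' (hl.shift_mulVec A hw)).inv).smul_vec hw

variable (A : Matrix (Fin d) (Fin d) ℝ) (ρ₁ : ℝ)

theorem Measurable.sqrtSum' {l : β → ℝ} (hl : Measurable l) :
    Measurable fun b => sqrtSum A (l b) :=
  Finset.measurable_sum _ fun _ _ => (hl.sub_const _).sqrt

theorem Measurable.acdmTau' {l : β → ℝ} (hl : Measurable l) :
    Measurable fun b => acdmTau A ρ₁ (l b) := by
  unfold acdmTau
  have h1 := hl.sqrtSum' A
  exact (((((h1.mul h1).const_mul 4).div (hl.sub_const ρ₁)).add_const 1).sqrt.const_add 1).const_div 2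

theorem Measurable.acdmEta' {l : β → ℝ} (hl : Measurable l) :
    Measurable fun b => acdmEta A ρ₁ (l b) := by
  unfold acdmEta
  have h1 := hl.sqrtSum' A
  exact ((hl.acdmTau' A ρ₁).mul (h1.mul h1)).const_div 1

theorem Measurable.acdmMid' {l : β → ℝ} {s : β → (Fin d → ℝ) × (Fin d → ℝ)}
    (hl : Measurable l) (hs : Measurable s) :
    Measurable fun b => acdmMid A ρ₁ (l b) (s b) :=
  ((hl.acdmTau' A ρ₁).smul_vec hs.snd).add
    (((hl.acdmTau' A ρ₁).const_sub 1).smul_vec hs.fst)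

theorem Measurable.acdmNext_index {l : β → ℝ} {w : β → Fin d → ℝ}
    {s : β → (Fin d → ℝ) × (Fin d → ℝ)} (hl : Measurable l) (hw : Measurable w)
    (hs : Measurable s) (i : Fin d) :
    Measurable fun b => acdmNext A ρ₁ (l b) (w b) (s b) i := by
  have hη := hl.acdmEta' A ρ₁
  have hx := hl.acdmMid' A ρ₁ hs
  have hg : Measurable fun b => (l b • acdmMid A ρ₁ (l b) (s b) -
      A.mulVec (acdmMid A ρ₁ (l b) (s b)) - w b) i :=
    (measurable_pi_apply i).comp ((hl.shift_mulVec A hx).sub hw)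
  have hημ : Measurable fun b => acdmEta A ρ₁ (l b) * (l b - ρ₁) := hη.mul (hl.sub_const ρ₁)
  have hv : Measurable fun b => (s b).2 + (acdmEta A ρ₁ (l b) * (l b - ρ₁)) •
      acdmMid A ρ₁ (l b) (s b) := hs.snd.add (hημ.smul_vec hx)
  have hxi : Measurable fun b => acdmMid A ρ₁ (l b) (s b) i := (measurable_pi_apply i).comp hx
  have hvi := (measurable_pi_apply i).comp hv
  have hL : Measurable fun b => l b - A i i := hl.sub_const _
  have h1 := hx.update_const i (hxi.sub (hg.div hL))
  have h2 := ((hημ.const_add 1).inv).smul_vec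
    (hv.update_const i (hvi.sub ((hη.div (hL.sqrt.div (hl.sqrtSum' A))).mul hg)))
  exact h1.prodMk h2

/-- A countable discrete parameter may be frozen. It is applied to the sampled coordinate, the
stopping index and the counter of the chain. -/
theorem Measurable.comp_index {ι γ : Type*} [Countable ι] [MeasurableSpace ι]
    [MeasurableSingletonClass ι] [MeasurableSpace γ] {f : β → ι → γ} {i : β → ι}
    (hf : ∀ i, Measurable fun b => f b i) (hi : Measurable i) : Measurable fun b => f b (i b) := by
  have key : Measurable fun q : β × ι => f q.1 q.2 :=
    measurable_from_prod_countable_left hf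
  exact key.comp (measurable_id.prodMk hi)

theorem Measurable.acdmNext' {l : β → ℝ} {w : β → Fin d → ℝ}
    {s : β → (Fin d → ℝ) × (Fin d → ℝ)} {i : β → Fin d} (hl : Measurable l) (hw : Measurable w)
    (hs : Measurable s) (hi : Measurable i) :
    Measurable fun b => acdmNext A ρ₁ (l b) (w b) (s b) (i b) :=
  Measurable.comp_index (f := fun b i => acdmNext A ρ₁ (l b) (w b) (s b) i)
    (fun i => hl.acdmNext_index A ρ₁ hw hs i) hi

variable [NeZero d]

theorem Measurable.acdmIdx' {l : β → ℝ} {u : β → unitInterval} (hl : Measurable l)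
    (hu : Measurable u) : Measurable fun b => acdmIdx A (l b) (u b) :=
  measurable_sampleIndex (measurable_pi_iff.2 fun _ => (hl.sub_const _).sqrt) (hl.sqrtSum' A) hu

theorem Measurable.acdmPair' {l : β → ℝ} {w x₀ : β → Fin d → ℝ} {u : β → ℕ → unitInterval}
    (hl : Measurable l) (hw : Measurable w) (hx : Measurable x₀) (hu : Measurable u) (n : ℕ) :
    Measurable fun b => acdmPair A ρ₁ (l b) (w b) (x₀ b) (u b) n := by
  induction n with
  | zero => exact hx.prodMk hx
  | succ n ih =>
    exact hl.acdmNext' A ρ₁ hw ih (hl.acdmIdx' A ((measurable_pi_apply n).comp hu))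

theorem measurableSet_acdmExit (ρ : Fin d → ℝ) (p : Fin d → Fin d → ℝ) (R : ℝ) {l : β → ℝ}
    {w : β → Fin d → ℝ} {u : β → ℕ → unitInterval} (hl : Measurable l) (hw : Measurable w)
    (hu : Measurable u) (n : ℕ) :
    MeasurableSet {b | AcdmExit A ρ₁ ρ p R (l b) (w b) (u b) n} := by
  have h0 := hl.startPoint' A hw
  exact measurableSet_le (hl.energy' ρ p hw (hl.acdmPair' A ρ₁ hw h0 hu n).fst)
    ((hl.energy' ρ p hw h0).div_const R)

/-- The value `0` also arises as the infimum of the empty set, which accounts for the extra piece of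
the preimage. -/
theorem measurable_sInf_nat {P : β → ℕ → Prop} (hP : ∀ n, MeasurableSet {b | P b n}) :
    Measurable fun b => sInf {n | P b n} := by
  classical
  refine measurable_to_countable' fun k => ?_
  have : (fun b => sInf {n | P b n}) ⁻¹' {k} =
      ({b | P b k} ∩ ⋂ j ∈ Finset.range k, {b | P b j}ᶜ) ∪
        (if k = 0 then (⋂ j, {b | P b j}ᶜ) else ∅) := by
    ext b
    simp only [Set.mem_preimage, Set.mem_singleton_iff, Set.mem_union, Set.mem_inter_iff,
      Set.mem_ofPred_eq, Set.mem_iInter, Finset.mem_range, Set.mem_compl_iff]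
    by_cases hex : ∃ n, P b n
    · have h1 : sInf {n | P b n} = Nat.find hex := Nat.sInf_def hex
      rw [h1, Nat.find_eq_iff]
      constructor
      · exact fun h => Or.inl ⟨h.1, fun j hj => h.2 j hj⟩
      · rintro (h | h)
        · exact ⟨h.1, fun j hj => h.2 j hj⟩
        · split_ifs at h with hk
          · obtain ⟨n, hn⟩ := hex
            exact absurd hn ((Set.mem_iInter.1 h) n)
          · exact absurd h (Set.notMem_empty _)
    · have h1 : {n | P b n} = ∅ := Set.eq_empty_of_forall_notMem fun n hn => hex ⟨n, hn⟩
      rw [h1, Nat.sInf_empty]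
      constructor
      · intro h
        right
        rw [if_pos h.symm]
        exact Set.mem_iInter.2 fun j hj => hex ⟨j, hj⟩
      · rintro (h | h)
        · exact absurd ⟨k, h.1⟩ hex
        · split_ifs at h with hk
          · exact hk.symm
          · exact absurd h (Set.notMem_empty _)
  rw [this]
  refine ((hP k).inter (Finset.measurableSet_biInter _ fun j _ => (hP j).compl)).union ?_
  split_ifs
  · exact MeasurableSet.iInter fun j => (hP j).compl
  · exact MeasurableSet.empty

theorem Measurable.acdmSol' (ρ : Fin d → ℝ) (p : Fin d → Fin d → ℝ) (R : ℝ) {l : β → ℝ}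
    {w : β → Fin d → ℝ} {u : β → ℕ → unitInterval} (hl : Measurable l) (hw : Measurable w)
    (hu : Measurable u) : Measurable fun b => acdmSol A ρ₁ ρ p R (l b) (w b) (u b) := by
  have h0 := hl.startPoint' A hw
  exact Measurable.comp_index (f := fun b n => (acdmPair A ρ₁ (l b) (w b)
    (startPoint A (l b) (w b)) (u b) n).1) (fun n => (hl.acdmPair' A ρ₁ hw h0 hu n).fst)
    (measurable_sInf_nat fun n => measurableSet_acdmExit A ρ₁ ρ p R hl hw hu n)

open Classical in
theorem Measurable.acdmCount' (ρ : Fin d → ℝ) (p : Fin d → Fin d → ℝ) (R : ℝ) {l : β → ℝ}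
    {w : β → Fin d → ℝ} {u : β → ℕ → unitInterval} (hl : Measurable l) (hw : Measurable w)
    (hu : Measurable u) : Measurable fun b => acdmCount A ρ₁ ρ p R (l b) (w b) (u b) := by
  unfold acdmCount
  refine Measurable.tsum fun n => Measurable.ite ?_ measurable_const measurable_const
  have : {b | ∀ k ≤ n, ¬ AcdmExit A ρ₁ ρ p R (l b) (w b) (u b) k} =
      ⋂ k ∈ Finset.range (n + 1), {b | AcdmExit A ρ₁ ρ p R (l b) (w b) (u b) k}ᶜ := by
    ext b; simp
  rw [this]
  exact Finset.measurableSet_biInter _ fun k _ =>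
    (measurableSet_acdmExit A ρ₁ ρ p R hl hw hu k).compl

end measurability

/-! ### Expected number of steps of NU-ACDM -/

section expectation

variable {d : ℕ} [NeZero d] {A : Matrix (Fin d) (Fin d) ℝ} {ρ : Fin d → ℝ}
  {p : Fin d → Fin d → ℝ} {lam ρ₁ : ℝ}

theorem energy_le_acdmPotential (hμ : 0 < lam - ρ₁) (hS : 2 * (lam - ρ₁) ≤ sqrtSum A lam ^ 2)
    (hS0 : 0 < sqrtSum A lam) (b : Fin d → ℝ) (s : (Fin d → ℝ) × (Fin d → ℝ)) :
    energy ρ p lam b s.1 ≤ acdmPotential A ρ p ρ₁ lam b s := by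
  obtain ⟨hτ0, hτ1, -, -, -⟩ := acdm_parameters hμ hS hS0
  unfold acdmPotential
  have : 0 ≤ (lam - ρ₁) / (2 * (1 - acdmTau A ρ₁ lam)) *
      ((s.2 - shiftInv ρ p lam b) ⬝ᵥ (s.2 - shiftInv ρ p lam b)) :=
    mul_nonneg (div_nonneg hμ.le (by linarith)) (dotProduct_self_nonneg' _)
  linarith

theorem lintegral_acdm_step (h : EigenSystem A ρ p) (hμ : 0 < lam - ρ₁)
    (hle : ∀ i, lam - ρ₁ ≤ lam - ρ i) (hS : 2 * (lam - ρ₁) ≤ sqrtSum A lam ^ 2)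
    (hS0 : 0 < sqrtSum A lam) (b : Fin d → ℝ) (s : (Fin d → ℝ) × (Fin d → ℝ)) :
    ∫⁻ a : unitInterval, ENNReal.ofReal
        (acdmPotential A ρ p ρ₁ lam b (acdmNext A ρ₁ lam b s (acdmIdx A lam a))) ≤
      ENNReal.ofReal (1 - acdmTau A ρ₁ lam) *
        ENNReal.ofReal (acdmPotential A ρ p ρ₁ lam b s) := by
  obtain ⟨hτ0, hτ1, -, -, -⟩ := acdm_parameters hμ hS hS0
  have hlam : ∀ i, 0 < lam - ρ i := fun i => hμ.trans_le (hle i)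
  have hnn : ∀ s, 0 ≤ acdmPotential A ρ p ρ₁ lam b s := fun s =>
    (EigenSystem.energy_nonneg hlam _ _).trans (energy_le_acdmPotential hμ hS hS0 b s)
  have hidx : Measurable fun a : unitInterval => acdmIdx A lam a :=
    measurable_const.acdmIdx' A measurable_id
  rw [← lintegral_map (f := fun i => ENNReal.ofReal
    (acdmPotential A ρ p ρ₁ lam b (acdmNext A ρ₁ lam b s i))) (measurable_of_countable _) hidx,
    lintegral_fintype]
  have h1 : ∀ i, (volume.map fun a : unitInterval => acdmIdx A lam a) {i} ≤
      ENNReal.ofReal (Real.sqrt (lam - A i i) / sqrtSum A lam) := by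
    intro i
    rw [Measure.map_apply hidx (measurableSet_singleton i)]
    exact volume_sampleIndex_le (fun i => Real.sqrt (lam - A i i)) hS0 i
  calc _ ≤ ∑ i, ENNReal.ofReal (Real.sqrt (lam - A i i) / sqrtSum A lam *
        acdmPotential A ρ p ρ₁ lam b (acdmNext A ρ₁ lam b s i)) := by
        refine Finset.sum_le_sum fun i _ => ?_
        rw [ENNReal.ofReal_mul (by positivity), mul_comm]
        gcongr
        exact h1 i
    _ = ENNReal.ofReal (∑ i, Real.sqrt (lam - A i i) / sqrtSum A lam *
        acdmPotential A ρ p ρ₁ lam b (acdmNext A ρ₁ lam b s i)) :=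
      (ENNReal.ofReal_sum_of_nonneg fun i _ => mul_nonneg (by positivity) (hnn _)).symm
    _ ≤ ENNReal.ofReal ((1 - acdmTau A ρ₁ lam) * acdmPotential A ρ p ρ₁ lam b s) :=
      ENNReal.ofReal_le_ofReal (acdm_contraction h hμ hle hS hS0 b s)
    _ = _ := ENNReal.ofReal_mul (by linarith)

/-- The first `n` steps read only the random numbers with index below `n`; this is the independence
that `lintegral_next` asks for. -/
theorem acdmPair_update (b x₀ : Fin d → ℝ) (u : ℕ → unitInterval) (n : ℕ) (a : unitInterval)
    {k : ℕ} (hk : k ≤ n) :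
    acdmPair A ρ₁ lam b x₀ (Function.update u n a) k = acdmPair A ρ₁ lam b x₀ u k := by
  induction k with
  | zero => rfl
  | succ k ih =>
    rw [acdmPair, acdmPair, ih (by omega), Function.update_of_ne (by omega)]

theorem lintegral_acdmPotential (h : EigenSystem A ρ p) (hμ : 0 < lam - ρ₁)
    (hle : ∀ i, lam - ρ₁ ≤ lam - ρ i) (hS : 2 * (lam - ρ₁) ≤ sqrtSum A lam ^ 2)
    (hS0 : 0 < sqrtSum A lam) (b x₀ : Fin d → ℝ) (n : ℕ) :
    ∫⁻ u, ENNReal.ofReal (acdmPotential A ρ p ρ₁ lam b (acdmPair A ρ₁ lam b x₀ u n))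
        ∂(Measure.infinitePi fun _ : ℕ => (volume : Measure unitInterval)) ≤
      ENNReal.ofReal (1 - acdmTau A ρ₁ lam) ^ n * ENNReal.ofReal (3 * energy ρ p lam b x₀) := by
  induction n with
  | zero =>
    simp only [acdmPair, lintegral_const, measure_univ, mul_one, pow_zero, one_mul]
    exact ENNReal.ofReal_le_ofReal (acdmPotential_start h hμ hle hS hS0 b x₀)
  | succ n ih =>
    have hpot : Measurable fun s : (Fin d → ℝ) × (Fin d → ℝ) =>
        ENNReal.ofReal (acdmPotential A ρ p ρ₁ lam b s) := by
      have h1 : Measurable fun s : (Fin d → ℝ) × (Fin d → ℝ) => s.2 - shiftInv ρ p lam b :=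
        measurable_snd.sub_const _
      exact ENNReal.measurable_ofReal.comp
        ((Measurable.energy' ρ p measurable_const measurable_const measurable_fst).add
          ((h1.dotProduct' h1).const_mul _))
    have hnext := lintegral_next (volume : Measure unitInterval) n
      (X := fun u => acdmPair A ρ₁ lam b x₀ u n)
      (F := fun s a => ENNReal.ofReal
        (acdmPotential A ρ p ρ₁ lam b (acdmNext A ρ₁ lam b s (acdmIdx A lam a))))
      (measurable_const.acdmPair' A ρ₁ measurable_const measurable_const measurable_id n)
      (fun u a => acdmPair_update b x₀ u n a le_rfl)
      (hpot.comp (measurable_const.acdmNext' A ρ₁ measurable_const measurable_fst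
        (measurable_const.acdmIdx' A measurable_snd)))
    simp only [acdmPair]
    rw [hnext]
    calc _ ≤ ∫⁻ u, ENNReal.ofReal (1 - acdmTau A ρ₁ lam) * ENNReal.ofReal
            (acdmPotential A ρ p ρ₁ lam b (acdmPair A ρ₁ lam b x₀ u n))
            ∂(Measure.infinitePi fun _ : ℕ => (volume : Measure unitInterval)) :=
          lintegral_mono fun u => lintegral_acdm_step h hμ hle hS hS0 b _
      _ = ENNReal.ofReal (1 - acdmTau A ρ₁ lam) * ∫⁻ u, ENNReal.ofReal
            (acdmPotential A ρ p ρ₁ lam b (acdmPair A ρ₁ lam b x₀ u n))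
            ∂(Measure.infinitePi fun _ : ℕ => (volume : Measure unitInterval)) :=
          lintegral_const_mul' _ _ ENNReal.ofReal_ne_top
      _ ≤ ENNReal.ofReal (1 - acdmTau A ρ₁ lam) * (ENNReal.ofReal (1 - acdmTau A ρ₁ lam) ^ n *
            ENNReal.ofReal (3 * energy ρ p lam b x₀)) := by gcongr
      _ = _ := by rw [pow_succ', mul_assoc]

/-- Probability that the solver needs more than `n` steps. -/
theorem prob_not_exit_le (h : EigenSystem A ρ p) (hμ : 0 < lam - ρ₁)
    (hle : ∀ i, lam - ρ₁ ≤ lam - ρ i) (hS : 2 * (lam - ρ₁) ≤ sqrtSum A lam ^ 2)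
    (hS0 : 0 < sqrtSum A lam) (w : Fin d → ℝ) {R : ℝ} (hR : 0 < R) (n : ℕ) :
    (Measure.infinitePi fun _ : ℕ => (volume : Measure unitInterval))
      {u | ∀ k ≤ n, ¬ AcdmExit A ρ₁ ρ p R lam w u k} ≤
        ENNReal.ofReal (3 * R * (1 - acdmTau A ρ₁ lam) ^ n) := by
  obtain ⟨hτ0, hτ1, -, -, -⟩ := acdm_parameters hμ hS hS0
  have hlam : ∀ i, 0 < lam - ρ i := fun i => hμ.trans_le (hle i)
  set x₀ := startPoint A lam w with hx₀
  have hE0 : 0 ≤ energy ρ p lam w x₀ := EigenSystem.energy_nonneg hlam _ _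
  -- Markov's inequality needs a positive threshold; if the initial energy vanishes, the test
  -- succeeds at once.
  rcases hE0.eq_or_lt with hE | hE
  · have : {u | ∀ k ≤ n, ¬ AcdmExit A ρ₁ ρ p R lam w u k} = ∅ := by
      refine Set.eq_empty_of_forall_notMem fun u hu => hu 0 (Nat.zero_le n) ?_
      simp only [AcdmExit, acdmPair, ← hx₀, ← hE, zero_div, le_refl]
    rw [this, measure_empty]; exact zero_le
  have hthr : ENNReal.ofReal (energy ρ p lam w x₀ / R) ≠ 0 := by
    rw [Ne, ENNReal.ofReal_eq_zero, not_le]; positivity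
  have hpotm : Measurable fun u : ℕ → unitInterval => ENNReal.ofReal
      (energy ρ p lam w (acdmPair A ρ₁ lam w x₀ u n).1) :=
    ENNReal.measurable_ofReal.comp (Measurable.energy' ρ p measurable_const measurable_const
      (measurable_const.acdmPair' A ρ₁ measurable_const measurable_const measurable_id n).fst)
  calc _ ≤ (Measure.infinitePi fun _ : ℕ => (volume : Measure unitInterval))
        {u | ENNReal.ofReal (energy ρ p lam w x₀ / R) ≤
          ENNReal.ofReal (energy ρ p lam w (acdmPair A ρ₁ lam w x₀ u n).1)} :=
        measure_mono fun u (hu : ∀ k ≤ n, ¬ AcdmExit A ρ₁ ρ p R lam w u k) =>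
          ENNReal.ofReal_le_ofReal (not_le.1 (hu n le_rfl)).le
    _ ≤ (∫⁻ u, ENNReal.ofReal (energy ρ p lam w (acdmPair A ρ₁ lam w x₀ u n).1)
        ∂(Measure.infinitePi fun _ : ℕ => (volume : Measure unitInterval))) /
          ENNReal.ofReal (energy ρ p lam w x₀ / R) :=
        meas_ge_le_lintegral_div hpotm.aemeasurable hthr ENNReal.ofReal_ne_top
    _ ≤ (ENNReal.ofReal (1 - acdmTau A ρ₁ lam) ^ n *
          ENNReal.ofReal (3 * energy ρ p lam w x₀)) /
          ENNReal.ofReal (energy ρ p lam w x₀ / R) := by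
        gcongr
        exact (lintegral_mono fun u => ENNReal.ofReal_le_ofReal
          (energy_le_acdmPotential hμ hS hS0 w _)).trans
          (lintegral_acdmPotential h hμ hle hS hS0 w x₀ n)
    _ = _ := by
        rw [← ENNReal.ofReal_pow (by linarith), ← ENNReal.ofReal_mul (pow_nonneg (by linarith) n),
          ← ENNReal.ofReal_div_of_pos (by positivity)]
        congr 1
        field_simp

/-- A tail sum bound: `n₀` initial terms and a geometric tail. -/
theorem tsum_le_of_geometric {f : ℕ → ENNReal} (hf : ∀ n, f n ≤ 1) {τ : ℝ} (hτ0 : 0 < τ)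
    (hτ1 : τ ≤ 1) (n₀ : ℕ) (htail : ∀ n, f (n + n₀) ≤ ENNReal.ofReal ((1 - τ) ^ n)) :
    ∑' n, f n ≤ ENNReal.ofReal (n₀ + 1 / τ) := by
  rw [← Summable.sum_add_tsum_nat_add' (f := f) (k := n₀) ENNReal.summable]
  have h3 : ∑ n ∈ Finset.range n₀, f n ≤ ENNReal.ofReal n₀ := by
    calc _ ≤ ∑ n ∈ Finset.range n₀, (1 : ENNReal) := Finset.sum_le_sum fun n _ => hf n
      _ = _ := by simp
  have h4 : ∑' n, f (n + n₀) ≤ ENNReal.ofReal (1 / τ) := by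
    refine (ENNReal.tsum_le_tsum htail).trans (le_of_eq ?_)
    rw [← ENNReal.ofReal_tsum_of_nonneg (fun n => pow_nonneg (by linarith) n)
      (summable_geometric_of_lt_one (by linarith) (by linarith)),
      tsum_geometric_of_lt_one (by linarith) (by linarith)]
    congr 1
    rw [sub_sub_cancel, one_div]
  refine (add_le_add h3 h4).trans (le_of_eq ?_)
  rw [← ENNReal.ofReal_add (Nat.cast_nonneg _) (by positivity)]

/-- The count is a sum of indicators of the events of not having stopped, so Tonelli gives the tail
sum formula. -/
theorem lintegral_acdmCount_eq (w : Fin d → ℝ) (R : ℝ) :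
    ∫⁻ u, acdmCount A ρ₁ ρ p R lam w u
        ∂(Measure.infinitePi fun _ : ℕ => (volume : Measure unitInterval)) =
      ∑' n, (Measure.infinitePi fun _ : ℕ => (volume : Measure unitInterval))
        {u | ∀ k ≤ n, ¬ AcdmExit A ρ₁ ρ p R lam w u k} := by
  classical
  have hEm : ∀ n, MeasurableSet {u | ∀ k ≤ n, ¬ AcdmExit A ρ₁ ρ p R lam w u k} := fun n => by
    have : {u | ∀ k ≤ n, ¬ AcdmExit A ρ₁ ρ p R lam w u k} =
        ⋂ k ∈ Finset.range (n + 1), {u | AcdmExit A ρ₁ ρ p R lam w u k}ᶜ := by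
      ext u; simp
    rw [this]
    exact Finset.measurableSet_biInter _ fun k _ =>
      (measurableSet_acdmExit A ρ₁ ρ p R measurable_const measurable_const measurable_id k).compl
  unfold acdmCount
  rw [lintegral_tsum]
  · refine tsum_congr fun n => ?_
    rw [← lintegral_indicator_one (hEm n)]
    refine lintegral_congr fun u => ?_
    simp only [Set.indicator_apply, Set.mem_ofPred_eq, Pi.one_apply]
  · exact fun n => (Measurable.ite (hEm n) measurable_const measurable_const).aemeasurable

/-- The expected number of steps of NU-ACDM. -/
theorem lintegral_acdmCount_le (h : EigenSystem A ρ p) (hμ : 0 < lam - ρ₁)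
    (hle : ∀ i, lam - ρ₁ ≤ lam - ρ i) (hS : 2 * (lam - ρ₁) ≤ sqrtSum A lam ^ 2)
    (hS0 : 0 < sqrtSum A lam) (w : Fin d → ℝ) {R : ℝ} (hR : 1 ≤ R) :
    ∫⁻ u, acdmCount A ρ₁ ρ p R lam w u
        ∂(Measure.infinitePi fun _ : ℕ => (volume : Measure unitInterval)) ≤
      ENNReal.ofReal ((Real.log (3 * R) + 2) * (1 + sqrtSum A lam / Real.sqrt (lam - ρ₁))) := by
  obtain ⟨hτ0, hτ1, -, -, hτinv⟩ := acdm_parameters hμ hS hS0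
  have hexit := prob_not_exit_le h hμ hle hS hS0 w (R := R) (by linarith)
  rw [lintegral_acdmCount_eq]
  generalize acdmTau A ρ₁ lam = τ at *
  have hlog : 0 ≤ Real.log (3 * R) := Real.log_nonneg (by linarith)
  -- From this index on the tail bound `3 * R * (1 - τ) ^ n` is at most `1`, and it decays
  -- geometrically.
  have hpow : (1 - τ) ^ ⌈Real.log (3 * R) / τ⌉₊ ≤ 1 / (3 * R) :=
    one_sub_pow_le_inv hτ0 (by linarith) (by positivity) (Nat.le_ceil _)
  refine (tsum_le_of_geometric (fun n => prob_le_one) hτ0 (by linarith)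
    ⌈Real.log (3 * R) / τ⌉₊ fun n => ?_).trans ?_
  · refine (hexit (n + _)).trans ?_
    refine ENNReal.ofReal_le_ofReal ?_
    rw [pow_add]
    have h2 : 0 ≤ (1 - τ) ^ n := pow_nonneg (by linarith) n
    calc _ ≤ 3 * R * ((1 - τ) ^ n * (1 / (3 * R))) := by gcongr
      _ = (1 - τ) ^ n := by field_simp
  refine ENNReal.ofReal_le_ofReal ?_
  have h5 : (⌈Real.log (3 * R) / τ⌉₊ : ℝ) ≤ Real.log (3 * R) / τ + 1 :=
    (Nat.ceil_lt_add_one (by positivity)).le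
  have h6 : 1 ≤ 1 / τ := by rw [le_div_iff₀ hτ0]; linarith
  calc (⌈Real.log (3 * R) / τ⌉₊ : ℝ) + 1 / τ ≤ (Real.log (3 * R) + 2) * (1 / τ) := by
        have : Real.log (3 * R) / τ = Real.log (3 * R) * (1 / τ) := by ring
        linarith
    _ ≤ _ := mul_le_mul_of_nonneg_left hτinv (by linarith)

end expectation

/-! ### Measurability of the run, and the expected number of solver iterations -/

section run

variable {d : ℕ} [NeZero d] {β : Type*} [MeasurableSpace β] (ρ : Fin d → ℝ)
  {sol : ℝ → ℝ → (Fin d → ℝ) → (ℕ → unitInterval) → Fin d → ℝ}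
  {cnt : ℝ → ℝ → (Fin d → ℝ) → (ℕ → unitInterval) → ENNReal} (c₂ Δt : ℝ)

/-- Measurability of a function of the shift, the vector and the random numbers. -/
def SolverMeasurable {γ : Type*} [MeasurableSpace γ]
    (f : ℝ → ℝ → (Fin d → ℝ) → (ℕ → unitInterval) → γ) : Prop :=
  ∀ R, Measurable fun q : (ℝ × (Fin d → ℝ)) × (ℕ → unitInterval) => f R q.1.1 q.1.2 q.2

theorem SolverMeasurable.comp {γ : Type*} [MeasurableSpace γ]
    {f : ℝ → ℝ → (Fin d → ℝ) → (ℕ → unitInterval) → γ} (hf : SolverMeasurable f) (R : ℝ)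
    {l : β → ℝ} {w : β → Fin d → ℝ} {u : β → ℕ → unitInterval} (hl : Measurable l)
    (hw : Measurable w) (hu : Measurable u) : Measurable fun b => f R (l b) (w b) (u b) :=
  (hf R).comp ((hl.prodMk hw).prodMk hu)

theorem measurableSet_admissible (lo : ℝ) {l : β → ℝ} {w : β → Fin d → ℝ} (hl : Measurable l)
    (hw : Measurable w) : MeasurableSet {b | Admissible ρ lo (l b) (w b)} :=
  (measurableSet_eq_fun (hw.dotProduct' hw) measurable_const).inter
    ((measurableSet_le measurable_const (hl.sub_const _)).inter
      (measurableSet_le hl measurable_const))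

theorem Measurable.gapEstimate' {w x : β → Fin d → ℝ} (hw : Measurable w) (hx : Measurable x) :
    Measurable fun b => gapEstimate c₂ Δt (w b) (x b) := by
  unfold gapEstimate
  exact (((hw.dotProduct' hx).sub_const _).const_div 1).const_mul _

theorem Measurable.flatUpdate' (m c : ℕ) {w x : β → Fin d → ℝ} {l : β → ℝ} (hw : Measurable w)
    (hl : Measurable l) (hx : Measurable x) :
    Measurable fun b => flatUpdate c₂ Δt m (w b, l b, c) (x b) := by
  have hg := hw.gapEstimate' c₂ Δt hx
  unfold flatUpdate
  by_cases hc : c = m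
  · simp only [hc, if_true]
    exact hw.prodMk ((hl.sub (hg.div_const 2)).prodMk
      (Measurable.ite (measurableSet_le hg measurable_const) measurable_const measurable_const))
  · simp only [hc, if_false]
    exact ((hx.dotProduct' hx).sqrt.inv.smul_vec hx).prodMk (hl.prodMk measurable_const)

-- Fixing the counter also fixes the accuracy ratio, so the solver need not be jointly measurable in
-- `R`.
open Classical in
theorem Measurable.flatStep' (hsol : SolverMeasurable sol) (m : ℕ) {s : β → FlatState d}
    {u : β → ℕ → unitInterval} (hs : Measurable s) (hu : Measurable u) :
    Measurable fun b => flatStep ρ sol c₂ Δt m (s b) (u b) := by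
  have hw : Measurable fun b => (s b).1 := hs.fst
  have hl : Measurable fun b => (s b).2.1 := hs.snd.fst
  refine Measurable.comp_index
    (f := fun b c => flatStep ρ sol c₂ Δt m ((s b).1, (s b).2.1, c) (u b)) (fun c => ?_) hs.snd.snd
  unfold flatStep
  exact Measurable.ite (measurableSet_admissible ρ _ hl hw)
    (hw.flatUpdate' c₂ Δt m c hl (hsol.comp (flatRatio Δt m c) hl hw hu)) (hw.prodMk (hl.prodMk measurable_const))

open Classical in
theorem Measurable.flatCount' (hcnt : SolverMeasurable cnt) (m : ℕ) {s : β → FlatState d}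
    {u : β → ℕ → unitInterval} (hs : Measurable s) (hu : Measurable u) :
    Measurable fun b => flatCount ρ cnt Δt m (s b) (u b) := by
  have hw : Measurable fun b => (s b).1 := hs.fst
  have hl : Measurable fun b => (s b).2.1 := hs.snd.fst
  refine Measurable.comp_index
    (f := fun b c => flatCount ρ cnt Δt m ((s b).1, (s b).2.1, c) (u b)) (fun c => ?_) hs.snd.snd
  unfold flatCount
  exact Measurable.ite (measurableSet_admissible ρ _ hl hw) (hcnt.comp (flatRatio Δt m c) hl hw hu) measurable_const

theorem Measurable.flatRun' (hsol : SolverMeasurable sol) (m : ℕ) {s : β → FlatState d}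
    {u : β → ℕ → ℕ → unitInterval} (hs : Measurable s) (hu : Measurable u) (k : ℕ) :
    Measurable fun b => flatRun ρ sol c₂ Δt m (s b) (u b) k := by
  induction k with
  | zero => exact hs
  | succ k ih => exact ih.flatStep' ρ c₂ Δt hsol m ((measurable_pi_apply k).comp hu)

theorem flatRun_update (m : ℕ) (s : FlatState d) (u : ℕ → ℕ → unitInterval) (n : ℕ)
    (a : ℕ → unitInterval) {k : ℕ} (hk : k ≤ n) :
    flatRun ρ sol c₂ Δt m s (Function.update u n a) k = flatRun ρ sol c₂ Δt m s u k := by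
  induction k with
  | zero => rfl
  | succ k ih => rw [flatRun, flatRun, ih (by omega), Function.update_of_ne (by omega)]

open Classical in
/-- The number of solver iterations in the first `N` states whose counter satisfies `P`. -/
noncomputable def countWhere (cnt : ℝ → ℝ → (Fin d → ℝ) → (ℕ → unitInterval) → ENNReal) (m : ℕ)
    (P : ℕ → Prop) (X : ℕ → FlatState d) (u : ℕ → ℕ → unitInterval) (N : ℕ) : ENNReal :=
  ∑ k ∈ Finset.range N, if P (X k).2.2 then flatCount ρ cnt Δt m (X k) (u k) else 0

open Classical in
theorem Measurable.countWhere' (hsol : SolverMeasurable sol) (hcnt : SolverMeasurable cnt) (m : ℕ)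
    (P : ℕ → Prop) {s : β → FlatState d} {u : β → ℕ → ℕ → unitInterval} (hs : Measurable s)
    (hu : Measurable u) (N : ℕ) :
    Measurable fun b =>
      countWhere ρ Δt cnt m P (flatRun ρ sol c₂ Δt m (s b) (u b)) (u b) N := by
  unfold countWhere
  refine Finset.measurable_sum _ fun k _ => ?_
  have hX := hs.flatRun' ρ c₂ Δt hsol m hu k
  refine Measurable.ite ?_ (hX.flatCount' ρ Δt hcnt m ((measurable_pi_apply k).comp hu))
    measurable_const
  exact hX.snd.snd (MeasurableSet.of_discrete (s := {c | P c}))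

/-- Law of the random numbers of one least squares problem. -/
noncomputable abbrev rowLaw : Measure (ℕ → unitInterval) :=
  Measure.infinitePi fun _ : ℕ => (volume : Measure unitInterval)

variable {lo B : ℝ}

open Classical in
/-- The expected number of solver iterations in state `k`. -/
theorem lintegral_flatCount_le (hsol : SolverMeasurable sol) (hcnt : SolverMeasurable cnt) (m : ℕ)
    (P : ℕ → Prop) {B : ENNReal}
    (hB : ∀ c, P c → ∀ lam w, Admissible ρ (9 / 20 * Δt) lam w →
      ∫⁻ a, cnt (flatRatio Δt m c) lam w a ∂rowLaw ≤ B) (s : FlatState d) (k : ℕ) :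
    ∫⁻ u, (if P (flatRun ρ sol c₂ Δt m s u k).2.2 then
        flatCount ρ cnt Δt m (flatRun ρ sol c₂ Δt m s u k) (u k) else 0)
        ∂(Measure.infinitePi fun _ : ℕ => rowLaw) ≤
      ∫⁻ u, (if P (flatRun ρ sol c₂ Δt m s u k).2.2 ∧ Admissible ρ (9 / 20 * Δt)
          (flatRun ρ sol c₂ Δt m s u k).2.1 (flatRun ρ sol c₂ Δt m s u k).1 then B else 0)
        ∂(Measure.infinitePi fun _ : ℕ => rowLaw) := by
  have hX : Measurable fun u => flatRun ρ sol c₂ Δt m s u k :=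
    measurable_const.flatRun' ρ c₂ Δt hsol m measurable_id k
  have hF : Measurable (Function.uncurry fun (x : FlatState d) (a : ℕ → unitInterval) =>
      if P x.2.2 then flatCount ρ cnt Δt m x a else 0) := by
    refine Measurable.ite ?_ (measurable_fst.flatCount' ρ Δt hcnt m measurable_snd)
      measurable_const
    exact measurable_fst.snd.snd (MeasurableSet.of_discrete (s := {c | P c}))
  refine (lintegral_next rowLaw k hX (fun u a => flatRun_update ρ c₂ Δt m s u k a le_rfl)
    hF).le.trans ?_
  refine lintegral_mono fun u => ?_
  generalize flatRun ρ sol c₂ Δt m s u k = x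
  by_cases hP : P x.2.2
  · by_cases hA : Admissible ρ (9 / 20 * Δt) x.2.1 x.1
    · simp only [hP, hA, and_self, if_true, flatCount]
      exact hB _ hP _ _ hA
    · simp [hP, hA, flatCount]
  · simp [hP]

-- Which positions contribute is random, but their number is at most `T` on every path. Moving the
-- sum inside the integral allows this pathwise count to be used.
open Classical in
theorem lintegral_countWhere_le (hsol : SolverMeasurable sol) (hcnt : SolverMeasurable cnt) (m : ℕ)
    (P : ℕ → Prop) {B : ENNReal}
    (hB : ∀ c, P c → ∀ lam w, Admissible ρ (9 / 20 * Δt) lam w →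
      ∫⁻ a, cnt (flatRatio Δt m c) lam w a ∂rowLaw ≤ B) (s : FlatState d) {N T : ℕ}
    (hT : ∀ u, ((Finset.range N).filter fun k => P (flatRun ρ sol c₂ Δt m s u k).2.2 ∧
      Admissible ρ (9 / 20 * Δt) (flatRun ρ sol c₂ Δt m s u k).2.1
        (flatRun ρ sol c₂ Δt m s u k).1).card ≤ T) :
    ∫⁻ u, countWhere ρ Δt cnt m P (flatRun ρ sol c₂ Δt m s u) u N
        ∂(Measure.infinitePi fun _ : ℕ => rowLaw) ≤ T * B := by
  have hX : ∀ k, Measurable fun u => flatRun ρ sol c₂ Δt m s u k := fun k =>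
    measurable_const.flatRun' ρ c₂ Δt hsol m measurable_id k
  have hPm : ∀ k, MeasurableSet {u | P (flatRun ρ sol c₂ Δt m s u k).2.2} := fun k =>
    (hX k).snd.snd (MeasurableSet.of_discrete (s := {c | P c}))
  have hAm : ∀ k, MeasurableSet {u | Admissible ρ (9 / 20 * Δt) (flatRun ρ sol c₂ Δt m s u k).2.1
      (flatRun ρ sol c₂ Δt m s u k).1} := fun k =>
    measurableSet_admissible ρ _ (hX k).snd.fst (hX k).fst
  unfold countWhere
  rw [lintegral_finsetSum _ fun k _ => Measurable.ite (hPm k)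
    ((hX k).flatCount' ρ Δt hcnt m (measurable_pi_apply k)) measurable_const]
  refine (Finset.sum_le_sum fun k _ =>
    lintegral_flatCount_le ρ c₂ Δt hsol hcnt m P hB s k).trans ?_
  have hPA : ∀ k, MeasurableSet {u | P (flatRun ρ sol c₂ Δt m s u k).2.2 ∧
      Admissible ρ (9 / 20 * Δt) (flatRun ρ sol c₂ Δt m s u k).2.1
        (flatRun ρ sol c₂ Δt m s u k).1} := fun k => (hPm k).inter (hAm k)
  calc _ = _ := (lintegral_finsetSum _ fun k _ =>
        Measurable.ite (hPA k) measurable_const measurable_const).symm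
    _ ≤ ∫⁻ _, (T : ENNReal) * B ∂(Measure.infinitePi fun _ : ℕ => rowLaw) := by
        refine lintegral_mono fun u => ?_
        rw [← Finset.sum_filter, Finset.sum_const, nsmul_eq_mul]
        gcongr
        exact hT u
    _ = _ := by simp

/-- Beyond `m` an admissible transition raises the counter by one and a frozen state keeps it, so
admissible Phase II states have distinct counters. -/
theorem flatRun_counter_lt (m : ℕ) (s : FlatState d) (u : ℕ → ℕ → unitInterval) {j : ℕ}
    (hj : m < (flatRun ρ sol c₂ Δt m s u j).2.2)
    (hA : Admissible ρ (9 / 20 * Δt) (flatRun ρ sol c₂ Δt m s u j).2.1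
      (flatRun ρ sol c₂ Δt m s u j).1) (i : ℕ) :
    (flatRun ρ sol c₂ Δt m s u j).2.2 < (flatRun ρ sol c₂ Δt m s u (j + 1 + i)).2.2 := by
  induction i with
  | zero =>
    rw [add_zero, flatRun, flatStep_of_admissible hA, flatUpdate, if_neg hj.ne']
    exact Nat.lt_succ_self _
  | succ i ih =>
    refine ih.trans_le ?_
    change _ ≤ (flatStep ρ sol c₂ Δt m (flatRun ρ sol c₂ Δt m s u (j + 1 + i))
      (u (j + 1 + i))).2.2
    generalize flatRun ρ sol c₂ Δt m s u (j + 1 + i) = x at *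
    unfold flatStep
    split_ifs
    · rw [flatUpdate, if_neg (by omega)]
      exact Nat.le_succ _
    · exact le_rfl

open Classical in
/-- Phase II states with at most `M` different values of the counter. -/
theorem card_phaseTwo_le (m M N : ℕ) (s : FlatState d) (u : ℕ → ℕ → unitInterval) :
    ((Finset.range N).filter fun k => (m < (flatRun ρ sol c₂ Δt m s u k).2.2 ∧
      (flatRun ρ sol c₂ Δt m s u k).2.2 ≤ m + M) ∧
      Admissible ρ (9 / 20 * Δt) (flatRun ρ sol c₂ Δt m s u k).2.1
        (flatRun ρ sol c₂ Δt m s u k).1).card ≤ M := by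
  have key : ∀ j k, j < k → m < (flatRun ρ sol c₂ Δt m s u j).2.2 →
      Admissible ρ (9 / 20 * Δt) (flatRun ρ sol c₂ Δt m s u j).2.1
        (flatRun ρ sol c₂ Δt m s u j).1 →
      (flatRun ρ sol c₂ Δt m s u j).2.2 < (flatRun ρ sol c₂ Δt m s u k).2.2 := by
    intro j k hjk h1 h2
    have := flatRun_counter_lt ρ c₂ Δt m s u h1 h2 (k - (j + 1))
    rwa [show j + 1 + (k - (j + 1)) = k by omega] at this
  have := Finset.card_le_card_of_injOn (s := (Finset.range N).filter fun k =>
      (m < (flatRun ρ sol c₂ Δt m s u k).2.2 ∧ (flatRun ρ sol c₂ Δt m s u k).2.2 ≤ m + M) ∧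
      Admissible ρ (9 / 20 * Δt) (flatRun ρ sol c₂ Δt m s u k).2.1
        (flatRun ρ sol c₂ Δt m s u k).1) (t := Finset.Ioc m (m + M))
    (fun k => (flatRun ρ sol c₂ Δt m s u k).2.2) (fun k hk => by
      have := (Finset.mem_filter.1 hk).2.1
      exact Finset.mem_coe.2 (Finset.mem_Ioc.2 this)) (by
      intro j hj k hk hjk
      have h1 := (Finset.mem_filter.1 hj).2
      have h2 := (Finset.mem_filter.1 hk).2
      simp only at hjk
      rcases lt_trichotomy j k with h | h | h
      · exact absurd hjk (key j k h h1.1.1 h1.2).ne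
      · exact h
      · exact absurd hjk (key k j h h2.1.1 h2.2).ne')
  simpa using this

end run

/-- Currying turns the tape into independent rows, one per least squares problem; a whole row then
plays the role of a single coordinate in `lintegral_next`. -/
theorem measurePreserving_rows :
    MeasurePreserving (fun (t : ℕ × ℕ → unitInterval) k j => t (k, j))
      (Measure.infinitePi fun _ : ℕ × ℕ => (volume : Measure unitInterval))
      (Measure.infinitePi fun _ : ℕ => rowLaw) := by
  refine ⟨?_, ?_⟩
  · exact measurable_pi_iff.2 fun k => measurable_pi_iff.2 fun j => measurable_pi_apply _
  · exact Measure.infinitePi_map_curry fun _ _ : ℕ => (volume : Measure unitInterval)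

/-! ### A random unit vector is not nearly orthogonal to a given one -/

section sphere

variable {d : ℕ}

open scoped Pointwise

/-- Bernoulli's inequality. It keeps the volume lost by shrinking with the factor `1 - 1 / (2 * d)`
below one half. -/
theorem half_le_pow (hd : 0 < d) : (1 / 2 : ℝ) ≤ (1 - 1 / (2 * d)) ^ d := by
  have hpos : (1 : ℝ) ≤ d := by exact_mod_cast hd
  have h1 : (1 / (2 * d) : ℝ) ≤ 1 / 2 := by gcongr; linarith
  have h2 := one_add_mul_le_pow (a := -(1 / (2 * d) : ℝ)) (by linarith) d
  have h3 : (d : ℝ) * (1 / (2 * d)) = 1 / 2 := by field_simp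
  rw [← sub_eq_add_neg] at h2
  linarith

/-- The part of the unit ball close to the hyperplane orthogonal to `v`. -/
def ballSlab (v : Fin d → ℝ) (t : ℝ) : Set (EuclideanSpace ℝ (Fin d)) :=
  {x | ‖x‖ < 1 ∧ |x.ofLp ⬝ᵥ v| ≤ t}

theorem measurableSet_ballSlab (v : Fin d → ℝ) (t : ℝ) : MeasurableSet (ballSlab v t) := by
  refine (measurableSet_lt measurable_norm measurable_const).inter ?_
  have : Continuous fun x : EuclideanSpace ℝ (Fin d) => |x.ofLp ⬝ᵥ v| := by
    unfold dotProduct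
    fun_prop
  exact measurableSet_le this.measurable measurable_const

/-- A packing argument: `N` disjoint translates of a slightly shrunken slab fit into the unit ball,
and each keeps at least half of the slab's volume. -/
theorem volume_ballSlab_le (hd : 2 ≤ d) {v : Fin d → ℝ} (hv : v ⬝ᵥ v = 1) {N : ℕ} (hN : 0 < N) :
    N * volume (ballSlab v (1 / (4 * d * N))) ≤
      2 * volume (Metric.ball (0 : EuclideanSpace ℝ (Fin d)) 1) := by
  set t : ℝ := 1 / (4 * d * N) with ht
  have hd0 : (0 : ℝ) < d := by positivity
  have hN0 : (0 : ℝ) < N := by positivity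
  have ht0 : 0 < t := by positivity
  set r : ℝ := 1 - 1 / (2 * d) with hr
  have hd1 : (1 : ℝ) / (2 * d) ≤ 1 / 2 := by
    gcongr
    have : (2 : ℝ) ≤ d := by exact_mod_cast hd
    linarith
  have hr0 : 0 < r := by linarith
  have hr1 : r < 1 := by
    have : (0 : ℝ) < 1 / (2 * d) := by positivity
    linarith
  set q : EuclideanSpace ℝ (Fin d) := WithLp.toLp 2 v with hq
  have hqn : ‖q‖ = 1 := by
    rw [EuclideanSpace.norm_eq, Real.sqrt_eq_one, ← hv]
    simp [hq, dotProduct, sq]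
  -- The slab is shrunk by `r < 1` and shifted by `2 * j * t` along `v`. The heights stay within `r
  -- * t` of `2 * j * t`, which gives disjointness, and the total shift is at most `1 / (2 * d) = 1
  -- - r`, which keeps it in the ball.
  set T : ℕ → Set (EuclideanSpace ℝ (Fin d)) := fun j =>
    (fun x => -((2 * j * t) • q) + x) ⁻¹' (r • ballSlab v t) with hT
  have hmem : ∀ j, ∀ x ∈ T j, ∃ y ∈ ballSlab v t, x = (2 * j * t) • q + r • y := by
    rintro j x ⟨y, hy, hyx⟩
    refine ⟨y, hy, ?_⟩
    simp only at hyx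
    rw [hyx]; abel
  have hmeas : ∀ j, volume (T j) = ENNReal.ofReal (r ^ d) * volume (ballSlab v t) := by
    intro j
    simp only [hT]
    rw [measure_preimage_add, Measure.addHaar_smul, finrank_euclideanSpace_fin,
      abs_of_pos (by positivity)]
  have hTm : ∀ j, MeasurableSet (T j) := fun j =>
    ((measurableSet_ballSlab v t).const_smul₀ r).preimage (measurable_const_add _)
  have hdot : ∀ j : ℕ, ∀ y : EuclideanSpace ℝ (Fin d),
      ((2 * j * t) • q + r • y).ofLp ⬝ᵥ v = 2 * j * t + r * (y.ofLp ⬝ᵥ v) := by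
    intro j y
    simp [hq, add_dotProduct, smul_dotProduct, hv]
  have hdisj : Pairwise (Function.onFun Disjoint T) := by
    have key : ∀ i j : ℕ, i < j → Disjoint (T i) (T j) := by
      intro i j hij
      rw [Set.disjoint_left]
      intro x hi hj
      obtain ⟨y, hy, h1⟩ := hmem i x hi
      obtain ⟨z, hz, h2⟩ := hmem j x hj
      have h3 := hdot i y
      rw [← h1, h2, hdot] at h3
      have hij' : (i : ℝ) + 1 ≤ j := by exact_mod_cast hij
      have h4 := abs_le.1 hy.2
      have h5 := abs_le.1 hz.2
      nlinarith
    intro i j hij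
    rcases lt_or_gt_of_ne hij with h | h
    · exact key i j h
    · exact (key j i h).symm
  have hsub : (⋃ j ∈ Finset.range N, T j) ⊆ Metric.ball (0 : EuclideanSpace ℝ (Fin d)) 1 := by
    intro x hx
    simp only [Set.mem_iUnion, Finset.mem_range] at hx
    obtain ⟨j, hj, hx⟩ := hx
    obtain ⟨y, hy, rfl⟩ := hmem j x hx
    rw [mem_ball_zero_iff]
    have h1 : (2 * j * t : ℝ) ≤ 1 / (2 * d) := by
      have : (j : ℝ) ≤ N := by exact_mod_cast hj.le
      calc (2 * j * t : ℝ) ≤ 2 * N * t := by gcongr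
        _ = 1 / (2 * d) := by rw [ht]; field_simp; norm_num
    calc ‖(2 * j * t) • q + r • y‖ ≤ ‖(2 * j * t) • q‖ + ‖r • y‖ := norm_add_le _ _
      _ = 2 * j * t + r * ‖y‖ := by
        rw [norm_smul, norm_smul, hqn, Real.norm_of_nonneg (by positivity),
          Real.norm_of_nonneg hr0.le, mul_one]
      _ < 2 * j * t + r * 1 := by
        have := mul_lt_mul_of_pos_left hy.1 hr0
        linarith
      _ ≤ 1 := by linarith
  have hsum : N * (ENNReal.ofReal (r ^ d) * volume (ballSlab v t)) ≤
      volume (Metric.ball (0 : EuclideanSpace ℝ (Fin d)) 1) := by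
    refine le_trans (le_of_eq ?_) (measure_mono hsub)
    rw [measure_biUnion_finset (fun i _ j _ hij => hdisj hij) fun j _ => hTm j]
    simp [hmeas]
  have hq4 : 1 ≤ 2 * ENNReal.ofReal (r ^ d) := by
    have : ENNReal.ofReal 1 ≤ ENNReal.ofReal (2 * r ^ d) :=
      ENNReal.ofReal_le_ofReal (by linarith [half_le_pow (d := d) (by omega)])
    rwa [ENNReal.ofReal_one, ENNReal.ofReal_mul (by norm_num), ENNReal.ofReal_ofNat] at this
  calc N * volume (ballSlab v t) = N * (1 * volume (ballSlab v t)) := by rw [one_mul]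
    _ ≤ N * (2 * ENNReal.ofReal (r ^ d) * volume (ballSlab v t)) := by gcongr
    _ = 2 * (N * (ENNReal.ofReal (r ^ d) * volume (ballSlab v t))) := by ring
    _ ≤ _ := by gcongr

/-- The law of a uniformly random unit vector. -/
noncomputable def sphereLaw (d : ℕ) : Measure (Metric.sphere (0 : EuclideanSpace ℝ (Fin d)) 1) :=
  ((volume : Measure (EuclideanSpace ℝ (Fin d))).toSphere Set.univ)⁻¹ •
    (volume : Measure (EuclideanSpace ℝ (Fin d))).toSphere

theorem isProbabilityMeasure_sphereLaw (hd : 2 ≤ d) : IsProbabilityMeasure (sphereLaw d) := by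
  have h0 : (volume : Measure (EuclideanSpace ℝ (Fin d))).toSphere Set.univ ≠ 0 := by
    rw [Measure.toSphere_apply_univ, finrank_euclideanSpace_fin]
    refine mul_ne_zero (by exact_mod_cast (by omega)) (Metric.measure_ball_pos _ _ one_pos).ne'
  refine ⟨?_⟩
  rw [sphereLaw, Measure.smul_apply, smul_eq_mul,
    ENNReal.inv_mul_cancel h0 (measure_ne_top _ _)]

/-- Spherical measure is `d` times the volume of the cone over a set, and the cone over the
spherical slab is contained in `ballSlab`. -/
theorem sphereLaw_slab_le (hd : 2 ≤ d) {v : Fin d → ℝ} (hv : v ⬝ᵥ v = 1) {N : ℕ} (hN : 0 < N) :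
    sphereLaw d {w | |w.val.ofLp ⬝ᵥ v| ≤ 1 / (4 * d * N)} ≤ ENNReal.ofReal (2 / N) := by
  set t : ℝ := 1 / (4 * d * N) with ht
  have ht0 : 0 ≤ t := by positivity
  have hmeas : MeasurableSet {w : Metric.sphere (0 : EuclideanSpace ℝ (Fin d)) 1 |
      |w.val.ofLp ⬝ᵥ v| ≤ t} := by
    refine measurableSet_le ?_ measurable_const
    have : Continuous fun x : Metric.sphere (0 : EuclideanSpace ℝ (Fin d)) 1 =>
        |x.val.ofLp ⬝ᵥ v| := by
      unfold dotProduct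
      fun_prop
    exact this.measurable
  have hsub : (Set.Ioo (0 : ℝ) 1) • ((↑) '' {w : Metric.sphere (0 : EuclideanSpace ℝ (Fin d)) 1 |
      |w.val.ofLp ⬝ᵥ v| ≤ t} : Set (EuclideanSpace ℝ (Fin d))) ⊆ ballSlab v t := by
    rintro _ ⟨a, ha, _, ⟨w, hw, rfl⟩, rfl⟩
    have hw1 : ‖w.val‖ = 1 := by simp
    have hw' : |w.val.ofLp ⬝ᵥ v| ≤ t := hw
    refine ⟨?_, ?_⟩
    · simp only [norm_smul, hw1, mul_one, Real.norm_of_nonneg ha.1.le]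
      exact ha.2
    · simp only [WithLp.ofLp_smul, smul_dotProduct, smul_eq_mul, abs_mul, abs_of_pos ha.1]
      nlinarith [ha.1, ha.2, abs_nonneg (w.val.ofLp ⬝ᵥ v)]
  have hball0 := (Metric.measure_ball_pos (volume : Measure (EuclideanSpace ℝ (Fin d))) 0 one_pos).ne'
  have hballt := (measure_ball_lt_top (μ := (volume : Measure (EuclideanSpace ℝ (Fin d))))
    (x := 0) (r := 1)).ne
  have hd0 : (d : ENNReal) ≠ 0 := by exact_mod_cast (by omega)
  rw [sphereLaw, Measure.smul_apply, smul_eq_mul, Measure.toSphere_apply_univ,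
    Measure.toSphere_apply' _ hmeas, finrank_euclideanSpace_fin]
  have hle := volume_ballSlab_le hd hv hN
  rw [← ht] at hle
  have hle2 := (measure_mono (μ := volume) hsub)
  rw [ENNReal.ofReal_div_of_pos (by positivity), ENNReal.ofReal_natCast, ENNReal.ofReal_ofNat,
    ENNReal.le_div_iff_mul_le (Or.inl (by exact_mod_cast hN.ne')) (Or.inl (by simp))]
  generalize volume (Metric.ball (0 : EuclideanSpace ℝ (Fin d)) 1) = b at *
  calc _ ≤ (d * b)⁻¹ * (d * volume (ballSlab v t)) * N := by gcongr
    _ = (d * b)⁻¹ * d * (N * volume (ballSlab v t)) := by ring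
    _ ≤ (d * b)⁻¹ * d * (2 * b) := by gcongr
    _ = (d * b)⁻¹ * (d * b) * 2 := by ring
    _ = 2 := by
      rw [ENNReal.inv_mul_cancel (mul_ne_zero hd0 hball0)
        (ENNReal.mul_ne_top (ENNReal.natCast_ne_top d) hballt), one_mul]

end sphere

/-! ### The total cost -/

/-- The number of power iterations per stage of Phase I, for the initial overlap `a`. -/
noncomputable def powerCount (a : ℝ) : ℕ := ⌈8 * Real.log (16 / a ^ 2)⌉₊

/-- A bound for the number of stages of Phase I. -/
noncomputable def stageCount (Δt : ℝ) : ℕ := ⌈Real.log (1 / Δt) / Real.log (4 / 3)⌉₊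

/-- A bound for the number of power iterations of Phase II. -/
noncomputable def finalCount (ε : ℝ) : ℕ := ⌈1 / 2 * Real.logb (9 / 7) (1 / ε)⌉₊

/-- A bound for the logarithms of the accuracy ratios of Phase I. -/
noncomputable def stageLog (Δt : ℝ) (m : ℕ) : ℝ := (2 * m + 10) * (6 + 2 * Real.log (1 / Δt))

section logs

variable {Δt : ℝ}

theorem pow_stageCount_le (h0 : 0 < Δt) : (3 / 4 : ℝ) ^ stageCount Δt ≤ Δt := by
  have hl : 0 < Real.log (4 / 3) := Real.log_pos (by norm_num)
  have h1 : Real.log (1 / Δt) ≤ stageCount Δt * Real.log (4 / 3) := by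
    rw [← div_le_iff₀ hl]; exact Nat.le_ceil _
  rw [← Real.log_pow, Real.log_le_log_iff (by positivity) (by positivity)] at h1
  have h2 : (3 / 4 : ℝ) ^ stageCount Δt = ((4 / 3 : ℝ) ^ stageCount Δt)⁻¹ := by
    rw [← inv_pow]; norm_num
  rw [h2]
  rw [one_div] at h1
  exact inv_le_of_inv_le₀ h0 h1

theorem stageCount_le (h0 : 0 < Δt) (h1 : Δt ≤ 1) :
    (stageCount Δt : ℝ) ≤ 4 * Real.log (1 / Δt) + 1 := by
  have hL : 0 ≤ Real.log (1 / Δt) := Real.log_nonneg (by rw [le_div_iff₀ h0]; linarith)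
  have h4 : (1 / 4 : ℝ) ≤ Real.log (4 / 3) := by
    have := Real.one_sub_inv_le_log_of_pos (show (0 : ℝ) < 4 / 3 by norm_num)
    norm_num at this ⊢
    linarith
  refine (Nat.ceil_lt_add_one (by positivity)).le.trans ?_
  have : Real.log (1 / Δt) / Real.log (4 / 3) ≤ 4 * Real.log (1 / Δt) := by
    rw [div_le_iff₀ (by linarith)]
    nlinarith
  linarith

theorem finalCount_le {ε : ℝ} (h0 : 0 < ε) (h1 : ε < 1) :
    (finalCount ε : ℝ) ≤ 9 / 4 * Real.log (1 / ε) + 1 := by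
  have hL : 0 ≤ Real.log (1 / ε) := Real.log_nonneg (by rw [le_div_iff₀ h0]; linarith)
  have h4 : (2 / 9 : ℝ) ≤ Real.log (9 / 7) := by
    have := Real.one_sub_inv_le_log_of_pos (show (0 : ℝ) < 9 / 7 by norm_num)
    norm_num at this ⊢
    linarith
  have h5 : Real.logb (9 / 7) (1 / ε) ≤ 9 / 2 * Real.log (1 / ε) := by
    rw [Real.logb, div_le_iff₀ (by linarith)]
    nlinarith
  have h6 : 0 ≤ Real.logb (9 / 7) (1 / ε) := div_nonneg hL (by linarith)
  refine (Nat.ceil_lt_add_one (by positivity)).le.trans ?_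
  linarith

theorem one_le_finalCount {ε : ℝ} (h0 : 0 < ε) (h1 : ε < 1) : 1 ≤ finalCount ε := by
  refine Nat.one_le_iff_ne_zero.2 (Nat.ceil_pos.2 ?_).ne'
  have := Real.logb_pos (b := 9 / 7) (x := 1 / ε) (by norm_num) (by rw [lt_div_iff₀ h0]; linarith)
  positivity

/-- The overlap bound gives `16 / a ^ 2 ≤ 256 * N ^ 2 * d ^ 2`; its additive constants are absorbed
by `log d ≥ 1 / 2`. -/
theorem powerCount_le {d N : ℕ} (hd : 2 ≤ d) (hN : 0 < N) {a : ℝ} (ha : 1 / (4 * d * N) < |a|) :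
    (powerCount a : ℝ) + 1 ≤ (8 * Real.log (256 * N ^ 2) * 2 + 20) * Real.log d := by
  have hd2 : (2 : ℝ) ≤ d := by exact_mod_cast hd
  have hN1 : (1 : ℝ) ≤ N := by exact_mod_cast hN
  have hlogd : 1 / 2 ≤ Real.log d := by
    have := Real.log_le_log (by norm_num) hd2
    linarith [Real.log_two_gt_d9]
  have hb : 0 < 1 / (4 * (d : ℝ) * N) := by positivity
  have h1 : 16 / a ^ 2 ≤ 256 * N ^ 2 * (d : ℝ) ^ 2 := by
    have h2 : (1 / (4 * (d : ℝ) * N)) ^ 2 ≤ a ^ 2 := by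
      rw [← sq_abs a]; gcongr
    calc 16 / a ^ 2 ≤ 16 / (1 / (4 * (d : ℝ) * N)) ^ 2 := by gcongr
      _ = _ := by field_simp; norm_num
  have ha2 : 0 < a ^ 2 := by
    rw [← sq_abs]; exact pow_pos (hb.trans ha) 2
  have hlogN : 0 ≤ Real.log (256 * N ^ 2) := Real.log_nonneg (by nlinarith)
  have h3 : Real.log (16 / a ^ 2) ≤ Real.log (256 * N ^ 2) + 2 * Real.log d := by
    refine (Real.log_le_log (by positivity) h1).trans (le_of_eq ?_)
    rw [Real.log_mul (by positivity) (by positivity), Real.log_pow]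
    norm_num
  have h4 : (powerCount a : ℝ) ≤ 8 * (Real.log (256 * N ^ 2) + 2 * Real.log d) + 1 := by
    refine (Nat.cast_le.2 (Nat.ceil_le_ceil (mul_le_mul_of_nonneg_left h3 (by norm_num)))).trans ?_
    exact (Nat.ceil_lt_add_one (by positivity)).le
  nlinarith

theorem log_flatRatio_le (h0 : 0 < Δt) (h1 : Δt ≤ 1) {m c : ℕ} (hc : c ≤ m) :
    Real.log (3 * flatRatio Δt m c) + 2 ≤ stageLog Δt m := by
  have hL : 0 ≤ Real.log (1 / Δt) := Real.log_nonneg (by rw [le_div_iff₀ h0]; linarith)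
  have hm : (0 : ℝ) ≤ m := Nat.cast_nonneg m
  have hl2 := Real.log_two_lt_d9
  have hl20 := Real.log_two_gt_d9
  unfold stageLog
  have hpw : ∀ (a k : ℕ), Real.log (2 ^ a * (1 / Δt) ^ k) = a * Real.log 2 + k * Real.log (1 / Δt) := by
    intro a k
    rw [Real.log_mul (by positivity) (by positivity), Real.log_pow, Real.log_pow]
  have hdiv : ∀ k : ℕ, (1 / Δt) ^ k = 1 / Δt ^ k := fun k => by rw [one_div_pow]
  unfold flatRatio
  split_ifs with h2 h3
  · have h4 : (10 : ℝ) ^ (2 * m + 1) ≤ 2 ^ (4 * (2 * m + 1)) := by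
      rw [pow_mul]; gcongr; norm_num
    have h5 : 3 * (32 * 10 ^ (2 * m + 1) / Δt ^ (2 * m)) ≤
        2 ^ (7 + 4 * (2 * m + 1)) * (1 / Δt) ^ (2 * m) := by
      rw [hdiv, pow_add 2 7, mul_one_div, ← mul_div_assoc]
      gcongr ?_ / _
      linarith [pow_pos (show (0 : ℝ) < 10 by norm_num) (2 * m + 1)]
    have h6 := Real.log_le_log (by positivity) h5
    rw [hpw] at h6
    push_cast at h6
    nlinarith [mul_nonneg hm hL]
  · have h5 : 3 * (1024 / Δt ^ 2) ≤ 2 ^ 12 * (1 / Δt) ^ 2 := by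
      rw [hdiv, mul_one_div, ← mul_div_assoc]
      gcongr
      norm_num
    have h6 := Real.log_le_log (by positivity) h5
    rw [hpw] at h6
    push_cast at h6
    nlinarith [mul_nonneg hm hL]
  · omega

/-- An absolute constant: Phase II therefore pays one logarithm only, that of the number of its
steps. -/
theorem log_flatRatio_final_le {m c : ℕ} (hc : m < c) :
    Real.log (3 * flatRatio Δt m c) + 2 ≤ 9 := by
  rw [flatRatio, if_neg (by omega), if_neg (by omega)]
  have h6 : Real.log (3 * 100) ≤ Real.log (2 ^ 9) := Real.log_le_log (by norm_num) (by norm_num)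
  rw [Real.log_pow] at h6
  push_cast at h6
  linarith [Real.log_two_lt_d9]

theorem stageLog_nonneg (h0 : 0 < Δt) (h1 : Δt ≤ 1) (m : ℕ) : 0 < stageLog Δt m := by
  have hL : 0 ≤ Real.log (1 / Δt) := Real.log_nonneg (by rw [le_div_iff₀ h0]; linarith)
  unfold stageLog; positivity

end logs

theorem Counted.cost_le_ofReal {α : Type} {m : Counted α} {κ N d : ℕ} {T : ENNReal} {t : ℝ}
    (ht : 0 ≤ t) (hT : T ≤ ENNReal.ofReal t)
    (h : m.cost ≤ (κ : ENNReal) * ((N : ENNReal) * (d : ENNReal) ^ 2 + d * T)) :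
    m.cost ≤ ENNReal.ofReal (κ * (N * (d : ℝ) ^ 2 + d * t)) := by
  refine h.trans ?_
  rw [ENNReal.ofReal_mul (by positivity), ENNReal.ofReal_add (by positivity) (by positivity),
    ENNReal.ofReal_mul (by positivity), ENNReal.ofReal_mul (by positivity),
    ENNReal.ofReal_pow (by positivity)]
  simp only [ENNReal.ofReal_natCast]
  gcongr

/-- Here `x` stands for `log d * (1 + log (1 / Δ))`, and both the number `n` of problems and the
logarithm `s` of the accuracy are `O(x)`; their product is the square in `Q`. The overhead per
problem is absorbed through `1 ≤ 4 * K * x`. -/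
theorem phaseOne_budget_le {κ n D G W K x a b s : ℝ} (hκ : 0 ≤ κ) (hn : n ≤ a * x) (hn0 : 0 ≤ n)
    (hG : 0 < G) (hW : 0 < W) (hK : 1 / 2 ≤ K) (hx : 1 / 2 ≤ x) (ha : 0 < a)
    (hs : s ≤ b * x) (hs0 : 0 ≤ s) :
    κ * (n * D ^ 2 + D * (G * (n * (W * K * D * s)))) ≤
      κ * (a * (4 + G * W * b)) * (K * D ^ 2 * x ^ 2) := by
  have hK0 : 0 < K := by linarith
  have hx0 : 0 < x := by linarith
  have h1 : 1 ≤ 4 * K * x := by nlinarith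
  calc κ * (n * D ^ 2 + D * (G * (n * (W * K * D * s))))
      = κ * (n * (D ^ 2 * (1 + G * W * K * s))) := by ring
    _ ≤ κ * ((a * x) * (D ^ 2 * (4 * K * x + G * W * K * (b * x)))) := by gcongr
    _ = _ := by ring

theorem phaseTwo_budget_le {κ n D G W K z : ℝ} (hκ : 0 ≤ κ) (hn : n ≤ 5 * z)
    (hG : 0 < G) (hW : 0 < W) (hK : 1 / 2 ≤ K) (hz : 0 ≤ z) :
    κ * (n * D ^ 2 + D * (G * (n * (W * K * D * 9)))) ≤
      κ * (5 * (2 + 9 * G * W)) * (K * D ^ 2 * z) := by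
  have hK0 : 0 < K := by linarith
  have h1 : 1 ≤ 2 * K := by linarith
  calc κ * (n * D ^ 2 + D * (G * (n * (W * K * D * 9))))
      = κ * (n * (D ^ 2 * (1 + 9 * G * W * K))) := by ring
    _ ≤ κ * ((5 * z) * (D ^ 2 * (2 * K + 9 * G * W * K))) := by gcongr
    _ = _ := by ring

theorem runSucceeds_of_cost_le {d : ℕ} [NeZero d] {opt : LSO d} {A : Matrix (Fin d) (Fin d) ℝ}
    {ρ : Fin d → ℝ} {p : Fin d → Fin d → ℝ} {tape : ℕ × ℕ → unitInterval} {c₂ Δt ε C₁ C₂ C K : ℝ}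
    {w₀ : Fin d → ℝ} (hC₁ : 0 < C₁) (hC₂ : 0 < C₂) (hC : C₁ + C₂ ≤ C) (hK : 0 ≤ K)
    (hZ : 0 ≤ Real.log (d / ε))
    (hval : 1 - ε ≤ ((shiftInvert opt A ρ p tape c₂ Δt ε w₀).val ⬝ᵥ p 0) ^ 2)
    (hb1 : (phaseOne opt A (p 0) tape c₂ Δt w₀).cost ≤ ENNReal.ofReal (C₁ * (K * (d : ℝ) ^ 2 *
      (Real.log d * (1 + Real.log (1 / (ρ 0 - ρ 1)))) ^ 2)))
    (hb2 : (phaseTwo opt A ρ p tape ε (phaseOne opt A (p 0) tape c₂ Δt w₀).val).cost ≤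
      ENNReal.ofReal (C₂ * (K * (d : ℝ) ^ 2 * Real.log (d / ε)))) :
    RunSucceeds opt A ρ p tape c₂ Δt ε w₀ C K := by
  have hC0 : 0 < C := by linarith
  have h0 : 0 ≤ K * (d : ℝ) ^ 2 := by positivity
  have hrun : (shiftInvert opt A ρ p tape c₂ Δt ε w₀).cost =
      (phaseOne opt A (p 0) tape c₂ Δt w₀).cost +
      (phaseTwo opt A ρ p tape ε (phaseOne opt A (p 0) tape c₂ Δt w₀).val).cost :=
    cost_bind _ _
  unfold RunSucceeds
  have hQ0 : 0 ≤ (Real.log d * (1 + Real.log (1 / (ρ 0 - ρ 1)))) ^ 2 := sq_nonneg _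
  generalize (Real.log d * (1 + Real.log (1 / (ρ 0 - ρ 1)))) ^ 2 = Q at *
  generalize Real.log (d / ε) = Z at *
  have hQZ : ∀ {B : ℝ}, 0 ≤ B → C₁ * B ≤ C * B ∧ C₂ * B ≤ C * B := fun hB =>
    ⟨mul_le_mul_of_nonneg_right (by linarith) hB, mul_le_mul_of_nonneg_right (by linarith) hB⟩
  have h2 : 0 ≤ K * (d : ℝ) ^ 2 * Z := mul_nonneg h0 hZ
  refine ⟨hval, costAtMost_of_cost_le (mul_nonneg hC0.le h2)
    (hb2.trans (ENNReal.ofReal_le_ofReal (hQZ h2).2)), ?_, fun hQ => ?_⟩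
  · have h1 := mul_nonneg h0 hQ0
    exact costAtMost_of_cost_le (mul_nonneg hC0.le h1)
      (hb1.trans (ENNReal.ofReal_le_ofReal (hQZ h1).1))
  · refine costAtMost_of_cost_le (mul_nonneg hC0.le h2) ?_
    rw [hrun]
    have hb1' := hb1.trans (ENNReal.ofReal_le_ofReal
      (mul_le_mul_of_nonneg_left (mul_le_mul_of_nonneg_left hQ h0) hC₁.le))
    refine (add_le_add hb1' hb2).trans ?_
    rw [← ENNReal.ofReal_add (mul_nonneg hC₁.le h2) (mul_nonneg hC₂.le h2), ← add_mul]
    exact ENNReal.ofReal_le_ofReal (mul_le_mul_of_nonneg_right hC h2)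

/-- The constants in the bounds for the number of iterations of Phase I. -/
noncomputable def overlapConst (N : ℕ) : ℝ := 8 * Real.log (256 * N ^ 2) * 2 + 20

/-- The loss from using an estimate of the eigenvalue gap. -/
noncomputable def estimateConst (c₁ : ℝ) : ℝ := 1 + Real.log (1 / c₁)

theorem overlapConst_pos {N : ℕ} (hN : 0 < N) : 0 < overlapConst N := by
  have hN1 : (1 : ℝ) ≤ N := by exact_mod_cast hN
  have : 0 ≤ Real.log (256 * N ^ 2) := Real.log_nonneg (by nlinarith)
  unfold overlapConst; positivity

theorem one_le_estimateConst {c₁ : ℝ} (hc₁ : 0 < c₁) (hc1 : c₁ ≤ 1) : 1 ≤ estimateConst c₁ := by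
  have : 0 ≤ Real.log (1 / c₁) := Real.log_nonneg (by rw [le_div_iff₀ hc₁]; linarith)
  unfold estimateConst; linarith

theorem half_le_log {d : ℕ} (hd : 2 ≤ d) : 1 / 2 ≤ Real.log d := by
  have hd2 : (2 : ℝ) ≤ d := by exact_mod_cast hd
  have := Real.log_le_log (by norm_num) hd2
  linarith [Real.log_two_gt_d9]

theorem log_one_div_nonneg {x : ℝ} (h0 : 0 < x) (h1 : x ≤ 1) : 0 ≤ Real.log (1 / x) :=
  Real.log_nonneg (by rw [le_div_iff₀ h0]; linarith)

/-- From `c₁ * Δ ≤ Δt` one gets `log (1 / Δt) ≤ log (1 / c₁) + log (1 / Δ)`, so using an estimate of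
the gap costs only the factor `estimateConst c₁`. -/
theorem phaseOne_parameters {d N : ℕ} {c₁ Δ Δt a : ℝ} (hc₁ : 0 < c₁) (hc1 : c₁ ≤ 1) (hd : 2 ≤ d)
    (hN : 0 < N) (hΔ0 : 0 < Δ) (hΔ1 : Δ ≤ 1) (hc : c₁ * Δ ≤ Δt) (ht1 : Δt ≤ 1)
    (ha : 1 / (4 * d * N) < |a|) :
    1 / 2 ≤ Real.log d * (1 + Real.log (1 / Δ)) ∧
    (((stageCount Δt + 1) * (powerCount a + 1) : ℕ) : ℝ) ≤
      overlapConst N * (4 * estimateConst c₁ + 2) * (Real.log d * (1 + Real.log (1 / Δ))) ∧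
    stageLog Δt (powerCount a) ≤ 8 * estimateConst c₁ * (2 * overlapConst N + 16) *
      (Real.log d * (1 + Real.log (1 / Δ))) := by
  have ht0 : 0 < Δt := (mul_pos hc₁ hΔ0).trans_le hc
  have hl1 := one_le_estimateConst hc₁ hc1
  have hα0 := overlapConst_pos hN
  have hL0 := half_le_log hd
  have hlc : estimateConst c₁ = 1 + Real.log (1 / c₁) := rfl
  have hlΔ' := log_one_div_nonneg hΔ0 hΔ1
  have hlΔ0 := log_one_div_nonneg ht0 ht1
  have hlΔ : Real.log (1 / Δt) ≤ Real.log (1 / c₁) + Real.log (1 / Δ) := by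
    have h1 : 1 / Δt ≤ (1 / c₁) * (1 / Δ) := by
      rw [one_div_mul_one_div]
      exact one_div_le_one_div_of_le (mul_pos hc₁ hΔ0) hc
    have h2 := Real.log_le_log (one_div_pos.2 ht0) h1
    rwa [Real.log_mul (by positivity) (one_div_pos.2 hΔ0).ne'] at h2
  have hmα : (powerCount a : ℝ) + 1 ≤ overlapConst N * Real.log d := powerCount_le hd hN ha
  have hS := stageCount_le ht0 ht1
  have hm0 : (0 : ℝ) ≤ powerCount a := Nat.cast_nonneg _
  unfold stageLog
  push_cast
  generalize (powerCount a : ℝ) = m at *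
  generalize (stageCount Δt : ℝ) = S at *
  generalize Real.log (1 / Δt) = lt at *
  generalize Real.log (1 / Δ) = e at *
  generalize Real.log (1 / c₁) = lc at *
  generalize estimateConst c₁ = l at *
  generalize overlapConst N = α at *
  generalize Real.log d = L at *
  have hle : lt ≤ l * (1 + e) := by
    have : 0 ≤ lc * e := mul_nonneg (by linarith) hlΔ'
    rw [hlc]; linarith
  have h1 : S + 1 ≤ (4 * l + 2) * (1 + e) := by linarith
  refine ⟨by nlinarith, ?_, ?_⟩
  · calc (S + 1) * (m + 1) ≤ ((4 * l + 2) * (1 + e)) * (α * L) := by gcongr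
      _ = _ := by ring
  · have h2 : 1 ≤ l * (1 + e) := by nlinarith
    calc (2 * m + 10) * (6 + 2 * lt) ≤ ((2 * α + 16) * L) * (8 * (l * (1 + e))) := by
          gcongr
          · linarith
          · linarith
      _ = _ := by ring

theorem phaseTwo_parameters {d : ℕ} {ε : ℝ} (hd : 2 ≤ d) (h0 : 0 < ε) (h1 : ε < 1) :
    (finalCount ε : ℝ) ≤ 5 * Real.log (d / ε) ∧ 0 ≤ Real.log (d / ε) := by
  have hd0 : (0 : ℝ) < d := by positivity
  have hZL : Real.log (d / ε) = Real.log d + Real.log (1 / ε) := by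
    rw [← Real.log_mul (by positivity) (by positivity)]; congr 1; ring
  have hlε := log_one_div_nonneg h0 h1.le
  have := half_le_log hd
  have := finalCount_le h0 h1
  constructor <;> linarith

/-- A run with few solver iterations is as fast as claimed. -/
theorem runSucceeds_of_counts {c₁ : ℝ} (hc₁ : 0 < c₁) (hc1 : c₁ ≤ 1) (κ N : ℕ) (hN : 0 < N)
    {W G : ℝ} (hW : 0 < W) (hG : 0 < G) :
    ∃ C₀ : ℝ, 0 < C₀ ∧ ∀ C, C₀ ≤ C → ∀ (d : ℕ) [NeZero d] (_ : 2 ≤ d)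
      (A : Matrix (Fin d) (Fin d) ℝ) (ρ : Fin d → ℝ) (p : Fin d → Fin d → ℝ) (c₂ Δt ε K : ℝ)
      (opt : LSO d) (sol : ℝ → ℝ → (Fin d → ℝ) → (ℕ → unitInterval) → Fin d → ℝ)
      (cnt : ℝ → ℝ → (Fin d → ℝ) → (ℕ → unitInterval) → ENNReal)
      (tape : ℕ × ℕ → unitInterval) (w₀ : Fin d → ℝ) (X : ℕ → FlatState d),
      GapProblem A ρ p c₂ Δt → c₁ * (ρ 0 - ρ 1) ≤ Δt →
      SolverSpec opt A ρ p (9 / 20 * Δt) sol cnt κ →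
      w₀ ⬝ᵥ w₀ = 1 → 1 / (4 * d * N) < |w₀ ⬝ᵥ p 0| → 0 < ε → ε < 1 → 1 / 2 ≤ K →
      X = flatRun ρ sol c₂ Δt (powerCount (w₀ ⬝ᵥ p 0)) (w₀, 1 + Δt, 0) (fun k j => tape (k, j)) →
      countOne ρ cnt Δt (powerCount (w₀ ⬝ᵥ p 0)) X (fun k j => tape (k, j))
        ((stageCount Δt + 1) * (powerCount (w₀ ⬝ᵥ p 0) + 1)) ≤
          ENNReal.ofReal (G * (((stageCount Δt + 1) * (powerCount (w₀ ⬝ᵥ p 0) + 1) : ℕ) *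
            (W * K * d * stageLog Δt (powerCount (w₀ ⬝ᵥ p 0))))) →
      countTwo ρ cnt Δt (powerCount (w₀ ⬝ᵥ p 0)) (finalCount ε) X (fun k j => tape (k, j))
        ((stageCount Δt + 1) * (powerCount (w₀ ⬝ᵥ p 0) + 1) + finalCount ε) ≤
          ENNReal.ofReal (G * (finalCount ε * (W * K * d * 9))) →
      RunSucceeds opt A ρ p tape c₂ Δt ε w₀ C K := by
  have hα0 := overlapConst_pos hN
  have hl1 := one_le_estimateConst hc₁ hc1
  have hC₁0 : 0 < ((κ : ℝ) + 25) * (overlapConst N * (4 * estimateConst c₁ + 2) *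
    (4 + G * W * (8 * estimateConst c₁ * (2 * overlapConst N + 16)))) := by positivity
  have hC₂0 : 0 < ((κ : ℝ) + 25) * (5 * (2 + 9 * G * W)) := by positivity
  refine ⟨_, add_pos hC₁0 hC₂0, ?_⟩
  intro C hC d _ hd A ρ p c₂ Δt ε K opt sol cnt tape w₀ X h hc₁Δ hspec hu hover hε0 hε1 hK hX hone
    htwo
  have hh : w₀ ⬝ᵥ p 0 ≠ 0 := by
    intro h0
    rw [h0, abs_zero] at hover
    exact absurd hover (not_lt.2 (by positivity))
  obtain ⟨hval, hcost1, hcost2⟩ := run_spec (A := A) (opt := opt) (κ := κ) h hspec hu hh rfl hX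
    (pow_stageCount_le h.est_pos) hε0 rfl (hone.trans_lt ENNReal.ofReal_lt_top).ne
    (htwo.trans_lt ENNReal.ofReal_lt_top).ne
  obtain ⟨hx, hn, hs⟩ := phaseOne_parameters (N := N) (d := d) (a := w₀ ⬝ᵥ p 0) hc₁ hc1 hd hN
    h.gap_pos h.gap_le_one hc₁Δ h.est_le_one hover
  obtain ⟨hM, hZ⟩ := phaseTwo_parameters hd hε0 hε1
  have hs0 := stageLog_nonneg h.est_pos h.est_le_one (powerCount (w₀ ⬝ᵥ p 0))
  have hK0 : 0 < K := by linarith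
  have hκ : ((κ + 25 : ℕ) : ℝ) = κ + 25 := by push_cast; ring
  refine runSucceeds_of_cost_le hC₁0 hC₂0 hC hK0.le hZ hval ?_ ?_
  · refine (Counted.cost_le_ofReal ?_ hone hcost1).trans (ENNReal.ofReal_le_ofReal ?_)
    · positivity
    · rw [hκ]
      exact phaseOne_budget_le (by positivity) hn (Nat.cast_nonneg _) hG hW hK hx (by positivity)
        hs hs0.le
  · refine (Counted.cost_le_ofReal ?_ htwo hcost2).trans (ENNReal.ofReal_le_ofReal ?_)
    · positivity
    · rw [hκ]
      exact phaseTwo_budget_le (by positivity) hM hG hW hK hZ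

/-! ### The work per least squares problem -/

/-- The constant in the number of solver iterations per problem. -/
noncomputable def workConst (c₁ : ℝ) : ℝ := 4 + 20 / (9 * c₁)

section work

variable {d : ℕ} [NeZero d] {A : Matrix (Fin d) (Fin d) ℝ} {ρ : Fin d → ℝ}
  {p : Fin d → Fin d → ℝ} {c₁ c₂ Δt : ℝ}

theorem GapProblem.of_hypotheses (hd : 2 ≤ d) (hc₁ : 0 < c₁) (hc : c₁ ≤ c₂) (hc₂ : c₂ ≤ 1)
    (hA : A.PosSemidef) (hρ : Antitone ρ) (horth : ∀ i j, p i ⬝ᵥ p j = if i = j then 1 else 0)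
    (heig : ∀ i, A.mulVec (p i) = ρ i • p i) (h1 : ρ 0 ≤ 1) (hgap : ρ 1 < ρ 0)
    (hΔt : Δt ∈ Set.Icc (c₁ * (ρ 0 - ρ 1)) (c₂ * (ρ 0 - ρ 1))) : GapProblem A ρ p c₂ Δt where
  symm i j := by simpa using hA.isHermitian.apply j i
  orth := horth
  eig := heig
  nonneg i := by
    have := hA.dotProduct_mulVec_nonneg (p i)
    rw [heig, dotProduct_smul] at this
    simpa [horth] using this
  le_one := h1
  gap_le i hi := by
    have : (1 : Fin d) ≤ i := by
      rw [Fin.le_def, Fin.val_one', Nat.mod_eq_of_lt (by omega)]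
      exact Nat.one_le_iff_ne_zero.2 fun h => hi (Fin.ext (by simpa using h))
    linarith [hρ this]
  gap_pos := by linarith
  est_pos := (mul_pos hc₁ (by linarith)).trans_le hΔt.1
  est_le := hΔt.2
  frac_pos := hc₁.trans_le hc
  frac_le := hc₂

theorem GapProblem.sum_gap (h : GapProblem A ρ p c₂ Δt) :
    ((d : ℝ) - 1) * (ρ 0 - ρ 1) ≤ ∑ i, (ρ 0 - ρ i) := by
  rw [← Finset.add_sum_erase _ _ (Finset.mem_univ 0), sub_self, zero_add]
  calc ((d : ℝ) - 1) * (ρ 0 - ρ 1) = ∑ i ∈ Finset.univ.erase (0 : Fin d), (ρ 0 - ρ 1) := by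
        rw [Finset.sum_const, Finset.card_erase_of_mem (Finset.mem_univ _), Finset.card_univ,
          Fintype.card_fin, nsmul_eq_mul, Nat.cast_sub (Nat.pos_of_ne_zero (NeZero.ne d)),
          Nat.cast_one]
    _ ≤ _ := Finset.sum_le_sum fun i hi => by linarith [h.gap_le i (Finset.ne_of_mem_erase hi)]

/-- All eigenvalues but the first are a gap below it, so the mean deficit is at least `(d - 1) / d`
gaps. The lower bound on `K` lets `K` absorb lower order terms. -/
theorem GapProblem.half_le_gsl (h : GapProblem A ρ p c₂ Δt) (hd : 2 ≤ d) :
    1 / 2 ≤ (ρ 0 - 1 / d * ∑ i, ρ i) / (ρ 0 - ρ 1) := by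
  have hd2 : (2 : ℝ) ≤ d := by exact_mod_cast hd
  have h1 := h.sum_gap
  rw [Finset.sum_sub_distrib, Finset.sum_const, Finset.card_univ, Fintype.card_fin,
    nsmul_eq_mul] at h1
  rw [le_div_iff₀ h.gap_pos]
  have h2 : (d : ℝ) * (ρ 0 - 1 / d * ∑ i, ρ i) = d * ρ 0 - ∑ i, ρ i := by field_simp
  have hg := h.gap_pos
  nlinarith

theorem GapProblem.gap_sq_le (h : GapProblem A ρ p c₂ Δt) (j : Fin d) :
    (ρ 0 - ρ 1) * (1 - p 0 j ^ 2) ≤ ρ 0 - A j j := by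
  have h1 := h.diag_shift_eq (ρ 0) j
  rw [h1, ← h.sum_sq_col j, ← Finset.add_sum_erase _ _ (Finset.mem_univ 0), add_sub_cancel_left,
    ← Finset.add_sum_erase _ (fun i => (ρ 0 - ρ i) * (p i j) ^ 2) (Finset.mem_univ 0), sub_self,
    zero_mul, zero_add, Finset.mul_sum]
  refine Finset.sum_le_sum fun i hi => mul_le_mul_of_nonneg_right ?_ (sq_nonneg _)
  linarith [h.gap_le i (Finset.ne_of_mem_erase hi)]

/-- For `0 ≤ t ≤ 1` one has `√(1 - t) ≥ 1 - t`; with `t = p 0 j ^ 2` the right-hand sides sum to `d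
- 1`, because `p 0` is a unit vector. -/
theorem GapProblem.half_le_acdm (h : GapProblem A ρ p c₂ Δt) (hd : 2 ≤ d) :
    1 / 2 ≤ (1 / d * ∑ i, Real.sqrt (ρ 0 - A i i)) / Real.sqrt (ρ 0 - ρ 1) := by
  have hd2 : (2 : ℝ) ≤ d := by exact_mod_cast hd
  have hg := Real.sqrt_pos.2 h.gap_pos
  have h1 : ∀ j, Real.sqrt (ρ 0 - ρ 1) * (1 - p 0 j ^ 2) ≤ Real.sqrt (ρ 0 - A j j) := by
    intro j
    have hy : p 0 j ^ 2 ≤ 1 := by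
      rw [← h.sum_sq_col j]
      exact Finset.single_le_sum (f := fun i => p i j ^ 2) (fun i _ => sq_nonneg _)
        (Finset.mem_univ 0)
    have hy0 := sq_nonneg (p 0 j)
    refine Real.le_sqrt_of_sq_le ?_
    rw [mul_pow, Real.sq_sqrt h.gap_pos.le]
    refine le_trans (mul_le_mul_of_nonneg_left ?_ h.gap_pos.le) (h.gap_sq_le j)
    nlinarith
  have h2 : Real.sqrt (ρ 0 - ρ 1) * (d - 1) ≤ ∑ i, Real.sqrt (ρ 0 - A i i) := by
    refine le_trans (le_of_eq ?_) (Finset.sum_le_sum fun j _ => h1 j)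
    rw [← Finset.mul_sum, Finset.sum_sub_distrib, h.sum_sq_row]
    simp
  rw [le_div_iff₀ hg]
  have h3 : (d : ℝ) * (1 / d * ∑ i, Real.sqrt (ρ 0 - A i i)) = ∑ i, Real.sqrt (ρ 0 - A i i) := by
    field_simp
  nlinarith

/-- The shift keeps a distance of at least `9 / 20 * c₁` gaps from `ρ 0`; this is how `c₁` enters
`workConst`. -/
theorem GapProblem.gap_div_le (h : GapProblem A ρ p c₂ Δt) (hc₁ : 0 < c₁)
    (hΔ : c₁ * (ρ 0 - ρ 1) ≤ Δt) {lam : ℝ} (hl : 9 / 20 * Δt ≤ lam - ρ 0) :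
    (ρ 0 - ρ 1) / (lam - ρ 0) ≤ 20 / (9 * c₁) := by
  have := h.est_pos
  rw [div_le_div_iff₀ (by linarith) (by positivity)]
  nlinarith

/-- The condition number equals `d + d * K * q`, with `q` the quotient of gap and shift distance,
and `1 + d` is absorbed by `3 * d * K`. -/
theorem GapProblem.gsl_work (h : GapProblem A ρ p c₂ Δt) (hd : 2 ≤ d) (hc₁ : 0 < c₁)
    (hΔ : c₁ * (ρ 0 - ρ 1) ≤ Δt) {lam : ℝ} (hl : 9 / 20 * Δt ≤ lam - ρ 0) :
    1 + (∑ i, (lam - ρ i)) / (lam - ρ 0) ≤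
      workConst c₁ * ((ρ 0 - 1 / d * ∑ i, ρ i) / (ρ 0 - ρ 1)) * d := by
  have hd2 : (2 : ℝ) ≤ d := by exact_mod_cast hd
  have hx : 0 < lam - ρ 0 := by linarith [h.est_pos]
  have hK := h.half_le_gsl hd
  have hq := h.gap_div_le hc₁ hΔ hl
  have hg := h.gap_pos
  have e1 : (∑ i, (lam - ρ i)) / (lam - ρ 0) =
      d + d * ((ρ 0 - 1 / d * ∑ i, ρ i) / (ρ 0 - ρ 1)) * ((ρ 0 - ρ 1) / (lam - ρ 0)) := by
    rw [Finset.sum_sub_distrib, Finset.sum_const, Finset.card_univ, Fintype.card_fin, nsmul_eq_mul]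
    have : (d : ℝ) ≠ 0 := by positivity
    field_simp
    ring
  rw [e1, workConst]
  generalize (ρ 0 - 1 / d * ∑ i, ρ i) / (ρ 0 - ρ 1) = K at *
  generalize (ρ 0 - ρ 1) / (lam - ρ 0) = q at *
  have hdK : 1 ≤ d * K := by nlinarith
  have h1 : d * K * q ≤ d * K * (20 / (9 * c₁)) := by gcongr
  nlinarith

theorem GapProblem.sqrtSum_bounds (h : GapProblem A ρ p c₂ Δt) (hd : 2 ≤ d) {lam : ℝ}
    (hx : 0 < lam - ρ 0) :
    0 < sqrtSum A lam ∧ 2 * (lam - ρ 0) ≤ sqrtSum A lam ^ 2 := by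
  have hd2 : (2 : ℝ) ≤ d := by exact_mod_cast hd
  have hs := Real.sqrt_pos.2 hx
  have h1 : d * Real.sqrt (lam - ρ 0) ≤ sqrtSum A lam := by
    calc d * Real.sqrt (lam - ρ 0) = ∑ i : Fin d, Real.sqrt (lam - ρ 0) := by simp
      _ ≤ _ := Finset.sum_le_sum fun i _ => Real.sqrt_le_sqrt
        (h.le_diag_shift (fun j => by linarith [h.le_zero j]) i)
  have h2 : 2 * Real.sqrt (lam - ρ 0) ≤ sqrtSum A lam := by nlinarith
  refine ⟨by linarith, ?_⟩
  have := Real.sq_sqrt hx.le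
  nlinarith

/-- Subadditivity of the square root separates the shift distance from the diagonal deficits `ρ 0 -
A i i`; the rest parallels `GapProblem.gsl_work`. -/
theorem GapProblem.acdm_work (h : GapProblem A ρ p c₂ Δt) (hd : 2 ≤ d) (hc₁ : 0 < c₁)
    (hΔ : c₁ * (ρ 0 - ρ 1) ≤ Δt) {lam : ℝ} (hl : 9 / 20 * Δt ≤ lam - ρ 0) :
    1 + sqrtSum A lam / Real.sqrt (lam - ρ 0) ≤
      workConst c₁ * ((1 / d * ∑ i, Real.sqrt (ρ 0 - A i i)) / Real.sqrt (ρ 0 - ρ 1)) * d := by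
  have hd2 : (2 : ℝ) ≤ d := by exact_mod_cast hd
  have hx : 0 < lam - ρ 0 := by linarith [h.est_pos]
  have hs := Real.sqrt_pos.2 hx
  have hK := h.half_le_acdm hd
  have hq := h.gap_div_le hc₁ hΔ hl
  have hg := Real.sqrt_pos.2 h.gap_pos
  have e0 : sqrtSum A lam ≤ d * Real.sqrt (lam - ρ 0) + ∑ i, Real.sqrt (ρ 0 - A i i) := by
    calc sqrtSum A lam ≤ ∑ i, (Real.sqrt (lam - ρ 0) + Real.sqrt (ρ 0 - A i i)) := by
          refine Finset.sum_le_sum fun i _ => ?_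
          have hA : 0 ≤ ρ 0 - A i i :=
            h.le_diag_shift (fun j => by linarith [h.le_zero j]) i
          refine Real.sqrt_le_iff.2 ⟨by positivity, ?_⟩
          nlinarith [Real.sq_sqrt hx.le, Real.sq_sqrt hA, Real.sqrt_nonneg (ρ 0 - A i i)]
      _ = _ := by simp [Finset.sum_add_distrib]
  have e1 : sqrtSum A lam / Real.sqrt (lam - ρ 0) ≤
      d + d * ((1 / d * ∑ i, Real.sqrt (ρ 0 - A i i)) / Real.sqrt (ρ 0 - ρ 1)) *
        (Real.sqrt (ρ 0 - ρ 1) / Real.sqrt (lam - ρ 0)) := by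
    rw [div_le_iff₀ hs]
    refine e0.trans (le_of_eq ?_)
    have : (d : ℝ) ≠ 0 := by positivity
    field_simp
  have e2 : Real.sqrt (ρ 0 - ρ 1) / Real.sqrt (lam - ρ 0) ≤ 1 + 20 / (9 * c₁) := by
    rw [← Real.sqrt_div h.gap_pos.le]
    refine Real.sqrt_le_iff.2 ⟨by positivity, hq.trans ?_⟩
    have : 0 < 20 / (9 * c₁) := by positivity
    nlinarith
  refine (add_le_add_right e1 1).trans ?_
  rw [workConst]
  generalize (1 / d * ∑ i, Real.sqrt (ρ 0 - A i i)) / Real.sqrt (ρ 0 - ρ 1) = K at *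
  generalize Real.sqrt (ρ 0 - ρ 1) / Real.sqrt (lam - ρ 0) = q at *
  have hdK : 1 ≤ d * K := by nlinarith
  have h1 : d * K * q ≤ d * K * (1 + 20 / (9 * c₁)) := by gcongr
  nlinarith

theorem one_le_flatRatio (h : GapProblem A ρ p c₂ Δt) (m c : ℕ) : 1 ≤ flatRatio Δt m c := by
  unfold flatRatio
  split_ifs
  · exact one_le_powerRatio h m
  · exact one_le_estimateRatio h
  · norm_num

end work

/-! ### Bounds for the numbers of solver iterations -/

section counts

variable {d : ℕ} [NeZero d] (ρ : Fin d → ℝ)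
  {sol : ℝ → ℝ → (Fin d → ℝ) → (ℕ → unitInterval) → Fin d → ℝ}
  {cnt : ℝ → ℝ → (Fin d → ℝ) → (ℕ → unitInterval) → ENNReal} (c₂ Δt : ℝ)

theorem countOne_eq (m : ℕ) (X : ℕ → FlatState d) (u : ℕ → ℕ → unitInterval) (N : ℕ) :
    countOne ρ cnt Δt m X u N = countWhere ρ Δt cnt m (fun c => c ≤ m) X u N := by
  unfold countOne countWhere
  exact Finset.sum_congr rfl fun k _ => by congr

theorem countTwo_eq (m M : ℕ) (X : ℕ → FlatState d) (u : ℕ → ℕ → unitInterval) (N : ℕ) :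
    countTwo ρ cnt Δt m M X u N =
      countWhere ρ Δt cnt m (fun c => m < c ∧ c ≤ m + M) X u N := by
  unfold countTwo countWhere
  exact Finset.sum_congr rfl fun k _ => by congr

-- The deterministic counterpart of `lintegral_countWhere_le`, for greedy coordinate descent.
open Classical in
theorem countWhere_le (m : ℕ) (P : ℕ → Prop) {B : ENNReal}
    (hB : ∀ c, P c → ∀ lam w u, Admissible ρ (9 / 20 * Δt) lam w →
      cnt (flatRatio Δt m c) lam w u ≤ B) (X : ℕ → FlatState d) (u : ℕ → ℕ → unitInterval)
    {N T : ℕ} (hT : ((Finset.range N).filter fun k => P (X k).2.2 ∧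
      Admissible ρ (9 / 20 * Δt) (X k).2.1 (X k).1).card ≤ T) :
    countWhere ρ Δt cnt m P X u N ≤ T * B := by
  calc countWhere ρ Δt cnt m P X u N ≤ ∑ k ∈ Finset.range N,
        if P (X k).2.2 ∧ Admissible ρ (9 / 20 * Δt) (X k).2.1 (X k).1 then B else 0 := by
        refine Finset.sum_le_sum fun k _ => ?_
        by_cases hP : P (X k).2.2
        · by_cases hA : Admissible ρ (9 / 20 * Δt) (X k).2.1 (X k).1
          · simp only [hP, hA, and_self, if_true, flatCount]
            exact hB _ hP _ _ _ hA
          · simp [hP, hA, flatCount]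
        · simp [hP]
    _ ≤ _ := by
        rw [← Finset.sum_filter, Finset.sum_const, nsmul_eq_mul]
        gcongr

-- Markov's inequality with slack `G`, applied to the total count of a phase after currying the
-- tape.
open Classical in
theorem prob_countWhere_le (hsol : SolverMeasurable sol) (hcnt : SolverMeasurable cnt) (m : ℕ)
    (P : ℕ → Prop) {B G : ℝ} (hB0 : 0 < B) (hG : 0 < G)
    (hB : ∀ c, P c → ∀ lam w, Admissible ρ (9 / 20 * Δt) lam w →
      ∫⁻ a, cnt (flatRatio Δt m c) lam w a ∂rowLaw ≤ ENNReal.ofReal B) (s : FlatState d)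
    {N T : ℕ} (hT0 : 0 < T)
    (hT : ∀ u, ((Finset.range N).filter fun k => P (flatRun ρ sol c₂ Δt m s u k).2.2 ∧
      Admissible ρ (9 / 20 * Δt) (flatRun ρ sol c₂ Δt m s u k).2.1
        (flatRun ρ sol c₂ Δt m s u k).1).card ≤ T) :
    (Measure.infinitePi fun _ : ℕ × ℕ => (volume : Measure unitInterval))
      {t | ENNReal.ofReal (G * (T * B)) < countWhere ρ Δt cnt m P
        (flatRun ρ sol c₂ Δt m s fun k j => t (k, j)) (fun k j => t (k, j)) N} ≤
      ENNReal.ofReal (1 / G) := by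
  have hmeas : Measurable fun u =>
      countWhere ρ Δt cnt m P (flatRun ρ sol c₂ Δt m s u) u N :=
    measurable_const.countWhere' ρ c₂ Δt hsol hcnt m P measurable_id N
  have hpre := measurePreserving_rows.measure_preimage
    (measurableSet_lt (measurable_const (a := ENNReal.ofReal (G * (T * B)))) hmeas).nullMeasurableSet
  refine hpre.le.trans ?_
  have hT0' : (0 : ℝ) < T := by exact_mod_cast hT0
  have hE := lintegral_countWhere_le ρ c₂ Δt hsol hcnt m P hB s hT
  calc _ ≤ (Measure.infinitePi fun _ : ℕ => rowLaw) {u | ENNReal.ofReal (G * (T * B)) ≤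
        countWhere ρ Δt cnt m P (flatRun ρ sol c₂ Δt m s u) u N} :=
        measure_mono fun u (hu : ENNReal.ofReal (G * (T * B)) < countWhere ρ Δt cnt m P
          (flatRun ρ sol c₂ Δt m s u) u N) => hu.le
    _ ≤ (∫⁻ u, countWhere ρ Δt cnt m P (flatRun ρ sol c₂ Δt m s u) u N
        ∂(Measure.infinitePi fun _ : ℕ => rowLaw)) / ENNReal.ofReal (G * (T * B)) :=
        meas_ge_le_lintegral_div hmeas.aemeasurable
          (ENNReal.ofReal_pos.2 (by positivity)).ne' ENNReal.ofReal_ne_top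
    _ ≤ (T * ENNReal.ofReal B) / ENNReal.ofReal (G * (T * B)) := by gcongr
    _ = ENNReal.ofReal (1 / G) := by
        rw [← ENNReal.ofReal_natCast T, ← ENNReal.ofReal_mul hT0'.le,
          ← ENNReal.ofReal_div_of_pos (by positivity)]
        congr 1
        field_simp

open Classical in
/-- With a random initial vector, a budget that depends on the initial vector is exceeded with
small probability. -/
theorem prod_countWhere_le {Θ : Type*} [MeasurableSpace Θ] (ν : Measure Θ) [IsProbabilityMeasure ν]
    (hsol : SolverMeasurable sol) (hcnt : SolverMeasurable cnt) {m : Θ → ℕ} (hm : Measurable m)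
    {s : Θ → FlatState d} (hs : Measurable s) (P : ℕ → ℕ → Prop) {B : ℕ → ℝ} {G : ℝ}
    (hB0 : ∀ m, 0 < B m) (hG : 0 < G)
    (hB : ∀ m c, P m c → ∀ lam w, Admissible ρ (9 / 20 * Δt) lam w →
      ∫⁻ a, cnt (flatRatio Δt m c) lam w a ∂rowLaw ≤ ENNReal.ofReal (B m))
    {N T : ℕ → ℕ} (hT0 : ∀ m, 0 < T m)
    (hT : ∀ m s u, ((Finset.range (N m)).filter fun k => P m (flatRun ρ sol c₂ Δt m s u k).2.2 ∧
      Admissible ρ (9 / 20 * Δt) (flatRun ρ sol c₂ Δt m s u k).2.1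
        (flatRun ρ sol c₂ Δt m s u k).1).card ≤ T m) :
    (ν.prod (Measure.infinitePi fun _ : ℕ × ℕ => (volume : Measure unitInterval)))
      {q | ENNReal.ofReal (G * (T (m q.1) * B (m q.1))) < countWhere ρ Δt cnt (m q.1) (P (m q.1))
        (flatRun ρ sol c₂ Δt (m q.1) (s q.1) fun k j => q.2 (k, j)) (fun k j => q.2 (k, j))
          (N (m q.1))} ≤
      ENNReal.ofReal (1 / G) := by
  have hrows : Measurable fun q : Θ × (ℕ × ℕ → unitInterval) => fun k j => q.2 (k, j) :=
    measurePreserving_rows.measurable.comp measurable_snd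
  have hcount : Measurable fun q : Θ × (ℕ × ℕ → unitInterval) =>
      countWhere ρ Δt cnt (m q.1) (P (m q.1))
        (flatRun ρ sol c₂ Δt (m q.1) (s q.1) fun k j => q.2 (k, j)) (fun k j => q.2 (k, j))
          (N (m q.1)) :=
    Measurable.comp_index (f := fun (q : Θ × (ℕ × ℕ → unitInterval)) n =>
      countWhere ρ Δt cnt n (P n) (flatRun ρ sol c₂ Δt n (s q.1) fun k j => q.2 (k, j))
        (fun k j => q.2 (k, j)) (N n))
      (fun n => (hs.comp measurable_fst).countWhere' ρ c₂ Δt hsol hcnt n (P n) hrows (N n))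
      (hm.comp measurable_fst)
  have hbound : Measurable fun q : Θ × (ℕ × ℕ → unitInterval) =>
      ENNReal.ofReal (G * (T (m q.1) * B (m q.1))) :=
    (Measurable.of_discrete (f := fun n => ENNReal.ofReal (G * (T n * B n)))).comp
      (hm.comp measurable_fst)
  rw [Measure.prod_apply (measurableSet_lt hbound hcount)]
  calc _ ≤ ∫⁻ _, ENNReal.ofReal (1 / G) ∂ν :=
        lintegral_mono fun x => prob_countWhere_le ρ c₂ Δt hsol hcnt (m x) (P (m x)) (hB0 _) hG
          (hB _) (s x) (hT0 _) (hT _ _)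
    _ = _ := by simp

end counts

/-! ### The runtime of the two variants -/

section final

variable {d : ℕ} [NeZero d] {A : Matrix (Fin d) (Fin d) ℝ} {ρ : Fin d → ℝ}
  {p : Fin d → Fin d → ℝ} {c₁ c₂ Δt : ℝ}

theorem sphere_dot_self (w : Metric.sphere (0 : EuclideanSpace ℝ (Fin d)) 1) :
    w.val.ofLp ⬝ᵥ w.val.ofLp = 1 := by
  have h : ‖w.val‖ = 1 := by simp
  rw [EuclideanSpace.norm_eq, Real.sqrt_eq_one] at h
  refine Eq.trans ?_ h
  simp [dotProduct, sq]

theorem workConst_pos (hc₁ : 0 < c₁) : 0 < workConst c₁ := by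
  unfold workConst; positivity

/-- The number of steps of greedy coordinate descent. -/
theorem gsl_count_le (h : GapProblem A ρ p c₂ Δt) (hd : 2 ≤ d) (hc₁ : 0 < c₁)
    (hΔ : c₁ * (ρ 0 - ρ 1) ≤ Δt) {lam R t : ℝ} (hl : 9 / 20 * Δt ≤ lam - ρ 0) (hR : 1 ≤ R)
    (ht : Real.log (3 * R) + 2 ≤ t) :
    (⌈Real.log R / ((lam - ρ 0) / ∑ i, (lam - ρ i))⌉₊ : ENNReal) ≤ ENNReal.ofReal
      (workConst c₁ * ((ρ 0 - 1 / d * ∑ i, ρ i) / (ρ 0 - ρ 1)) * d * t) := by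
  have hx : 0 < lam - ρ 0 := by linarith [h.est_pos]
  have hw := h.gsl_work hd hc₁ hΔ hl
  have hR0 := Real.log_nonneg hR
  have hR3 : Real.log R ≤ Real.log (3 * R) := Real.log_le_log (by linarith) (by linarith)
  have hq : 0 ≤ (∑ i, (lam - ρ i)) / (lam - ρ 0) :=
    div_nonneg (Finset.sum_nonneg fun i _ => by linarith [h.le_zero i]) hx.le
  rw [← ENNReal.ofReal_natCast]
  refine ENNReal.ofReal_le_ofReal ?_
  rw [div_div_eq_mul_div, mul_div_assoc]
  refine (Nat.ceil_lt_add_one (mul_nonneg hR0 hq)).le.trans ?_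
  generalize (∑ i, (lam - ρ i)) / (lam - ρ 0) = q at *
  generalize workConst c₁ * ((ρ 0 - 1 / d * ∑ i, ρ i) / (ρ 0 - ρ 1)) * d = V at *
  nlinarith

/-- The expected number of steps of NU-ACDM. -/
theorem lintegral_acdm_count_le (h : GapProblem A ρ p c₂ Δt) (hd : 2 ≤ d) (hc₁ : 0 < c₁)
    (hΔ : c₁ * (ρ 0 - ρ 1) ≤ Δt) {lam R t : ℝ} (hl : 9 / 20 * Δt ≤ lam - ρ 0) (hR : 1 ≤ R)
    (ht : Real.log (3 * R) + 2 ≤ t) (w : Fin d → ℝ) :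
    ∫⁻ u, acdmCount A (ρ 0) ρ p R lam w u ∂rowLaw ≤ ENNReal.ofReal
      (workConst c₁ * ((1 / d * ∑ i, Real.sqrt (ρ 0 - A i i)) / Real.sqrt (ρ 0 - ρ 1)) * d * t) := by
  have hx : 0 < lam - ρ 0 := by linarith [h.est_pos]
  obtain ⟨hS0, hS⟩ := h.sqrtSum_bounds hd hx
  have hw := h.acdm_work hd hc₁ hΔ hl
  have hR3 : 0 ≤ Real.log (3 * R) := Real.log_nonneg (by linarith)
  refine (lintegral_acdmCount_le h.toEigenSystem hx (fun i => by linarith [h.le_zero i]) hS hS0 w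
    hR).trans (ENNReal.ofReal_le_ofReal ?_)
  have hq : 0 ≤ sqrtSum A lam / Real.sqrt (lam - ρ 0) := by positivity
  rw [mul_comm]
  exact mul_le_mul hw ht (by linarith) (by linarith)

theorem card_filter_range_le (n : ℕ) (P : ℕ → Prop) {_ : DecidablePred P} :
    ((Finset.range n).filter P).card ≤ n :=
  (Finset.card_filter_le _ _).trans (Finset.card_range n).le

theorem two_div_ceil_le {δ : ℝ} (hδ : 0 < δ) : 0 < ⌈6 / δ⌉₊ ∧ 2 / (⌈6 / δ⌉₊ : ℝ) ≤ δ / 3 := by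
  have h1 : 6 / δ ≤ ⌈6 / δ⌉₊ := Nat.le_ceil _
  have h2 : 0 < ⌈6 / δ⌉₊ := Nat.ceil_pos.2 (by positivity)
  refine ⟨h2, ?_⟩
  have h3 : (0 : ℝ) < ⌈6 / δ⌉₊ := by exact_mod_cast h2
  rw [div_le_iff₀ hδ] at h1
  rw [div_le_iff₀ h3]
  linarith

/-- The initial overlap is rarely small. -/
theorem initLaw_slab_le (hd : 2 ≤ d) {v : Fin d → ℝ} (hv : v ⬝ᵥ v = 1) {δ : ℝ} (hδ : 0 < δ) :
    initLaw d ({w | |w.val.ofLp ⬝ᵥ v| ≤ 1 / (4 * d * (⌈6 / δ⌉₊ : ℕ))} ×ˢ Set.univ) ≤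
      ENNReal.ofReal (δ / 3) := by
  obtain ⟨hN, hNδ⟩ := two_div_ceil_le hδ
  change ((sphereLaw d).prod _) _ ≤ _
  rw [Measure.prod_prod, measure_univ, mul_one]
  exact (sphereLaw_slab_le hd hv hN).trans (ENNReal.ofReal_le_ofReal hNδ)

theorem measurable_sphere_val :
    Measurable fun w : Metric.sphere (0 : EuclideanSpace ℝ (Fin d)) 1 => w.val.ofLp := by
  have : Continuous fun w : Metric.sphere (0 : EuclideanSpace ℝ (Fin d)) 1 => w.val.ofLp := by
    fun_prop
  exact this.measurable

theorem measurable_powerCount : Measurable powerCount := by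
  have h1 : Measurable fun a : ℝ => 8 * Real.log (16 / a ^ 2) :=
    (Real.measurable_log.comp ((measurable_id.pow_const 2).const_div 16)).const_mul 8
  exact Nat.measurable_ceil.comp h1

theorem measure_failure_le {Ω : Type*} [MeasurableSpace Ω] (μ : Measure Ω) {P : Ω → Prop}
    {a b c : Set Ω} {x y z : ENNReal} (h : ∀ ω, ω ∉ a → ω ∉ b → ω ∉ c → P ω) (ha : μ a ≤ x)
    (hb : μ b ≤ y) (hc : μ c ≤ z) : μ {ω | ¬ P ω} ≤ x + y + z := by
  have hsub : {ω | ¬ P ω} ⊆ a ∪ b ∪ c := by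
    intro ω hω
    by_contra hbad
    simp only [Set.mem_union, not_or] at hbad
    exact hω (h ω hbad.1.1 hbad.1.2 hbad.2)
  exact (measure_mono hsub).trans ((measure_union_le _ _).trans
    (add_le_add ((measure_union_le _ _).trans (add_le_add ha hb)) hc))

end final

/-- The iteration bound is deterministic, so `G = 1` works and a small initial overlap is the only
possible failure. -/
theorem gsl_runtime {c₁ δ : ℝ} (hc₁ : 0 < c₁) (hc1 : c₁ ≤ 1) (hδ : 0 < δ) :
    ∃ C₀ : ℝ, 0 < C₀ ∧ ∀ C, C₀ ≤ C → ∀ (d : ℕ) [NeZero d] (_ : 2 ≤ d)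
      (A : Matrix (Fin d) (Fin d) ℝ) (ρ : Fin d → ℝ) (p : Fin d → Fin d → ℝ) (c₂ Δt ε : ℝ),
      GapProblem A ρ p c₂ Δt → c₁ * (ρ 0 - ρ 1) ≤ Δt → 0 < ε → ε < 1 →
      ∀ pick : (Fin d → ℝ) → Fin d, IsArgmax pick →
        initLaw d {ω | ¬ RunSucceeds (gsl A pick) A ρ p ω.2 c₂ Δt ε ω.1.val.ofLp C
          ((ρ 0 - 1 / d * ∑ i, ρ i) / (ρ 0 - ρ 1))} ≤ ENNReal.ofReal δ := by
  classical
  obtain ⟨C₀, hC₀, H⟩ := runSucceeds_of_counts hc₁ hc1 11 ⌈6 / δ⌉₊ (two_div_ceil_le hδ).1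
    (workConst_pos hc₁) one_pos
  refine ⟨C₀, hC₀, fun C hC d _ hd A ρ p c₂ Δt ε h hΔ hε0 hε1 pick hpick => ?_⟩
  refine (measure_mono ?_).trans ((initLaw_slab_le hd (v := p 0) (by simp [h.orth]) hδ).trans
    (ENNReal.ofReal_le_ofReal (by linarith)))
  rintro ω hω
  refine ⟨?_, trivial⟩
  by_contra hslab
  apply hω
  have hspec := gsl_spec h hpick (mul_pos (by norm_num : (0 : ℝ) < 9 / 20) h.est_pos)
  refine H C hC d hd A ρ p c₂ Δt ε _ _ _ _ ω.2 _ _ h hΔ hspec (sphere_dot_self ω.1)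
    (not_le.1 hslab) hε0 hε1 (h.half_le_gsl hd) rfl ?_ ?_
  · rw [countOne_eq, one_mul, ENNReal.ofReal_mul (by positivity), ENNReal.ofReal_natCast]
    refine countWhere_le ρ Δt _ _ (fun c hc lam w u hadm => gsl_count_le h hd hc₁ hΔ hadm.2.1
      (one_le_flatRatio h _ c) (log_flatRatio_le h.est_pos h.est_le_one hc)) _ _ ?_
    exact card_filter_range_le _ _
  · rw [countTwo_eq, one_mul, ENNReal.ofReal_mul (by positivity), ENNReal.ofReal_natCast]
    refine countWhere_le ρ Δt _ _ (fun c hc lam w u hadm => gsl_count_le h hd hc₁ hΔ hadm.2.1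
      (one_le_flatRatio h _ c) (log_flatRatio_final_le hc.1)) _ _ ?_
    convert card_phaseTwo_le ρ c₂ Δt _ _ _ _ _

/-- Three failure events of probability at most `δ / 3` each: a small initial overlap, and an
exceeded iteration budget in either phase. This fixes `N = ⌈6 / δ⌉₊` and the Markov slack `3 / δ`.
-/
theorem acdm_runtime {c₁ δ : ℝ} (hc₁ : 0 < c₁) (hc1 : c₁ ≤ 1) (hδ : 0 < δ) :
    ∃ C₀ : ℝ, 0 < C₀ ∧ ∀ C, C₀ ≤ C → ∀ (d : ℕ) [NeZero d] (_ : 2 ≤ d)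
      (A : Matrix (Fin d) (Fin d) ℝ) (ρ : Fin d → ℝ) (p : Fin d → Fin d → ℝ) (c₂ Δt ε : ℝ),
      GapProblem A ρ p c₂ Δt → c₁ * (ρ 0 - ρ 1) ≤ Δt → 0 < ε → ε < 1 →
        initLaw d {ω | ¬ RunSucceeds (nuACDM A (ρ 0)) A ρ p ω.2 c₂ Δt ε ω.1.val.ofLp C
          ((1 / d * ∑ i, Real.sqrt (ρ 0 - A i i)) / Real.sqrt (ρ 0 - ρ 1))} ≤
          ENNReal.ofReal δ := by
  classical
  obtain ⟨C₀, hC₀, H⟩ := runSucceeds_of_counts hc₁ hc1 29 ⌈6 / δ⌉₊ (two_div_ceil_le hδ).1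
    (workConst_pos hc₁) (G := 3 / δ) (by positivity)
  refine ⟨C₀, hC₀, fun C hC d _ hd A ρ p c₂ Δt ε h hΔ hε0 hε1 => ?_⟩
  have := isProbabilityMeasure_sphereLaw hd
  have hK := h.half_le_acdm hd
  have hd0 : (0 : ℝ) < d := by positivity
  have hspec := nuACDM_spec h (mul_pos (by norm_num : (0 : ℝ) < 9 / 20) h.est_pos)
  have hsol : SolverMeasurable (acdmSol A (ρ 0) ρ p) := fun R =>
    measurable_fst.fst.acdmSol' A (ρ 0) ρ p R measurable_fst.snd measurable_snd
  have hcnt : SolverMeasurable (acdmCount A (ρ 0) ρ p) := fun R =>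
    measurable_fst.fst.acdmCount' A (ρ 0) ρ p R measurable_fst.snd measurable_snd
  have hwork := fun (lam : ℝ) (R t : ℝ) (hl : 9 / 20 * Δt ≤ lam - ρ 0) hR ht w =>
    lintegral_acdm_count_le (R := R) (t := t) h hd hc₁ hΔ hl hR ht w
  set K := (1 / d * ∑ i, Real.sqrt (ρ 0 - A i i)) / Real.sqrt (ρ 0 - ρ 1)
  have hK0 : 0 < K := by linarith
  have hW0 : 0 < workConst c₁ * K * d := mul_pos (mul_pos (workConst_pos hc₁) hK0) hd0
  have hlog := stageLog_nonneg h.est_pos h.est_le_one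
  have hm : Measurable fun w : Metric.sphere (0 : EuclideanSpace ℝ (Fin d)) 1 =>
      powerCount (w.val.ofLp ⬝ᵥ p 0) :=
    measurable_powerCount.comp (measurable_sphere_val.dotProduct' measurable_const)
  have hs : Measurable fun w : Metric.sphere (0 : EuclideanSpace ℝ (Fin d)) 1 =>
      ((w.val.ofLp, 1 + Δt, 0) : FlatState d) := measurable_sphere_val.prodMk measurable_const
  have hone := prod_countWhere_le ρ c₂ Δt (sphereLaw d) hsol hcnt hm hs (fun m c => c ≤ m)
    (B := fun m => workConst c₁ * K * d * stageLog Δt m) (G := 3 / δ)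
    (fun m => mul_pos hW0 (hlog m)) (by positivity)
    (fun m c hc lam w hadm => hwork lam _ _ hadm.2.1 (one_le_flatRatio h m c)
      (log_flatRatio_le h.est_pos h.est_le_one hc) w)
    (N := fun m => (stageCount Δt + 1) * (m + 1)) (T := fun m => (stageCount Δt + 1) * (m + 1))
    (fun m => by positivity)
    (fun m s u => card_filter_range_le _ _)
  have htwo := prod_countWhere_le ρ c₂ Δt (sphereLaw d) hsol hcnt hm hs
    (fun m c => m < c ∧ c ≤ m + finalCount ε)
    (B := fun _ => workConst c₁ * K * d * 9) (G := 3 / δ)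
    (fun m => by positivity) (by positivity)
    (fun m c hc lam w hadm => hwork lam _ _ hadm.2.1 (one_le_flatRatio h m c)
      (log_flatRatio_final_le hc.1) w)
    (N := fun m => (stageCount Δt + 1) * (m + 1) + finalCount ε) (T := fun _ => finalCount ε)
    (fun m => one_le_finalCount hε0 hε1)
    (fun m s u => by convert card_phaseTwo_le ρ c₂ Δt m _ _ s u)
  rw [one_div_div] at hone htwo
  have hslab := initLaw_slab_le hd (v := p 0) (by simp [h.orth]) hδ
  refine (measure_failure_le (initLaw d) ?_ hslab hone htwo).trans ?_
  · intro ω h0 h1 h2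
    refine H C hC d hd A ρ p c₂ Δt ε K _ _ _ ω.2 _ _ h hΔ hspec (sphere_dot_self ω.1)
      (not_le.1 fun hle => h0 ⟨hle, trivial⟩) hε0 hε1 hK rfl ?_ ?_
    · rw [countOne_eq]
      exact not_lt.1 h1
    · rw [countTwo_eq]
      exact not_lt.1 h2
  · rw [← ENNReal.ofReal_add (by positivity) (by positivity),
      ← ENNReal.ofReal_add (by positivity) (by positivity)]
    exact ENNReal.ofReal_le_ofReal (by linarith)

theorem mainTheorem5 (c₁ c₂ δ : ℝ) (hc₁ : 0 < c₁) (hc : c₁ ≤ c₂) (hc₂ : c₂ ≤ 1) (hδ : 0 < δ) :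
    ∃ C : ℝ, 0 < C ∧
      ∀ (d : ℕ) [NeZero d] (_ : 2 ≤ d) (A : Matrix (Fin d) (Fin d) ℝ) (ρ : Fin d → ℝ)
        (p : Fin d → Fin d → ℝ) (Δt ε : ℝ),
        A.PosSemidef →
        Antitone ρ →
        (∀ i j, p i ⬝ᵥ p j = if i = j then 1 else 0) →
        (∀ i, A.mulVec (p i) = ρ i • p i) →
        ρ 0 ≤ 1 →
        ρ 1 < ρ 0 →
        Δt ∈ Set.Icc (c₁ * (ρ 0 - ρ 1)) (c₂ * (ρ 0 - ρ 1)) →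
        ε ∈ Set.Ioo (0 : ℝ) 1 →
        (∀ pick : (Fin d → ℝ) → Fin d, IsArgmax pick →
          initLaw d {ω | ¬ RunSucceeds (gsl A pick) A ρ p ω.2 c₂ Δt ε ω.1.val.ofLp C
            ((ρ 0 - 1 / d * ∑ i, ρ i) / (ρ 0 - ρ 1))} ≤ ENNReal.ofReal δ) ∧
        initLaw d {ω | ¬ RunSucceeds (nuACDM A (ρ 0)) A ρ p ω.2 c₂ Δt ε ω.1.val.ofLp C
            ((1 / d * ∑ i, Real.sqrt (ρ 0 - A i i)) / Real.sqrt (ρ 0 - ρ 1))} ≤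
          ENNReal.ofReal δ := by
  obtain ⟨C₁, hC₁, H₁⟩ := gsl_runtime hc₁ (hc.trans hc₂) hδ
  obtain ⟨C₂, -, H₂⟩ := acdm_runtime hc₁ (hc.trans hc₂) hδ
  -- Both runtime bounds hold for every larger constant, so one constant serves the two solvers.
  refine ⟨max C₁ C₂, lt_max_of_lt_left hC₁, ?_⟩
  intro d _ hd A ρ p Δt ε hA hρ horth heig h1 hgap hΔt hε
  have h := GapProblem.of_hypotheses hd hc₁ hc hc₂ hA hρ horth heig h1 hgap hΔt
  exact ⟨H₁ _ (le_max_left _ _) d hd A ρ p c₂ Δt ε h hΔt.1 hε.1 hε.2,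
    H₂ _ (le_max_right _ _) d hd A ρ p c₂ Δt ε h hΔt.1 hε.1 hε.2⟩
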